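/- **Corollary (Euclidean space).** Let $d\ge 3$, $T\ge 1$, $G>0$, $\mathcal X=\{x\in\mathbb R^d:\|x\|_2\le 1\}$, $\psi(x)=\|x\|_2^2/2$ with Bregman divergence $B_\psi(x;y)=\psi(x)-\psi(y)-\langle\nabla\psi(y),x-y\rangle$, and let $f_1,\dots,f_T$ be loss functions that are convex on $\mathcal X$ and satisfy $|f_t(x)-f_t(y)|\le G\|x-y\|_2$ for $x,y\in\mathcal X$. Let $s_1,\dots,s_T$ be independent and uniformly distributed on the unit $\ell_1$-sphere $\{s\in\mathbb R^d:\|s\|_1=1\}$. *Algorithm (parameter-free bandit mirror descent, PBMD).* Inputs: $\mu>0$, $\alpha\in(0,1)$, $\gamma>0$, $N\in\mathbb N$, step sizes $\eta_{(1)},\dots,\eta_{(N)}$. Put $\mathcal X_\alpha=(1-\alpha)\mathcal X$, choose any $y_{(k),1}\in\mathcal X_\alpha$ and put $\omega_{(k),1}=\frac{N+1}{N}\frac1{k(k+1)}$, $k=1,\dots,N$. For $t=1,\dots,T$: put $y_t=\sum_{k}\omega_{(k),t}\,y_{(k),t}$; play $x_t^\pm=y_t\pm\mu s_t$; put $g_t=\frac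 d{2\mu}\bigl(f_t(x_t^+)-f_t(x_t^-)\bigr)\,\mathrm{sign}(s_t)$ (component-wise sign, with $\mathrm{sign}(0)=1$) and $\varphi_t(y)=\langle g_t,y-y_t\rangle$; update $$\omega_{(k),t+1}=\frac{\omega_{(k),t}\,e^{-\gamma\varphi_t(y_{(k),t})}}{\sum_{j=1}^N\omega_{(j),t}\,e^{-\gamma\varphi_t(y_{(j),t})}},\qquad y_{(k),t+1}=\operatorname*{argmin}_{y\in\mathcal X_\alpha}\Bigl\{\langle g_t,y\rangle+\tfrac1{\eta_{(k)}}B_\psi(y;y_{(k),t})\Bigr\}.$$ *Parameters.* Let $F_\psi=\sup_{\mathcal X}\psi-\inf_{\mathcal X}\psi$ $(=\tfrac12)$, $G_\psi=\sup_{x\in\mathcal X}\|\nabla\psi(x)\|_2$ $(=1)$, $r=\tfrac12$, $R=1$, and let $B\in[0,2]$ be any number; for a comparator $u_1\in\mathcal X$, $v_1=(1-\alpha)u_1$ and an initial point $y_1\in\mathcal X_\alpha$, the choices $B=B_\psi(v_1;y_1)=\frac12\|v_1-y_1\|_2^2$ and its upper bound $B=2$ are both allowed. Let $\zeta=2\sqrt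 d/(d+1)$ if $2<\log d$ and $\zeta=e\log(d)/(d+1)$ otherwise, and let $0<c_1\le c_2$ and $c_3>0$ be constants. Suppose $$\eta_{(k)}=2^{k-1}\sqrt{\frac{F_\psi+B}{6(1+\sqrt2)^2G^2dT}},\qquad N=\Bigl\lceil\tfrac12\log_2\Bigl(1+\frac{2RG_\psi T}{F_\psi+B}\Bigr)\Bigr\rceil+1,$$ $$\frac{c_1}{RG\sqrt{dT}}\le\gamma\le\frac{c_2}{RG\sqrt{dT}},\qquad 0<\mu\le c_3\,\frac{\sqrt{(F_\psi+B)\,d}}{\sqrt T\,(1+\sqrt d+\zeta)\,R/r},\qquad \mu\sqrt d=\alpha r,\quad \alpha\in(0,1).$$ *Claim.* There is a constant $C>0$ that depends only on $c_1,c_2,c_3$ (and not on $d$, $T$, $G$, $B$, the losses, the comparators, the initial points or the other parameters) such that, for every comparator sequence $u_1,\dots,u_{T+1}\in\mathcal X$ with path variation $\mathcal P_{T,2}=\sum_{t=1}^T\|u_{t+1}-u_t\|_2$ (the point $u_{T+1}$ occurs only in $\mathcal P_{T,2}$; one may take $u_{T+1}=u_T$), the dynamic regret of PBMD is integrable and $$\mathbb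 E\Bigl[\sum_{t=1}^T\Bigl(\frac{f_t(x_t^+)+f_t(x_t^-)}2-f_t(u_t)\Bigr)\Bigr]\le C\,G\sqrt{dT\,(1+\mathcal P_{T,2})},$$ where the expectation is over $s_1,\dots,s_T$. -/

import Mathlib

noncomputable section

namespace BCO

/-- The Euclidean space `ℝ^d`; its norm is the `ℓ₂`-norm. -/
abbrev Vec (d : ℕ) : Type := EuclideanSpace ℝ (Fin d)

/-- The `ℓ₁`-norm of a vector. -/
def l1Norm {d : ℕ} (x : Vec d) : ℝ := ∑ i, |x i|

/-- The uniform distribution on the unit `ℓ₁`-sphere: the image of the uniform distribution on the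
open unit `ℓ₁`-ball under the radial projection `x ↦ x / ‖x‖₁`. All facets of the `ℓ₁`-sphere have
the same distance `1/√d` to the origin, so the volume of the cone over a piece of the sphere is
proportional to the area of the piece; hence this is the normalized surface measure. -/
def unifL1Sphere (d : ℕ) : MeasureTheory.Measure (Vec d) :=
  (ProbabilityTheory.cond (MeasureTheory.volume : MeasureTheory.Measure (Vec d))
    {x | l1Norm x < 1}).map (fun x => (l1Norm x)⁻¹ • x)

/-- The component-wise sign, with value `1` at `0`. -/
def signVec {d : ℕ} (x : Vec d) : Vec d := WithLp.toLp 2 (fun i => if x i < 0 then -1 else 1)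

/-- The Bregman divergence `B_ψ(x; y) = ψ(x) - ψ(y) - ⟨∇ψ(y), x - y⟩`. -/
def bregman {d : ℕ} (ψ : Vec d → ℝ) (x y : Vec d) : ℝ :=
  ψ x - ψ y - inner ℝ (gradient ψ y) (x - y)

/-- `F_ψ = sup_X ψ - inf_X ψ`. -/
def oscOn {d : ℕ} (X : Set (Vec d)) (ψ : Vec d → ℝ) : ℝ := sSup (ψ '' X) - sInf (ψ '' X)

/-- The bound `sup_{x ∈ X} ‖∇ψ(x)‖₂` of the gradient of `ψ` on the feasible set. -/
def gradBound {d : ℕ} (X : Set (Vec d)) (ψ : Vec d → ℝ) : ℝ :=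
  sSup ((fun x => ‖gradient ψ x‖) '' X)

/-- The shrunk feasible set `X_α = (1 - α) X`. -/
def shrunk {d : ℕ} (α : ℝ) (X : Set (Vec d)) : Set (Vec d) := (fun x => (1 - α) • x) '' X

/-- The two-point gradient estimator `(d / 2μ) (f(y + μ s) - f(y - μ s)) sign(s)`. -/
def gradEst {d : ℕ} (μ : ℝ) (f : Vec d → ℝ) (y s : Vec d) : Vec d :=
  ((d : ℝ) / (2 * μ) * (f (y + μ • s) - f (y - μ • s))) • signVec s

/-- The mirror descent update `argmin_{w ∈ K} ⟨g, w⟩ + B_ψ(w; y) / η`. -/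
def mirrorStep {d : ℕ} (ψ : Vec d → ℝ) (K : Set (Vec d)) (η : ℝ) (g y : Vec d) : Vec d :=
  Classical.epsilon fun z =>
    z ∈ K ∧ IsMinOn (fun w => inner ℝ g w + 1 / η * bregman ψ w y) K z

/-- The inputs of parameter-free bandit mirror descent with `N` base learners in dimension `d`.
The `k`-th base learner, `k = 1, …, N`, has the index `k - 1` in `Fin N`. -/
structure Input (d N : ℕ) where
  /-- feasible set -/
  X : Set (Vec d)
  /-- divergence-generating function -/
  ψ : Vec d → ℝ
  /-- smoothing parameter -/
  μ : ℝ
  /-- shrinkage parameter -/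
  α : ℝ
  /-- weight update parameter -/
  γ : ℝ
  /-- step sizes of the base learners -/
  η : Fin N → ℝ
  /-- initial points of the base learners -/
  y₁ : Fin N → Vec d

/-- The state of the algorithm at the beginning of an iteration. -/
structure State (d N : ℕ) where
  /-- current points of the base learners -/
  pts : Fin N → Vec d
  /-- current weights of the base learners -/
  wts : Fin N → ℝ

/-- The combined decision `y_t = ∑_k ω_k y_k` of the meta learner. -/
def State.decision {d N : ℕ} (σ : State d N) : Vec d := ∑ k, σ.wts k • σ.pts k

/-- The initial state: the weights are `ω_k = (N + 1) / N * 1 / (k (k + 1))`, `k = 1, …, N`. -/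
def Input.init {d N : ℕ} (I : Input d N) : State d N where
  pts := I.y₁
  wts := fun k => ((N : ℝ) + 1) / N * (1 / (((k : ℕ) + 1) * ((k : ℕ) + 2)))

/-- The surrogate loss `φ(y) = ⟨g, y - y_t⟩` of the current iteration, where `g` is the gradient
estimator for the loss `f` and the sampled direction `s`. -/
def Input.surrogate {d N : ℕ} (I : Input d N) (f : Vec d → ℝ) (s : Vec d) (σ : State d N)
    (y : Vec d) : ℝ :=
  inner ℝ (gradEst I.μ f σ.decision s) (y - σ.decision)

/-- One iteration, with loss `f` and sampled direction `s`. -/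
def Input.step {d N : ℕ} (I : Input d N) (f : Vec d → ℝ) (s : Vec d) (σ : State d N) :
    State d N where
  pts := fun k =>
    mirrorStep I.ψ (shrunk I.α I.X) (I.η k) (gradEst I.μ f σ.decision s) (σ.pts k)
  wts := fun k =>
    σ.wts k * Real.exp (-I.γ * I.surrogate f s σ (σ.pts k)) /
      ∑ j, σ.wts j * Real.exp (-I.γ * I.surrogate f s σ (σ.pts j))

/-- The state after `t` iterations, with losses `f 0, f 1, …` and directions `s 0, s 1, …`. -/
def Input.state {d N : ℕ} (I : Input d N) (f : ℕ → Vec d → ℝ) (s : ℕ → Vec d) : ℕ → State d N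
  | 0 => I.init
  | t + 1 => I.step (f t) (s t) (I.state f s t)

/-- The played point `x_t⁺ = y_t + μ s_t`. -/
def Input.xPlus {d N : ℕ} (I : Input d N) (f : ℕ → Vec d → ℝ) (s : ℕ → Vec d) (t : ℕ) : Vec d :=
  (I.state f s t).decision + I.μ • s t

/-- The played point `x_t⁻ = y_t - μ s_t`. -/
def Input.xMinus {d N : ℕ} (I : Input d N) (f : ℕ → Vec d → ℝ) (s : ℕ → Vec d) (t : ℕ) : Vec d :=
  (I.state f s t).decision - I.μ • s t

/-- The dynamic regret over `T` iterations (numbered `0, …, T - 1`) against the comparators `u`. -/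
def Input.dynRegret {d N : ℕ} (I : Input d N) (T : ℕ) (f : ℕ → Vec d → ℝ) (u s : ℕ → Vec d) : ℝ :=
  ∑ t ∈ Finset.range T, ((f t (I.xPlus f s t) + f t (I.xMinus f s t)) / 2 - f t (u t))

/-- The `ℓ₂`-path variation `∑_t ‖u_{t+1} - u_t‖₂`, with `T` summands. -/
def pathVar {d : ℕ} (T : ℕ) (u : ℕ → Vec d) : ℝ := ∑ t ∈ Finset.range T, ‖u (t + 1) - u t‖

/-- `ζ_q(d)`. -/
def zetaC (q : ℝ) (d : ℕ) : ℝ :=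
  if q < Real.log d then q * (d : ℝ) ^ (1 / q) / (d + 1) else Real.exp 1 * Real.log d / (d + 1)

/-- `ξ_{p,q}(d)`. -/
def xiC (p q : ℝ) (d : ℕ) : ℝ := (d : ℝ) ^ (1 + 2 / min q 2 - 2 / p)

/-- `υ_{p,q}(d)`. -/
def upsilonC (p q : ℝ) (d : ℕ) : ℝ := (d : ℝ) ^ (1 + 1 / q - 1 / p - 1 / max q p)

/-- The step size `2^(k-1) √((F + B) / (6 (1 + √2)² G² ξ T / lam))` of the `k`-th base learner,
where `k = j + 1`. -/
def stepSize (F B G ξ lam : ℝ) (T j : ℕ) : ℝ :=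
  2 ^ j * √((F + B) / (6 * (1 + √2) ^ 2 * G ^ 2 * ξ * T / lam))

/-- The number `⌈½ log₂ (1 + 2 R H T / (F + B))⌉ + 1` of base learners. -/
def numLearners (F B R H : ℝ) (T : ℕ) : ℕ :=
  ⌈1 / 2 * Real.logb 2 (1 + 2 * R * H * T / (F + B))⌉₊ + 1

/-- The order `1 / (R G √(ξ T))` of the weight update parameter. -/
def gammaOrder (R G ξ : ℝ) (T : ℕ) : ℝ := 1 / (R * G * √(ξ * T))

/-- The order `√((F + B) ξ) / (√(lam T) (1 + υ + ζ) R / r)` of the smoothing parameter. -/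
def muOrder (F B ξ lam υ ζ R r : ℝ) (T : ℕ) : ℝ :=
  √((F + B) * ξ) / (√(lam * T) * (1 + υ + ζ) * R / r)

/-- The closed unit `ℓ₂`-ball. -/
def unitBall (d : ℕ) : Set (Vec d) := {x | ‖x‖ ≤ 1}

/-- The function `ψ(x) = ‖x‖₂² / 2`. -/
def halfSq (d : ℕ) (x : Vec d) : ℝ := ‖x‖ ^ 2 / 2

/-- The Euclidean instance of the parameter setting: `p = q = 2`, the unit ball,
`ψ(x) = ‖x‖₂² / 2` (which is `1`-strongly convex), and radii `r = 1/2`, `R = 1`.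
The number `B` takes the place of `B_ψ(v₁; y₁) = ‖v₁ - y₁‖₂² / 2`, which lies in `[0, 2]` for points
of the unit ball, and `c₁, c₂, c₃` are the constants behind the orders of `γ` and `μ`. -/
structure EuclideanSetting (c₁ c₂ c₃ : ℝ) (d T : ℕ) (G B : ℝ) {N : ℕ} (I : Input d N) :
    Prop where
  X_eq : I.X = unitBall d
  ψ_eq : I.ψ = halfSq d
  N_eq : N = numLearners (oscOn (unitBall d) (halfSq d)) B 1 (gradBound (unitBall d) (halfSq d)) T
  η_eq : ∀ k : Fin N, I.η k = stepSize (oscOn (unitBall d) (halfSq d)) B G (xiC 2 2 d) 1 T k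
  le_γ : c₁ * gammaOrder 1 G (xiC 2 2 d) T ≤ I.γ
  γ_le : I.γ ≤ c₂ * gammaOrder 1 G (xiC 2 2 d) T
  μ_pos : 0 < I.μ
  μ_le : I.μ ≤ c₃ * muOrder (oscOn (unitBall d) (halfSq d)) B (xiC 2 2 d) 1
    (upsilonC 2 2 d) (zetaC 2 d) 1 (1 / 2) T
  /-- the relation `μ d^(1 - 1/p) = α r` -/
  μ_α : I.μ * (d : ℝ) ^ ((1 : ℝ) - 1 / 2) = I.α * (1 / 2)
  α_mem : I.α ∈ Set.Ioo (0 : ℝ) 1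
  y₁_mem : ∀ k, I.y₁ k ∈ shrunk I.α (unitBall d)

end BCO

end

/-!
The played points are within `μ` of the decision `y_t`, and the comparators are within `α` of their
shrunk copies `v_t = (1 - α) u_t`. Since the losses are `G`-Lipschitz and `α = 2 μ √d`, it costs
`O(G μ √d T) = O(G √(d T))` to replace the regret by `∑ (f_t(y_t) - f_t(v_t))`. The rest of the proof
compares this sum with the linearized regret `∑ ⟨g_t, y_t - v_t⟩`. It rests on two facts about the
gradient estimator for a direction `s` that is uniform on the `ℓ₁`-sphere, and on a pathwise bound.

* The estimator is a subgradient in the mean, up to an error `2 G μ`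
  (`integral_inner_gradEst_ge`). By the divergence theorem on the `ℓ₁`-ball, the mean of the estimator
  is the gradient of a smoothed loss. Only an inequality is needed, and it is obtained by
  integrating by parts against the Lipschitz cones `max 0 (a - ‖x‖₁)` for `a = 1` and `a = 1 - ε`;
  the difference of the two identities lives on a thin annulus, and `ε → 0` gives the flux through
  the sphere (`flux_le_of_lineDeriv_le`).
* The second moment of the estimator is of order `d G²` (`integral_norm_gradEst_sq_le`). This
  amounts to the variance bound `O(L² / d²)` for odd `L`-Lipschitz functions `h` on the `ℓ₁`-sphere
  (`integral_sq_unifL1Sphere_le`). If the coordinates of `X` are independent Laplace variables, then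
  `X / ‖X‖₁` is uniform on the sphere and uncorrelated with `‖X‖₁²`. The Poincaré
  inequality for the product of Laplace distributions (`laplacePi_poincare`), applied to the
  homogeneous extension `‖x‖₁ h(x / ‖x‖₁)`, yields
  `d (d + 1) 𝔼 h² ≤ 12 d 𝔼 h² + 36 L²`, where the first term on the right is absorbed for large `d`.
* For every base learner `k`, the linearized regret is at most
  `log (1 / ω_k) / γ + (2 + 2 P) / η_k + (2 γ + η_k / 2) ∑ ‖g_t‖²` along every path
  (`IsBallInput.sum_inner_grad_le`), by the analysis of exponential weights and of projected gradient
  descent with path variation `P`.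

The decision `y_t` is a function of the earlier directions, hence independent of `s_t`, so the
first two facts may be used with `y_t` in place of a fixed point. The step sizes form a geometric
grid, which contains some `η_k` with `2 ^ (k - 1)` between `√(1 + P) / 2` and `√(1 + P)`
(`exists_learner`); for this learner the prior weight costs only `log (1 / ω_k) = O(√(1 + P))`,
and every term of the bound is `O(G √(d T (1 + P)))`.
-/

namespace BCO

open MeasureTheory Set Filter Topology
open scoped NNReal ENNReal Pointwise

/-! ### The Laplace distribution and its Poincaré inequality -/

/-- The standard Laplace distribution on `ℝ`, with density `exp (-|x|) / 2`. -/
noncomputable def laplace : Measure ℝ :=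
  volume.withDensity fun x => ENNReal.ofReal (Real.exp (-|x|) / 2)

theorem integrableOn_pow_mul_exp_neg (n : ℕ) :
    IntegrableOn (fun x : ℝ => x ^ n * Real.exp (-x)) (Ioi 0) := by
  have h := Real.GammaIntegral_convergent (s := (n : ℝ) + 1) (by positivity)
  refine h.congr_fun (fun x hx => ?_) measurableSet_Ioi
  simp [mul_comm]

theorem integral_pow_mul_exp_neg (n : ℕ) :
    ∫ x in Ioi (0 : ℝ), x ^ n * Real.exp (-x) = (n.factorial : ℝ) := by
  rw [← Real.Gamma_nat_eq_factorial, Real.Gamma_eq_integral (by positivity)]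
  refine setIntegral_congr_fun measurableSet_Ioi fun x hx => ?_
  simp [mul_comm]

theorem integral_pow_abs_mul_exp_neg_abs (n : ℕ) :
    ∫ x : ℝ, |x| ^ n * Real.exp (-|x|) = 2 * (n.factorial : ℝ) := by
  rw [integral_comp_abs (f := fun x => x ^ n * Real.exp (-x)), integral_pow_mul_exp_neg]

theorem integrable_pow_abs_mul_exp_neg_abs (n : ℕ) :
    Integrable fun x : ℝ => |x| ^ n * Real.exp (-|x|) := by
  by_contra h
  have h1 := integral_pow_abs_mul_exp_neg_abs n
  rw [integral_undef h] at h1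
  have : (0 : ℝ) < n.factorial := by positivity
  linarith

theorem integral_laplace (g : ℝ → ℝ) :
    ∫ x, g x ∂laplace = ∫ x, Real.exp (-|x|) / 2 * g x := by
  rw [laplace, integral_withDensity_eq_integral_toReal_smul (by fun_prop) (by simp)]
  refine integral_congr_ae (.of_forall fun x => ?_)
  simp only [smul_eq_mul]
  rw [ENNReal.toReal_ofReal (by positivity)]

theorem integrable_laplace_iff (g : ℝ → ℝ) :
    Integrable g laplace ↔ Integrable fun x => Real.exp (-|x|) / 2 * g x := by
  rw [laplace, integrable_withDensity_iff_integrable_smul' (by fun_prop) (by simp)]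
  refine integrable_congr (.of_forall fun x => ?_)
  simp only [smul_eq_mul]
  rw [ENNReal.toReal_ofReal (by positivity)]

instance isProbabilityMeasure_laplace : IsProbabilityMeasure laplace := by
  constructor
  have h0 := integrable_pow_abs_mul_exp_neg_abs 0
  have h1 := integral_pow_abs_mul_exp_neg_abs 0
  simp only [pow_zero, one_mul] at h0 h1
  rw [laplace, withDensity_apply _ MeasurableSet.univ, Measure.restrict_univ,
    ← ofReal_integral_eq_lintegral_ofReal (h0.div_const 2)
      (.of_forall fun x => by positivity), integral_div, h1]
  simp

theorem integrable_laplace_abs_pow (n : ℕ) : Integrable (fun x : ℝ => |x| ^ n) laplace := by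
  rw [integrable_laplace_iff]
  refine ((integrable_pow_abs_mul_exp_neg_abs n).div_const 2).congr (.of_forall fun x => ?_)
  ring

theorem integral_laplace_sq : ∫ x : ℝ, x ^ 2 ∂laplace = 2 := by
  have h := integral_pow_abs_mul_exp_neg_abs 2
  rw [integral_laplace, ← integral_congr_ae (f := fun x : ℝ => |x| ^ 2 * Real.exp (-|x|) / 2)
    (.of_forall fun x => by simp only [sq_abs]; ring), integral_div, h]
  norm_num [Nat.factorial]

/-- The Poincaré inequality for the exponential distribution: integrate `u ^ 2` against the
derivative of `-exp (-x)` by parts and split `2 u u'` by the inequality of arithmetic and geometric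
means. -/
theorem setIntegral_sq_mul_exp_neg_le {C : ℝ≥0} {u : ℝ → ℝ} (hu : LipschitzWith C u)
    (hu0 : u 0 = 0) :
    ∫ x in Ioi (0 : ℝ), u x ^ 2 * Real.exp (-x) ≤
      4 * ∫ x in Ioi (0 : ℝ), deriv u x ^ 2 * Real.exp (-x) := by
  have hud : ∀ x, ‖deriv u x‖ ≤ C := fun x => norm_deriv_le_of_lipschitz hu
  have hum : Measurable (deriv u) := measurable_deriv u
  have hi1 : IntegrableOn (fun x => u x ^ 2 * Real.exp (-x)) (Ioi 0) := by
    refine ((integrableOn_pow_mul_exp_neg 2).const_mul ((C : ℝ) ^ 2)).mono'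
      (by have := hu.continuous; fun_prop) (.of_forall fun x => ?_)
    have h := hu.dist_le_mul x 0
    rw [Real.dist_eq, Real.dist_eq, hu0, sub_zero, sub_zero] at h
    have h2 : |u x| ^ 2 ≤ (C * |x|) ^ 2 := by gcongr
    rw [sq_abs, mul_pow, sq_abs] at h2
    rw [Real.norm_of_nonneg (by positivity), ← mul_assoc]
    gcongr
  have hi2 : IntegrableOn (fun x => deriv u x ^ 2 * Real.exp (-x)) (Ioi 0) := by
    refine ((integrableOn_pow_mul_exp_neg 0).const_mul ((C : ℝ) ^ 2)).mono'
      (by fun_prop) (.of_forall fun x => ?_)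
    have h2 : ‖deriv u x‖ ^ 2 ≤ (C : ℝ) ^ 2 := by gcongr; exact hud x
    rw [Real.norm_eq_abs, sq_abs] at h2
    rw [Real.norm_of_nonneg (by positivity), pow_zero, one_mul]
    gcongr
  have key : ∀ M : ℝ, 0 ≤ M → ∫ x in (0)..M, u x ^ 2 * Real.exp (-x) ≤
      4 * ∫ x in (0)..M, deriv u x ^ 2 * Real.exp (-x) := by
    intro M hM
    have j1 : IntervalIntegrable (fun x => u x ^ 2 * Real.exp (-x)) volume 0 M :=
      (intervalIntegrable_iff_integrableOn_Ioc_of_le hM).2 (hi1.mono_set Ioc_subset_Ioi_self)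
    have j2 : IntervalIntegrable (fun x => deriv u x ^ 2 * Real.exp (-x)) volume 0 M :=
      (intervalIntegrable_iff_integrableOn_Ioc_of_le hM).2 (hi2.mono_set Ioc_subset_Ioi_self)
    have acu : AbsolutelyContinuousOnInterval u 0 M :=
      (hu.lipschitzOnWith (s := uIcc 0 M)).absolutelyContinuousOnInterval
    have acg : AbsolutelyContinuousOnInterval (fun x => -Real.exp (-x)) 0 M :=
      ContDiffOn.absolutelyContinuousOnInterval (by fun_prop)
    have acf := acu.fun_mul acu
    have ibp := acf.integral_mul_deriv_eq_deriv_mul acg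
    have hg : ∀ x : ℝ, deriv (fun x => -Real.exp (-x)) x = Real.exp (-x) := by
      intro x
      have : HasDerivAt (fun x : ℝ => -Real.exp (-x)) (-(Real.exp (-x) * (-1))) x :=
        ((hasDerivAt_neg x).exp).neg
      rw [this.deriv]; ring
    have e1 : ∫ x in (0)..M, u x * u x * deriv (fun x => -Real.exp (-x)) x =
        ∫ x in (0)..M, u x ^ 2 * Real.exp (-x) :=
      intervalIntegral.integral_congr fun x _ => by simp only [hg]; ring
    have e2 : ∫ x in (0)..M, deriv (fun x => u x * u x) x * -Real.exp (-x) =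
        ∫ x in (0)..M, -(2 * (u x * deriv u x) * Real.exp (-x)) := by
      refine intervalIntegral.integral_congr_ae ?_
      filter_upwards [hu.ae_differentiableAt_real] with x hx _
      rw [(hx.hasDerivAt.fun_mul hx.hasDerivAt).deriv]
      ring
    have e3 : ∫ x in (0)..M, -(2 * (u x * deriv u x) * Real.exp (-x)) ≥
        ∫ x in (0)..M, -(1 / 2 * (u x ^ 2 * Real.exp (-x)) +
          2 * (deriv u x ^ 2 * Real.exp (-x))) := by
      refine intervalIntegral.integral_mono_on hM
        ((j1.const_mul _).add (j2.const_mul _)).neg ?_ fun x _ => ?_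
      · refine IntervalIntegrable.neg ?_
        refine ((j1.const_mul 1).add (j2.const_mul 1)).mono_fun ?_ (.of_forall fun x => ?_)
        · have := hu.continuous
          exact Measurable.aestronglyMeasurable (by fun_prop)
        · dsimp only
          rw [Real.norm_eq_abs, Real.norm_of_nonneg (by positivity), abs_mul,
            abs_of_pos (Real.exp_pos _)]
          have : |2 * (u x * deriv u x)| ≤ u x ^ 2 + deriv u x ^ 2 := by
            rw [abs_le]; constructor <;> nlinarith [sq_nonneg (u x + deriv u x),
              sq_nonneg (u x - deriv u x)]
          calc _ ≤ (u x ^ 2 + deriv u x ^ 2) * Real.exp (-x) := by gcongr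
            _ = _ := by ring
      · have : 0 ≤ (u x - 2 * deriv u x) ^ 2 * Real.exp (-x) := by positivity
        nlinarith
    rw [intervalIntegral.integral_neg] at e2
    rw [intervalIntegral.integral_neg, intervalIntegral.integral_neg,
      intervalIntegral.integral_add (j1.const_mul _)
      (j2.const_mul _), intervalIntegral.integral_const_mul,
      intervalIntegral.integral_const_mul] at e3
    rw [e1, e2, hu0] at ibp
    have hpos : 0 ≤ u M * u M * Real.exp (-M) := by have := mul_self_nonneg (u M); positivity
    simp only [zero_mul] at ibp
    linarith
  refine le_of_tendsto_of_tendsto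
    (intervalIntegral_tendsto_integral_Ioi 0 hi1 tendsto_id)
    ((intervalIntegral_tendsto_integral_Ioi 0 hi2 tendsto_id).const_mul 4) ?_
  filter_upwards [eventually_ge_atTop 0] with M hM using key M hM

theorem integral_eq_setIntegral_Ioi_add {g : ℝ → ℝ} (hg : Integrable g) :
    ∫ x, g x = (∫ x in Ioi (0 : ℝ), g x) + ∫ x in Ioi (0 : ℝ), g (-x) := by
  rw [integral_comp_neg_Ioi, neg_zero, add_comm, ← setIntegral_union (Iic_disjoint_Ioi le_rfl)
    measurableSet_Ioi hg.integrableOn hg.integrableOn, Iic_union_Ioi, Measure.restrict_univ]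

theorem integrable_laplace_of_lipschitz_sq {C : ℝ≥0} {u : ℝ → ℝ} (hu : LipschitzWith C u) :
    Integrable (fun x => u x ^ 2) laplace := by
  have hb := ((integrable_laplace_abs_pow 2).const_mul (2 * (C : ℝ) ^ 2)).add
    (integrable_const (2 * u 0 ^ 2))
  refine hb.mono' (by have := hu.continuous; fun_prop) (.of_forall fun x => ?_)
  have h := hu.dist_le_mul x 0
  rw [Real.dist_eq, Real.dist_eq, sub_zero] at h
  have h2 : |u x - u 0| ^ 2 ≤ (C * |x|) ^ 2 := by gcongr
  rw [sq_abs] at h2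
  rw [Real.norm_of_nonneg (by positivity)]
  simp only [Pi.add_apply]
  nlinarith [sq_nonneg (u x - 2 * u 0)]

/-- The Poincaré inequality for the Laplace distribution. -/
theorem laplace_poincare {C : ℝ≥0} {u : ℝ → ℝ} (hu : LipschitzWith C u) :
    ∫ x, u x ^ 2 ∂laplace - (∫ x, u x ∂laplace) ^ 2 ≤ 4 * ∫ x, deriv u x ^ 2 ∂laplace := by
  have husq := integrable_laplace_of_lipschitz_sq hu
  have hui : Integrable u laplace :=
    ((memLp_two_iff_integrable_sq (hu.continuous.aestronglyMeasurable)).2 husq).integrable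
      (by norm_num)
  set w : ℝ → ℝ := fun x => u x - u 0 with hw
  have hwL : LipschitzWith C w := by
    intro x y
    simpa [hw, edist_dist, dist_eq_norm] using hu x y
  have hwi := integrable_laplace_of_lipschitz_sq hwL
  have hdw : deriv w = deriv u := by
    ext x; simp [hw, deriv_sub_const_fun]
  have hdi : Integrable (fun x => deriv u x ^ 2) laplace := by
    refine (integrable_const ((C : ℝ) ^ 2)).mono' ((measurable_deriv u).pow_const 2
      |>.aestronglyMeasurable) (.of_forall fun x => ?_)
    have : ‖deriv u x‖ ^ 2 ≤ (C : ℝ) ^ 2 := by gcongr; exact norm_deriv_le_of_lipschitz hu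
    rwa [norm_pow]
  have h1 : ∫ x, u x ^ 2 ∂laplace - (∫ x, u x ∂laplace) ^ 2 ≤ ∫ x, w x ^ 2 ∂laplace := by
    have e : ∫ x, w x ^ 2 ∂laplace =
        ∫ x, u x ^ 2 ∂laplace - 2 * u 0 * ∫ x, u x ∂laplace + u 0 ^ 2 := by
      have : ∀ x, w x ^ 2 = u x ^ 2 - 2 * u 0 * u x + u 0 ^ 2 := fun x => by simp only [hw]; ring
      simp_rw [this]
      have hI : Integrable (fun x => u x ^ 2 - 2 * u 0 * u x) laplace :=
        husq.sub (hui.const_mul _)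
      rw [integral_add hI (integrable_const _),
        integral_sub husq (hui.const_mul _), integral_const_mul]
      simp
    rw [e]
    nlinarith [sq_nonneg (∫ x, u x ∂laplace - u 0)]
  refine h1.trans ?_
  rw [integral_laplace, integral_laplace,
    integral_eq_setIntegral_Ioi_add ((integrable_laplace_iff _).1 hwi),
    integral_eq_setIntegral_Ioi_add ((integrable_laplace_iff _).1 hdi)]
  have hp := setIntegral_sq_mul_exp_neg_le hwL (by simp [hw])
  have hwL' : LipschitzWith C (fun x => w (-x)) := by
    intro x y
    simpa [edist_dist, dist_neg_neg] using hwL (-x) (-y)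
  have hn := setIntegral_sq_mul_exp_neg_le hwL' (by simp [hw])
  have c : ∀ g : ℝ → ℝ, ∫ x in Ioi (0 : ℝ), Real.exp (-|x|) / 2 * g x =
      (∫ x in Ioi (0 : ℝ), g x * Real.exp (-x)) / 2 := by
    intro g
    rw [← integral_div]
    refine setIntegral_congr_fun measurableSet_Ioi fun x hx => ?_
    simp only [abs_of_pos (mem_Ioi.1 hx)]
    ring
  simp_rw [abs_neg, c (fun x => w (-x) ^ 2), c (fun x => deriv u (-x) ^ 2), c]
  rw [hdw] at hp
  have hd' : ∀ x, deriv (fun x => w (-x)) x ^ 2 = deriv u (-x) ^ 2 := by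
    intro x; rw [deriv_comp_neg, hdw]; ring
  simp_rw [hd'] at hn
  linarith

/-! ### Tensorization of the Poincaré inequality -/

/-- The law of `n` independent standard Laplace variables. -/
noncomputable def laplacePi (n : ℕ) : Measure (Fin n → ℝ) := Measure.pi fun _ => laplace

instance isProbabilityMeasure_laplacePi (n : ℕ) : IsProbabilityMeasure (laplacePi n) :=
  inferInstanceAs (IsProbabilityMeasure (Measure.pi _))

theorem laplacePi_eq_withDensity (n : ℕ) :
    laplacePi n = volume.withDensity
      fun x : Fin n → ℝ => ENNReal.ofReal (Real.exp (-∑ i, |x i|) / 2 ^ n) := by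
  have hprod : ∀ x : Fin n → ℝ, Real.exp (-∑ i, |x i|) / 2 ^ n =
      ∏ i, Real.exp (-|x i|) / 2 := by
    intro x
    rw [Finset.prod_div_distrib, ← Real.exp_sum, Finset.sum_neg_distrib]
    simp
  have hint : Integrable fun t : ℝ => Real.exp (-|t|) / 2 := by
    have := (integrable_pow_abs_mul_exp_neg_abs 0).div_const 2
    simpa using this
  refine Measure.pi_eq fun s hs => ?_
  have hms : MeasurableSet (univ.pi s) := MeasurableSet.univ_pi hs
  have hi : ∀ i, Integrable ((s i).indicator fun t : ℝ => Real.exp (-|t|) / 2) :=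
    fun i => hint.indicator (hs i)
  have hind : ∀ x : Fin n → ℝ,
      (univ.pi s).indicator (fun x => ENNReal.ofReal (Real.exp (-∑ i, |x i|) / 2 ^ n)) x =
        ENNReal.ofReal (∏ i, (s i).indicator (fun t : ℝ => Real.exp (-|t|) / 2) (x i)) := by
    intro x
    by_cases hx : x ∈ univ.pi s
    · rw [indicator_of_mem hx, hprod]
      congr 1
      refine Finset.prod_congr rfl fun i _ => ?_
      rw [indicator_of_mem (hx i (mem_univ i))]
    · rw [indicator_of_notMem hx]
      simp only [Set.mem_pi, mem_univ, true_implies, not_forall] at hx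
      obtain ⟨i, hi⟩ := hx
      rw [Finset.prod_eq_zero (Finset.mem_univ i) (indicator_of_notMem hi _), ENNReal.ofReal_zero]
  rw [withDensity_apply _ hms, ← lintegral_indicator hms]
  simp_rw [hind]
  rw [volume_pi, ← ofReal_integral_eq_lintegral_ofReal (Integrable.fintype_prod hi)
    (.of_forall fun x => Finset.prod_nonneg fun i _ =>
      indicator_nonneg (fun _ _ => by positivity) _),
    integral_fintype_prod_eq_prod, ENNReal.ofReal_prod_of_nonneg fun i _ =>
      integral_nonneg (indicator_nonneg (fun _ _ => by positivity))]
  refine Finset.prod_congr rfl fun i _ => ?_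
  rw [integral_indicator (hs i), ofReal_integral_eq_lintegral_ofReal hint.integrableOn
    (.of_forall fun _ => by positivity), laplace, withDensity_apply _ (hs i)]

theorem laplacePi_absolutelyContinuous (n : ℕ) : laplacePi n ≪ volume := by
  rw [laplacePi_eq_withDensity]
  exact withDensity_absolutelyContinuous _ _

theorem measurePreserving_cons (n : ℕ) :
    MeasurePreserving (fun p : ℝ × (Fin n → ℝ) => (Fin.cons p.1 p.2 : Fin (n + 1) → ℝ))
      (laplace.prod (laplacePi n)) (laplacePi (n + 1)) := by
  have h := (measurePreserving_piFinSuccAbove (fun _ : Fin (n + 1) => laplace) 0).symm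
  have e : (fun p : ℝ × (Fin n → ℝ) => (Fin.cons p.1 p.2 : Fin (n + 1) → ℝ)) =
      (MeasurableEquiv.piFinSuccAbove (fun _ : Fin (n + 1) => ℝ) 0).symm := by
    ext p : 1
    simp [MeasurableEquiv.piFinSuccAbove_symm_apply, Fin.insertNthEquiv]
  rw [e]
  exact h

theorem integrable_laplacePi_sq_coord (n : ℕ) (i : Fin n) :
    Integrable (fun x : Fin n → ℝ => x i ^ 2) (laplacePi n) := by
  have h := (measurePreserving_eval (fun _ : Fin n => laplace) i).integrable_comp
    (g := fun t : ℝ => t ^ 2) (by fun_prop)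
  have h2 : Integrable (fun t : ℝ => t ^ 2) laplace := by
    simpa using integrable_laplace_abs_pow 2
  exact h.2 h2

theorem integral_laplacePi_sq_coord (n : ℕ) (i : Fin n) :
    ∫ x : Fin n → ℝ, x i ^ 2 ∂laplacePi n = 2 := by
  have hmp := measurePreserving_eval (fun _ : Fin n => laplace) i
  have h := integral_map (μ := laplacePi n) hmp.measurable.aemeasurable
    (f := fun t : ℝ => t ^ 2) (by fun_prop)
  have h2 : (laplacePi n).map (Function.eval i) = laplace := hmp.map_eq
  rw [h2, integral_laplace_sq] at h
  exact h.symm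

theorem memLp_laplacePi_of_lipschitz {n : ℕ} {C : ℝ≥0} {H : (Fin n → ℝ) → ℝ}
    (hH : LipschitzWith C H) : MemLp H 2 (laplacePi n) := by
  rw [memLp_two_iff_integrable_sq hH.continuous.aestronglyMeasurable]
  have hs : Integrable (fun x : Fin n → ℝ => ∑ i, x i ^ 2) (laplacePi n) :=
    integrable_finsetSum _ fun i _ => integrable_laplacePi_sq_coord n i
  refine ((hs.const_mul (2 * (C : ℝ) ^ 2)).add (integrable_const (2 * H 0 ^ 2))).mono'
    (hH.continuous.pow 2).aestronglyMeasurable (.of_forall fun x => ?_)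
  have hn : ‖x‖ ^ 2 ≤ ∑ i, x i ^ 2 := by
    have hle : ‖x‖ ≤ √(∑ i, x i ^ 2) := by
      refine (pi_norm_le_iff_of_nonneg (Real.sqrt_nonneg _)).2 fun i => ?_
      refine Real.le_sqrt_of_sq_le ?_
      rw [Real.norm_eq_abs, sq_abs]
      exact Finset.single_le_sum (f := fun i => x i ^ 2) (fun j _ => sq_nonneg _)
        (Finset.mem_univ i)
    calc ‖x‖ ^ 2 ≤ √(∑ i, x i ^ 2) ^ 2 := by gcongr
      _ = _ := Real.sq_sqrt (Finset.sum_nonneg fun _ _ => sq_nonneg _)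
  have h := hH.dist_le_mul x 0
  rw [Real.dist_eq, dist_zero_right] at h
  have h2 : |H x - H 0| ^ 2 ≤ (C * ‖x‖) ^ 2 := by gcongr
  rw [sq_abs] at h2
  rw [Real.norm_of_nonneg (by positivity)]
  simp only [Pi.add_apply]
  nlinarith [sq_nonneg (H x - 2 * H 0), mul_le_mul_of_nonneg_left hn (sq_nonneg (C : ℝ))]

theorem abs_lineDeriv_single_le {n : ℕ} {C : ℝ≥0} {H : (Fin n → ℝ) → ℝ}
    (hH : LipschitzWith C H) (i : Fin n) (x : Fin n → ℝ) :
    |lineDeriv ℝ H x (Pi.single i 1)| ≤ C := by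
  have h := norm_lineDeriv_le_of_lipschitz ℝ hH (x₀ := x) (v := Pi.single i 1)
  rwa [Pi.norm_single, norm_one, mul_one] at h

theorem integrable_sq_lineDeriv {n : ℕ} {C : ℝ≥0} {H : (Fin n → ℝ) → ℝ}
    (hH : LipschitzWith C H) (i : Fin n) :
    Integrable (fun x => lineDeriv ℝ H x (Pi.single i 1) ^ 2) (laplacePi n) := by
  refine (integrable_const ((C : ℝ) ^ 2)).mono'
    ((measurable_lineDeriv hH.continuous).pow_const 2).aestronglyMeasurable
    (.of_forall fun x => ?_)
  have := abs_lineDeriv_single_le hH i x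
  rw [Real.norm_of_nonneg (sq_nonneg _), ← sq_abs]
  gcongr

theorem dist_cons_le {n : ℕ} (a b : ℝ) (z w : Fin n → ℝ) :
    dist (Fin.cons a z : Fin (n + 1) → ℝ) (Fin.cons b w) ≤ max (dist a b) (dist z w) := by
  refine (dist_pi_le_iff (by positivity)).2 fun i => ?_
  refine Fin.cases ?_ (fun j => ?_) i
  · simp
  · simpa using Or.inr (dist_le_pi_dist z w j)

theorem cons_add_smul_single_zero {n : ℕ} (a t : ℝ) (z : Fin n → ℝ) :
    (Fin.cons a z : Fin (n + 1) → ℝ) + t • Pi.single 0 1 = Fin.cons (a + t) z := by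
  ext i
  refine Fin.cases ?_ (fun j => ?_) i <;> simp

theorem cons_add_smul_single_succ {n : ℕ} (a t : ℝ) (z : Fin n → ℝ) (i : Fin n) :
    (Fin.cons a z : Fin (n + 1) → ℝ) + t • Pi.single i.succ 1 =
      (Fin.cons a (z + t • Pi.single i 1 : Fin n → ℝ) : Fin (n + 1) → ℝ) := by
  ext j
  refine Fin.cases ?_ (fun j => ?_) j
  · simp [(Fin.succ_ne_zero i).symm]
  · simp [Pi.single_apply]

/-- The Poincaré inequality for the product of Laplace distributions. The induction splits off one
coordinate: the variance in that coordinate is controlled by the one-dimensional inequality, and the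
derivatives of the partial mean are bounded by Jensen's inequality. -/
theorem laplacePi_poincare (n : ℕ) : ∀ {C : ℝ≥0} {H : (Fin n → ℝ) → ℝ}, LipschitzWith C H →
    ∫ x, H x ^ 2 ∂laplacePi n - (∫ x, H x ∂laplacePi n) ^ 2 ≤
      4 * ∑ i, ∫ x, lineDeriv ℝ H x (Pi.single i 1) ^ 2 ∂laplacePi n := by
  induction n with
  | zero =>
    intro C H _
    have : ∀ x, H x = H 0 := fun x => by rw [Subsingleton.elim x 0]
    simp_rw [this]
    simp
  | succ n ih =>
    intro C H hH
    have mp := measurePreserving_cons n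
    have swap : ∀ g : (Fin (n + 1) → ℝ) → ℝ, Integrable g (laplacePi (n + 1)) →
        ∫ x, g x ∂laplacePi (n + 1) =
          ∫ z, ∫ a, g (Fin.cons a z) ∂laplace ∂laplacePi n := by
      intro g hg
      have hg' : Integrable (fun p : ℝ × (Fin n → ℝ) => g (Fin.cons p.1 p.2))
          (laplace.prod (laplacePi n)) := mp.integrable_comp_of_integrable hg
      rw [← mp.map_eq, integral_map mp.measurable.aemeasurable
        (by rw [mp.map_eq]; exact hg.aestronglyMeasurable), integral_prod_symm _ hg']
    have swapI : ∀ g : (Fin (n + 1) → ℝ) → ℝ, Integrable g (laplacePi (n + 1)) →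
        Integrable (fun z => ∫ a, g (Fin.cons a z) ∂laplace) (laplacePi n) := by
      intro g hg
      have hg' : Integrable (fun p : ℝ × (Fin n → ℝ) => g (Fin.cons p.1 p.2))
          (laplace.prod (laplacePi n)) := mp.integrable_comp_of_integrable hg
      exact hg'.integral_prod_right
    -- the sections of `H` and its partial mean are Lipschitz
    have hsec : ∀ z, LipschitzWith C fun a => H (Fin.cons a z) := fun z =>
      LipschitzWith.of_dist_le_mul fun a b => (hH.dist_le_mul _ _).trans (by
        gcongr; exact (dist_cons_le a b z z).trans (by simp))
    have hsec' : ∀ a, LipschitzWith C fun z : Fin n → ℝ => H (Fin.cons a z) := fun a =>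
      LipschitzWith.of_dist_le_mul fun z w => (hH.dist_le_mul _ _).trans (by
        gcongr; exact (dist_cons_le a a z w).trans (by simp))
    have hsecI : ∀ z, Integrable (fun a => H (Fin.cons a z)) laplace := fun z =>
      ((memLp_two_iff_integrable_sq (hsec z).continuous.aestronglyMeasurable).2
        (integrable_laplace_of_lipschitz_sq (hsec z))).integrable (by norm_num)
    set Hb : (Fin n → ℝ) → ℝ := fun z => ∫ a, H (Fin.cons a z) ∂laplace with hHb
    have hHbL : LipschitzWith C Hb := LipschitzWith.of_dist_le_mul fun z w => by
      rw [dist_eq_norm, hHb]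
      simp only
      rw [← integral_sub (hsecI z) (hsecI w)]
      refine (norm_integral_le_of_norm_le_const (C := C * dist z w)
        (.of_forall fun a => ?_)).trans (by simp)
      rw [← dist_eq_norm]
      exact (hsec' a).dist_le_mul z w
    have hH2 := (memLp_laplacePi_of_lipschitz hH).integrable_sq
    have hH1 := (memLp_laplacePi_of_lipschitz hH).integrable (by norm_num)
    have hB2 := (memLp_laplacePi_of_lipschitz hHbL).integrable_sq
    -- the contribution of the first coordinate
    have first : ∫ z, ((∫ a, H (Fin.cons a z) ^ 2 ∂laplace) - Hb z ^ 2) ∂laplacePi n ≤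
        4 * ∫ x, lineDeriv ℝ H x (Pi.single 0 1) ^ 2 ∂laplacePi (n + 1) := by
      rw [swap _ (integrable_sq_lineDeriv hH 0), ← integral_const_mul]
      refine integral_mono ((swapI _ hH2).sub hB2)
        ((swapI _ (integrable_sq_lineDeriv hH 0)).const_mul 4) fun z => ?_
      have h := laplace_poincare (hsec z)
      have hd : ∀ a, deriv (fun a => H (Fin.cons a z)) a =
          lineDeriv ℝ H (Fin.cons a z) (Pi.single 0 1) := by
        intro a
        simp only [lineDeriv, cons_add_smul_single_zero]
        have := deriv_comp_const_add (fun a => H (Fin.cons a z)) a 0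
        rw [add_zero] at this
        exact this.symm
      simp_rw [hd] at h
      exact h
    -- the contribution of the other coordinates
    have rest : ∀ i : Fin n, ∫ z, lineDeriv ℝ Hb z (Pi.single i 1) ^ 2 ∂laplacePi n ≤
        ∫ x, lineDeriv ℝ H x (Pi.single i.succ 1) ^ 2 ∂laplacePi (n + 1) := by
      intro i
      have hae : ∀ᵐ x ∂laplacePi (n + 1), LineDifferentiableAt ℝ H x (Pi.single i.succ 1) :=
        (laplacePi_absolutelyContinuous _).ae_le (hH.ae_lineDifferentiableAt _)
      have hae2 : ∀ᵐ z ∂laplacePi n, ∀ᵐ a ∂laplace,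
          LineDifferentiableAt ℝ H (Fin.cons a z) (Pi.single i.succ 1) :=
        Measure.ae_ae_of_ae_prod
          ((mp.comp Measure.measurePreserving_swap).quasiMeasurePreserving.ae hae)
      rw [swap _ (integrable_sq_lineDeriv hH i.succ)]
      refine integral_mono_ae (integrable_sq_lineDeriv hHbL i)
        (swapI _ (integrable_sq_lineDeriv hH i.succ)) ?_
      filter_upwards [hae2] with z hz
      have hmeas : Measurable fun a : ℝ =>
          lineDeriv ℝ H (Fin.cons a z : Fin (n + 1) → ℝ) (Pi.single i.succ 1) :=
        (measurable_lineDeriv hH.continuous).comp (mp.measurable.comp (measurable_id.prodMk measurable_const))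
      have hder := hasDerivAt_integral_of_dominated_loc_of_lip (μ := laplace) (x₀ := (0 : ℝ))
        (F := fun t a => H (Fin.cons a (z + t • Pi.single i 1)))
        (F' := fun a => lineDeriv ℝ H (Fin.cons a z) (Pi.single i.succ 1))
        (bound := fun _ => (C : ℝ)) (s := univ) univ_mem
        (.of_forall fun t => (hsec _).continuous.aestronglyMeasurable)
        (by simpa using hsecI z) hmeas.aestronglyMeasurable
        (.of_forall fun a => by
          refine LipschitzWith.lipschitzOnWith (LipschitzWith.of_dist_le_mul fun t r => ?_)
          refine ((hsec' a).dist_le_mul _ _).trans ?_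
          rw [dist_add_left, dist_eq_norm, ← sub_smul, norm_smul, Pi.norm_single]
          simp [Real.dist_eq])
        (integrable_const _)
        (by
          filter_upwards [hz] with a ha
          have h := ha.hasLineDerivAt
          simp only [HasLineDerivAt, cons_add_smul_single_succ] at h
          exact h)
      have hlin : lineDeriv ℝ Hb z (Pi.single i 1) =
          ∫ a, lineDeriv ℝ H (Fin.cons a z) (Pi.single i.succ 1) ∂laplace := hder.2.deriv
      rw [hlin]
      have hsq : Integrable (fun a =>
          lineDeriv ℝ H (Fin.cons a z : Fin (n + 1) → ℝ) (Pi.single i.succ 1) ^ 2) laplace := by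
        refine (integrable_const ((C : ℝ) ^ 2)).mono' (hmeas.pow_const 2).aestronglyMeasurable
          (.of_forall fun a => ?_)
        rw [Real.norm_of_nonneg (sq_nonneg _), ← sq_abs]
        have := abs_lineDeriv_single_le hH i.succ (Fin.cons a z)
        gcongr
      exact (even_two.convexOn_pow (𝕜 := ℝ)).map_integral_le (by fun_prop) isClosed_univ
        (by simp) hder.1 hsq
    have e1 : ∫ x, H x ^ 2 ∂laplacePi (n + 1) - (∫ x, H x ∂laplacePi (n + 1)) ^ 2 =
        ∫ z, ((∫ a, H (Fin.cons a z) ^ 2 ∂laplace) - Hb z ^ 2) ∂laplacePi n +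
        (∫ z, Hb z ^ 2 ∂laplacePi n - (∫ z, Hb z ∂laplacePi n) ^ 2) := by
      rw [swap _ hH2, swap _ hH1, integral_sub (swapI _ hH2) hB2]
      ring
    rw [e1, Fin.sum_univ_succ, mul_add]
    refine add_le_add first ((ih hHbL).trans ?_)
    gcongr with i _
    exact rest i

/-! ### The `ℓ₁`-norm and the uniform distribution on its sphere -/

variable {d N : ℕ}

theorem l1Norm_nonneg (x : Vec d) : 0 ≤ l1Norm x := Finset.sum_nonneg fun _ _ => abs_nonneg _

@[simp] theorem l1Norm_zero : l1Norm (0 : Vec d) = 0 := by simp [l1Norm]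

theorem l1Norm_smul (c : ℝ) (x : Vec d) : l1Norm (c • x) = |c| * l1Norm x := by
  simp [l1Norm, abs_mul, Finset.mul_sum]

theorem l1Norm_add_le (x y : Vec d) : l1Norm (x + y) ≤ l1Norm x + l1Norm y := by
  rw [l1Norm, l1Norm, l1Norm, ← Finset.sum_add_distrib]
  exact Finset.sum_le_sum fun i _ => abs_add_le _ _

theorem l1Norm_neg (x : Vec d) : l1Norm (-x) = l1Norm x := by simp [l1Norm]

@[fun_prop]
theorem continuous_l1Norm : Continuous (l1Norm (d := d)) := by
  unfold l1Norm; fun_prop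

theorem norm_le_l1Norm (x : Vec d) : ‖x‖ ≤ l1Norm x := by
  rw [EuclideanSpace.norm_eq, Real.sqrt_le_left (l1Norm_nonneg x)]
  simp only [Real.norm_eq_abs]
  exact Finset.sum_sq_le_sq_sum_of_nonneg fun i _ => abs_nonneg _

theorem l1Norm_le_sqrt_mul_norm (x : Vec d) : l1Norm x ≤ √d * ‖x‖ := by
  rw [EuclideanSpace.norm_eq, ← Real.sqrt_mul (by positivity)]
  refine Real.le_sqrt_of_sq_le ?_
  have := sq_sum_le_card_mul_sum_sq (s := Finset.univ) (f := fun i => |x i|)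
  simpa [l1Norm] using this

theorem abs_l1Norm_sub_le (x y : Vec d) : |l1Norm x - l1Norm y| ≤ √d * ‖x - y‖ := by
  have h1 : l1Norm x ≤ l1Norm (x - y) + l1Norm y := by simpa using l1Norm_add_le (x - y) y
  have h2 : l1Norm y ≤ l1Norm (y - x) + l1Norm x := by simpa using l1Norm_add_le (y - x) x
  have h3 : l1Norm (y - x) = l1Norm (x - y) := by rw [← l1Norm_neg, neg_sub]
  refine le_trans ?_ (l1Norm_le_sqrt_mul_norm (x - y))
  rw [abs_le]; constructor <;> linarith

theorem l1Norm_pos {x : Vec d} (hx : x ≠ 0) : 0 < l1Norm x :=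
  (norm_pos_iff.2 hx).trans_le (norm_le_l1Norm x)

/-- The open `ℓ₁`-ball of radius `u` about the origin. -/
def l1Ball (d : ℕ) (u : ℝ) : Set (Vec d) := {x | l1Norm x < u}

theorem isOpen_l1Ball (u : ℝ) : IsOpen (l1Ball d u) :=
  isOpen_lt continuous_l1Norm continuous_const

theorem measurableSet_l1Ball (u : ℝ) : MeasurableSet (l1Ball d u) := (isOpen_l1Ball u).measurableSet

theorem l1Ball_mono {u v : ℝ} (h : u ≤ v) : l1Ball d u ⊆ l1Ball d v :=
  fun _ hx => lt_of_lt_of_le hx h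

theorem l1Ball_subset_ball (u : ℝ) : l1Ball d u ⊆ Metric.ball 0 u := fun x hx => by
  rw [mem_ball_zero_iff]; exact (norm_le_l1Norm x).trans_lt hx

theorem volume_l1Ball_lt_top (u : ℝ) : volume (l1Ball d u) < ∞ :=
  (measure_mono (l1Ball_subset_ball u)).trans_lt measure_ball_lt_top

theorem volume_l1Ball_pos : 0 < volume (l1Ball d 1) :=
  (isOpen_l1Ball 1).measure_pos _ ⟨0, by simp [l1Ball]⟩

theorem volumeReal_l1Ball_pos : 0 < volume.real (l1Ball d 1) :=
  ENNReal.toReal_pos volume_l1Ball_pos.ne' (volume_l1Ball_lt_top 1).ne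

theorem smul_l1Ball {u : ℝ} (hu : 0 < u) : u • l1Ball d 1 = l1Ball d u := by
  ext x
  rw [mem_smul_set_iff_inv_smul_mem₀ hu.ne']
  simp only [l1Ball, mem_ofPred_eq, l1Norm_smul, abs_inv, abs_of_pos hu]
  rw [inv_mul_lt_iff₀ hu, mul_one]

theorem integrableOn_l1Ball_of_bounded {h : Vec d → ℝ} (hm : Measurable h) {c : ℝ}
    (hc : ∀ x, |h x| ≤ c) (u : ℝ) : IntegrableOn h (l1Ball d u) :=
  Measure.integrableOn_of_bounded (volume_l1Ball_lt_top u).ne hm.aestronglyMeasurable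
    (.of_forall hc)

/-- Scaling of the integral of a function that is positively homogeneous of degree zero. -/
theorem setIntegral_l1Ball {h : Vec d → ℝ} (hom : ∀ r : ℝ, 0 < r → ∀ x, h (r • x) = h x)
    {u : ℝ} (hu : 0 < u) : ∫ x in l1Ball d u, h x = u ^ d * ∫ x in l1Ball d 1, h x := by
  have e := Measure.setIntegral_comp_smul_of_pos (volume : Measure (Vec d)) h (l1Ball d 1) hu
  simp_rw [hom u hu] at e
  rw [e, smul_l1Ball hu, smul_eq_mul, finrank_euclideanSpace_fin, ← mul_assoc,
    mul_inv_cancel₀ (by positivity), one_mul]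

/-- Layer cake formula: a function that is positively homogeneous of degree zero, integrated against
a weight that depends on the `ℓ₁`-norm only. -/
theorem integral_mul_tail_l1Norm {h : Vec d → ℝ} (hm : Measurable h) {c : ℝ}
    (hc : ∀ x, |h x| ≤ c) (hom : ∀ r : ℝ, 0 < r → ∀ x, h (r • x) = h x)
    {w : ℝ → ℝ} (hw : Measurable w) (hwi : IntegrableOn (fun u => u ^ d * w u) (Ioi 0)) :
    ∫ x, h x * ∫ u in Ioi (l1Norm x), w u =
      (∫ u in Ioi (0 : ℝ), u ^ d * w u) * ∫ x in l1Ball d 1, h x := by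
  set S : Set (Vec d × ℝ) := {p | l1Norm p.1 < p.2} with hS
  have hSm : MeasurableSet S := measurableSet_lt (by fun_prop) (by fun_prop)
  set F : Vec d × ℝ → ℝ := S.indicator fun p => h p.1 * w p.2 with hF
  have hFm : Measurable F := Measurable.indicator (by fun_prop) hSm
  have sec1 : ∀ x, ∫ u in Ioi (0 : ℝ), F (x, u) = h x * ∫ u in Ioi (l1Norm x), w u := by
    intro x
    have : ∀ u, F (x, u) = (Ioi (l1Norm x)).indicator (fun u => h x * w u) u := fun u => by
      simp only [hF, hS, indicator, mem_ofPred_eq, mem_Ioi]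
    simp_rw [this]
    rw [setIntegral_indicator measurableSet_Ioi, Ioi_inter_Ioi,
      sup_eq_right.2 (l1Norm_nonneg x), integral_const_mul]
  have sec2 : ∀ u, ∀ x, F (x, u) = (l1Ball d u).indicator (fun x => h x * w u) x := fun u x => by
    simp only [hF, hS, indicator, mem_ofPred_eq, l1Ball]
    congr
  have sec2i : ∀ u ∈ Ioi (0 : ℝ), ∫ x, F (x, u) = (u ^ d * w u) * ∫ x in l1Ball d 1, h x := by
    intro u hu
    simp_rw [sec2 u]
    rw [integral_indicator (measurableSet_l1Ball u), integral_mul_const,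
      setIntegral_l1Ball hom hu]
    ring
  have sec2n : ∀ u ∈ Ioi (0 : ℝ), ∫ x, ‖F (x, u)‖ =
      ‖u ^ d * w u‖ * ∫ x in l1Ball d 1, |h x| := by
    intro u hu
    simp_rw [sec2 u, norm_indicator_eq_indicator_norm, norm_mul]
    rw [integral_indicator (measurableSet_l1Ball u), integral_mul_const]
    simp only [Real.norm_eq_abs]
    rw [setIntegral_l1Ball (h := fun x => |h x|) (fun r hr x => by rw [hom r hr]) hu,
      abs_of_pos (pow_pos (mem_Ioi.1 hu) d)]
    ring
  have hint : Integrable F (volume.prod (volume.restrict (Ioi (0 : ℝ)))) := by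
    rw [integrable_prod_iff' hFm.aestronglyMeasurable]
    constructor
    · refine .of_forall fun u => ?_
      simp_rw [sec2 u]
      rw [integrable_indicator_iff (measurableSet_l1Ball u)]
      exact (integrableOn_l1Ball_of_bounded hm hc u).mul_const _
    · refine (hwi.norm.mul_const (∫ x in l1Ball d 1, |h x|)).congr ?_
      filter_upwards [ae_restrict_mem measurableSet_Ioi] with u hu
      exact (sec2n u hu).symm
  have sw := integral_integral_swap (f := fun x u => F (x, u)) hint
  simp_rw [sec1] at sw
  rw [sw, setIntegral_congr_fun measurableSet_Ioi sec2i, integral_mul_const]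

theorem integral_laplacePi_toLp (g : Vec d → ℝ) :
    ∫ x, g (WithLp.toLp 2 x) ∂laplacePi d =
      ∫ x : Vec d, Real.exp (-l1Norm x) / 2 ^ d * g x := by
  rw [laplacePi_eq_withDensity, integral_withDensity_eq_integral_toReal_smul (by fun_prop)
    (by simp), ← (PiLp.volume_preserving_toLp (Fin d)).integral_comp
      (MeasurableEquiv.toLp 2 (Fin d → ℝ)).measurableEmbedding]
  refine integral_congr_ae (.of_forall fun x => ?_)
  simp only [smul_eq_mul, l1Norm]
  rw [ENNReal.toReal_ofReal (by positivity)]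

theorem integral_exp_neg_l1Norm_mul {h : Vec d → ℝ} (hm : Measurable h) {c : ℝ}
    (hc : ∀ x, |h x| ≤ c) (hom : ∀ r : ℝ, 0 < r → ∀ x, h (r • x) = h x) :
    ∫ x, Real.exp (-l1Norm x) * h x = d.factorial * ∫ x in l1Ball d 1, h x := by
  rw [← integral_pow_mul_exp_neg d, ← integral_mul_tail_l1Norm hm hc hom
    (w := fun u => Real.exp (-u)) (by fun_prop) (integrableOn_pow_mul_exp_neg d)]
  simp_rw [integral_exp_neg_Ioi, mul_comm]

theorem integral_sq_sub_mul_exp_neg {r : ℝ} (hr : 0 ≤ r) :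
    ∫ u in Ioi r, (u ^ 2 - 2 * u) * Real.exp (-u) = r ^ 2 * Real.exp (-r) := by
  have hd : ∀ u ∈ Ici r, HasDerivAt (fun u : ℝ => -(u ^ 2 * Real.exp (-u)))
      ((u ^ 2 - 2 * u) * Real.exp (-u)) u := by
    intro u _
    have := ((hasDerivAt_pow 2 u).mul (hasDerivAt_neg u).exp).neg
    convert! this using 1
    norm_num
    ring
  have hi : IntegrableOn (fun u : ℝ => (u ^ 2 - 2 * u) * Real.exp (-u)) (Ioi r) := by
    have h := (integrableOn_pow_mul_exp_neg 2).sub ((integrableOn_pow_mul_exp_neg 1).const_mul 2)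
    refine IntegrableOn.mono_set (h.congr_fun (fun u _ => ?_) measurableSet_Ioi)
      (Ioi_subset_Ioi hr)
    simp only [Pi.sub_apply]
    ring
  have ht : Tendsto (fun u : ℝ => -(u ^ 2 * Real.exp (-u))) atTop (𝓝 (-0)) :=
    (Real.tendsto_pow_mul_exp_neg_atTop_nhds_zero 2).neg
  rw [integral_Ioi_of_hasDerivAt_of_tendsto' hd hi ht]
  ring

theorem integral_sq_mul_exp_neg_l1Norm_mul {h : Vec d → ℝ} (hm : Measurable h) {c : ℝ}
    (hc : ∀ x, |h x| ≤ c) (hom : ∀ r : ℝ, 0 < r → ∀ x, h (r • x) = h x) :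
    ∫ x, Real.exp (-l1Norm x) * (l1Norm x ^ 2 * h x) =
      (d : ℝ) * (d + 1) * (d.factorial * ∫ x in l1Ball d 1, h x) := by
  have i1 := integrableOn_pow_mul_exp_neg (d + 1)
  have i2 := integrableOn_pow_mul_exp_neg (d + 2)
  have e : ∀ u : ℝ, u ^ d * ((u ^ 2 - 2 * u) * Real.exp (-u)) =
      u ^ (d + 2) * Real.exp (-u) - 2 * (u ^ (d + 1) * Real.exp (-u)) := fun u => by ring
  have hI : ∫ u in Ioi (0 : ℝ), u ^ d * ((u ^ 2 - 2 * u) * Real.exp (-u)) =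
      (d : ℝ) * (d + 1) * d.factorial := by
    simp_rw [e]
    rw [integral_sub i2 (i1.const_mul 2), integral_const_mul, integral_pow_mul_exp_neg,
      integral_pow_mul_exp_neg, Nat.factorial_succ (d + 1), Nat.factorial_succ d]
    push_cast
    ring
  rw [← mul_assoc, ← hI, ← integral_mul_tail_l1Norm hm hc hom
    (w := fun u => (u ^ 2 - 2 * u) * Real.exp (-u)) (by fun_prop)
    (by simp_rw [e]; exact i2.sub (i1.const_mul 2))]
  refine integral_congr_ae (.of_forall fun x => ?_)
  simp only [integral_sq_sub_mul_exp_neg (l1Norm_nonneg x)]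
  ring

instance isProbabilityMeasure_unifL1Sphere (d : ℕ) : IsProbabilityMeasure (unifL1Sphere d) := by
  have : IsProbabilityMeasure (ProbabilityTheory.cond (volume : Measure (Vec d))
      {x | l1Norm x < 1}) :=
    ProbabilityTheory.cond_isProbabilityMeasure_of_finite volume_l1Ball_pos.ne'
      (volume_l1Ball_lt_top 1).ne
  exact Measure.isProbabilityMeasure_map (by fun_prop)

theorem measurable_radial : Measurable fun x : Vec d => (l1Norm x)⁻¹ • x := by fun_prop

theorem integral_unifL1Sphere {g : Vec d → ℝ} (hg : Measurable g) :
    ∫ s, g s ∂unifL1Sphere d =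
      (volume.real (l1Ball d 1))⁻¹ * ∫ x in l1Ball d 1, g ((l1Norm x)⁻¹ • x) := by
  rw [unifL1Sphere, integral_map measurable_radial.aemeasurable hg.aestronglyMeasurable,
    ProbabilityTheory.cond, integral_smul_measure, smul_eq_mul, ENNReal.toReal_inv]
  rfl

theorem radial_smul {r : ℝ} (hr : 0 < r) (x : Vec d) :
    (l1Norm (r • x))⁻¹ • (r • x) = (l1Norm x)⁻¹ • x := by
  rw [l1Norm_smul, abs_of_pos hr, smul_smul]
  congr 1
  field_simp

/-- The volume of the unit `ℓ₁`-ball is `2 ^ d / d!`, since the Laplace distribution is a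
probability measure. -/
theorem factorial_mul_volume_l1Ball : (d.factorial : ℝ) * volume.real (l1Ball d 1) = 2 ^ d := by
  have h := integral_laplacePi_toLp (d := d) fun _ => 1
  simp_rw [div_mul_eq_mul_div] at h
  rw [integral_div, integral_exp_neg_l1Norm_mul (c := 1) measurable_const (by simp) (by simp)] at h
  simp only [integral_const, probReal_univ, smul_eq_mul, mul_one, measureReal_restrict_apply_univ]
    at h
  field_simp at h
  exact h.symm

/-- The uniform distribution on the `ℓ₁`-sphere integrates a function `g` like the Laplace
distribution integrates `x ↦ g (x / ‖x‖₁)`. -/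
theorem integral_laplacePi_radial {g : Vec d → ℝ} (hg : Measurable g) {c : ℝ}
    (hc : ∀ x, |g ((l1Norm x)⁻¹ • x)| ≤ c) :
    ∫ x, g ((l1Norm (WithLp.toLp 2 x : Vec d))⁻¹ • WithLp.toLp 2 x) ∂laplacePi d =
      ∫ s, g s ∂unifL1Sphere d := by
  rw [integral_laplacePi_toLp fun x => g ((l1Norm x)⁻¹ • x)]
  simp_rw [div_mul_eq_mul_div]
  rw [integral_div, integral_exp_neg_l1Norm_mul (h := fun x => g ((l1Norm x)⁻¹ • x))
    (hg.comp measurable_radial) (fun x => hc _) (fun r hr x => by simp only [radial_smul hr]), integral_unifL1Sphere hg,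
    ← factorial_mul_volume_l1Ball (d := d)]
  have := volumeReal_l1Ball_pos (d := d)
  field_simp

/-- Under the Laplace distribution the squared `ℓ₁`-norm, which has mean `d (d + 1)`, is uncorrelated
with the functions of the direction `x / ‖x‖₁`. -/
theorem integral_laplacePi_sq_mul_radial {g : Vec d → ℝ} (hg : Measurable g) {c : ℝ}
    (hc : ∀ x, |g ((l1Norm x)⁻¹ • x)| ≤ c) :
    ∫ x, l1Norm (WithLp.toLp 2 x : Vec d) ^ 2 *
        g ((l1Norm (WithLp.toLp 2 x : Vec d))⁻¹ • WithLp.toLp 2 x) ∂laplacePi d =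
      d * (d + 1) * ∫ s, g s ∂unifL1Sphere d := by
  rw [integral_laplacePi_toLp fun x => l1Norm x ^ 2 * g ((l1Norm x)⁻¹ • x)]
  simp_rw [div_mul_eq_mul_div]
  rw [integral_div, integral_sq_mul_exp_neg_l1Norm_mul (h := fun x => g ((l1Norm x)⁻¹ • x))
    (hg.comp measurable_radial) (fun x => hc _) (fun r hr x => by simp only [radial_smul hr]), integral_unifL1Sphere hg,
    ← factorial_mul_volume_l1Ball (d := d)]
  have := volumeReal_l1Ball_pos (d := d)
  field_simp

theorem ae_volume_ne_zero (hd : 0 < d) : ∀ᵐ x : Vec d, x ≠ 0 := by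
  have : Nonempty (Fin d) := ⟨⟨0, hd⟩⟩
  rw [ae_iff]
  simp only [ne_eq, not_not, ofPred_eq_eq_singleton]
  exact measure_singleton 0

theorem ae_unifL1Sphere (hd : 0 < d) : ∀ᵐ s ∂unifL1Sphere d, l1Norm s = 1 := by
  rw [unifL1Sphere, ae_map_iff measurable_radial.aemeasurable
    (measurableSet_eq_fun (by fun_prop) (by fun_prop))]
  refine (ProbabilityTheory.cond_absolutelyContinuous).ae_le ?_
  filter_upwards [ae_volume_ne_zero hd] with x hx
  rw [l1Norm_smul, abs_inv, abs_of_pos (l1Norm_pos hx), inv_mul_cancel₀ (l1Norm_pos hx).ne']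

theorem norm_radial_le_one (x : Vec d) : ‖(l1Norm x)⁻¹ • x‖ ≤ 1 := by
  rcases eq_or_ne x 0 with rfl | hx
  · simp
  · rw [norm_smul, norm_inv, Real.norm_of_nonneg (l1Norm_nonneg x), inv_mul_eq_div,
      div_le_one (l1Norm_pos hx)]
    exact norm_le_l1Norm x

theorem l1Norm_smul_radial (x : Vec d) : l1Norm x • ((l1Norm x)⁻¹ • x) = x := by
  rcases eq_or_ne x 0 with rfl | hx
  · simp
  · rw [smul_smul, mul_inv_cancel₀ (l1Norm_pos hx).ne', one_smul]

/-- The mean squared Euclidean norm on the `ℓ₁`-sphere. -/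
theorem integral_unifL1Sphere_norm_sq :
    (d * (d + 1)) * ∫ s, ‖s‖ ^ 2 ∂unifL1Sphere d = 2 * d := by
  have e2 : ∀ x : Fin d → ℝ, l1Norm (WithLp.toLp 2 x : Vec d) ^ 2 *
      ‖(l1Norm (WithLp.toLp 2 x : Vec d))⁻¹ • (WithLp.toLp 2 x : Vec d)‖ ^ 2 =
      ∑ i, x i ^ 2 := by
    intro x
    have hn : ‖(WithLp.toLp 2 x : Vec d)‖ ^ 2 = ∑ i, x i ^ 2 := by
      rw [EuclideanSpace.norm_sq_eq]; simp
    have h := congrArg norm (l1Norm_smul_radial (WithLp.toLp 2 x : Vec d))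
    rw [norm_smul, Real.norm_of_nonneg (l1Norm_nonneg _)] at h
    rw [← mul_pow, h, hn]
  have h := integral_laplacePi_sq_mul_radial (d := d) (g := fun s => ‖s‖ ^ 2) (c := 1)
    (by fun_prop) fun x => by
      rw [abs_of_nonneg (by positivity)]
      exact pow_le_one₀ (norm_nonneg _) (norm_radial_le_one x)
  simp_rw [e2] at h
  rw [integral_finsetSum _ fun i _ => integrable_laplacePi_sq_coord d i] at h
  simp_rw [integral_laplacePi_sq_coord] at h
  rw [← h]
  simp [mul_comm]

/-! ### Variance of Lipschitz functions on the `ℓ₁`-sphere -/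

/-- The extension of a function from the `ℓ₁`-sphere to the whole space that is positively
homogeneous of degree one. -/
noncomputable def homExt (h : Vec d → ℝ) (x : Vec d) : ℝ :=
  l1Norm x * h ((l1Norm x)⁻¹ • x)

/-- The Lipschitz bound of the homogeneous extension at a point `x`, with a constant that depends on
the direction `x / ‖x‖₁` only. -/
theorem abs_homExt_sub_le {h : Vec d → ℝ} {L : ℝ} (hL : ∀ x y, |h x - h y| ≤ L * ‖x - y‖)
    (hL0 : 0 ≤ L) (x y : Vec d) :
    |homExt h y - homExt h x| ≤
      (√d * |h ((l1Norm x)⁻¹ • x)| + L * (1 + √d * ‖(l1Norm x)⁻¹ • x‖)) * ‖y - x‖ := by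
  set p := (l1Norm x)⁻¹ • x with hp
  set q := (l1Norm y)⁻¹ • y with hq
  have e1 : homExt h y - homExt h x = (l1Norm y - l1Norm x) * h p + l1Norm y * (h q - h p) := by
    simp only [homExt, ← hp, ← hq]; ring
  have hx : l1Norm x • p = x := l1Norm_smul_radial x
  have hy : l1Norm y • q = y := l1Norm_smul_radial y
  have e2 : l1Norm y • (q - p) = (y - x) + (l1Norm x - l1Norm y) • p := by
    rw [smul_sub, hy, sub_smul, hx]; abel
  have n2 : l1Norm y * ‖q - p‖ ≤ ‖y - x‖ + √d * ‖y - x‖ * ‖p‖ := by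
    calc l1Norm y * ‖q - p‖ = ‖l1Norm y • (q - p)‖ := by
          rw [norm_smul, Real.norm_of_nonneg (l1Norm_nonneg y)]
      _ ≤ ‖y - x‖ + |l1Norm x - l1Norm y| * ‖p‖ := by
          rw [e2, ← Real.norm_eq_abs, ← norm_smul]; exact norm_add_le _ _
      _ ≤ _ := by
          gcongr
          rw [abs_sub_comm]
          exact abs_l1Norm_sub_le y x
  rw [e1]
  calc |(l1Norm y - l1Norm x) * h p + l1Norm y * (h q - h p)|
      ≤ |l1Norm y - l1Norm x| * |h p| + l1Norm y * |h q - h p| := by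
        refine (abs_add_le _ _).trans ?_
        rw [abs_mul, abs_mul, abs_of_nonneg (l1Norm_nonneg y)]
    _ ≤ (√d * ‖y - x‖) * |h p| + l1Norm y * (L * ‖q - p‖) := by
        gcongr
        · exact abs_l1Norm_sub_le y x
        · exact l1Norm_nonneg y
        · exact hL q p
    _ = (√d * ‖y - x‖) * |h p| + L * (l1Norm y * ‖q - p‖) := by ring
    _ ≤ (√d * ‖y - x‖) * |h p| + L * (‖y - x‖ + √d * ‖y - x‖ * ‖p‖) := by gcongr
    _ = _ := by ring

/-- At a point of differentiability, a one-point Lipschitz bound for the Euclidean norm bounds the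
Euclidean norm of the vector of the partial derivatives. -/
theorem sum_sq_lineDeriv_le {F : (Fin d → ℝ) → ℝ} {x : Fin d → ℝ} (hF : DifferentiableAt ℝ F x)
    {K : ℝ} (hK : 0 ≤ K)
    (hb : ∀ y : Fin d → ℝ, |F y - F x| ≤ K * ‖(WithLp.toLp 2 (y - x) : Vec d)‖) :
    ∑ i, lineDeriv ℝ F x (Pi.single i 1) ^ 2 ≤ K ^ 2 := by
  set p : Fin d → ℝ := fun i => lineDeriv ℝ F x (Pi.single i 1) with hp
  have hpi : ∀ i, fderiv ℝ F x (Pi.single i 1) = p i := fun i =>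
    (hF.lineDeriv_eq_fderiv (v := Pi.single i 1)).symm
  have hDp : lineDeriv ℝ F x p = ∑ i, p i ^ 2 := by
    rw [hF.lineDeriv_eq_fderiv]
    conv_lhs => rw [pi_eq_sum_univ' p]
    rw [map_sum]
    refine Finset.sum_congr rfl fun i _ => ?_
    rw [map_smul]
    rw [hpi, smul_eq_mul, sq]
  have hn : ‖(WithLp.toLp 2 p : Vec d)‖ ^ 2 = ∑ i, p i ^ 2 := by
    rw [EuclideanSpace.norm_sq_eq]; simp
  set r := ‖(WithLp.toLp 2 p : Vec d)‖ with hr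
  have hle : ‖lineDeriv ℝ F x p‖ ≤ K * r := by
    refine HasDerivAt.le_of_lip' (hF.lineDifferentiableAt (v := p)).hasLineDerivAt
      (by positivity) (.of_forall fun t => ?_)
    have h := hb (x + t • p)
    simp only [zero_smul, add_zero, sub_zero]
    rw [add_sub_cancel_left, WithLp.toLp_smul, norm_smul] at h
    calc _ ≤ _ := h
      _ = _ := by ring
  rw [hDp, ← hn, Real.norm_of_nonneg (by positivity)] at hle
  rw [← hn]
  have hr0 : 0 ≤ r := norm_nonneg _
  rcases hr0.eq_or_lt with h0 | h0
  · rw [← h0, zero_pow two_ne_zero]; positivity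
  · have : r ≤ K := by
      rw [sq] at hle
      exact le_of_mul_le_mul_right hle h0
    gcongr

/-- An odd `L`-Lipschitz function on the `ℓ₁`-sphere has variance of order `L ^ 2 / d ^ 2`. The
homogeneous extension turns the Poincaré inequality for the Laplace distribution into
`d (d + 1) 𝔼 h² ≤ 12 d 𝔼 h² + 36 L²`; in low dimensions the bound `|h| ≤ L` suffices. -/
theorem integral_sq_unifL1Sphere_le (hd : 0 < d) {h : Vec d → ℝ} {L : ℝ}
    (hL : ∀ x y, |h x - h y| ≤ L * ‖x - y‖) (hL0 : 0 ≤ L) (hodd : ∀ x, h (-x) = -h x) :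
    (d : ℝ) ^ 2 * ∫ s, h s ^ 2 ∂unifL1Sphere d ≤ 500 * L ^ 2 := by
  have hLip : LipschitzWith L.toNNReal h := LipschitzWith.of_dist_le_mul fun x y => by
    rw [Real.dist_eq, dist_eq_norm, Real.coe_toNNReal L hL0]; exact hL x y
  have hcont := hLip.continuous
  have h0 : h 0 = 0 := by have := hodd 0; rw [neg_zero] at this; linarith
  have hn : ∀ x, |h x| ≤ L * ‖x‖ := fun x => by simpa [h0] using hL x 0
  have hp : ∀ x : Vec d, |h ((l1Norm x)⁻¹ • x)| ≤ L := fun x =>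
    (hn _).trans (mul_le_of_le_one_right hL0 (norm_radial_le_one x))
  set k : Vec d → ℝ := fun s => √d * |h s| + L * (1 + √d * ‖s‖) with hk
  have hk0 : ∀ s, 0 ≤ k s := fun s => by positivity
  have hkb : ∀ x : Vec d, k ((l1Norm x)⁻¹ • x) ≤ √d * L + L * (1 + √d * 1) := fun x => by
    simp only [hk]
    gcongr
    · exact hp x
    · exact norm_radial_le_one x
  set c : ℝ := √d * L + L * (1 + √d * 1) with hc
  have hc0 : 0 ≤ c := by positivity
  have hinc : ∀ x y, |homExt h y - homExt h x| ≤ k ((l1Norm x)⁻¹ • x) * ‖y - x‖ :=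
    abs_homExt_sub_le hL hL0
  have hHL : LipschitzWith c.toNNReal (homExt h) := LipschitzWith.of_dist_le_mul fun x y => by
    rw [Real.dist_eq, dist_eq_norm, Real.coe_toNNReal c hc0]
    exact (hinc y x).trans (by gcongr; exact hkb y)
  set F : (Fin d → ℝ) → ℝ := fun x => homExt h (WithLp.toLp 2 x) with hF
  have hFL : LipschitzWith _ F := hHL.comp (PiLp.lipschitzWith_toLp 2 (fun _ : Fin d => ℝ))
  have hFodd : ∫ x, F x ∂laplacePi d = 0 := by
    simp only [hF]
    rw [integral_laplacePi_toLp]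
    have e := integral_neg_eq_self
      (fun x : Vec d => Real.exp (-l1Norm x) / 2 ^ d * homExt h x) volume
    have e2 : ∀ x : Vec d, Real.exp (-l1Norm (-x)) / 2 ^ d * homExt h (-x) =
        -(Real.exp (-l1Norm x) / 2 ^ d * homExt h x) := fun x => by
      simp only [homExt, l1Norm_neg, smul_neg, hodd]; ring
    simp_rw [e2] at e
    rw [integral_neg] at e
    linarith
  have hFsq : ∫ x, F x ^ 2 ∂laplacePi d = d * (d + 1) * ∫ s, h s ^ 2 ∂unifL1Sphere d := by
    rw [← integral_laplacePi_sq_mul_radial (g := fun s => h s ^ 2) (c := L ^ 2)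
      (by have := hcont.measurable; fun_prop) fun x => by
        rw [abs_of_nonneg (sq_nonneg _), ← sq_abs]
        have := hp x
        gcongr]
    simp only [hF, homExt, mul_pow]
  have hsecond : ∑ i, ∫ x, lineDeriv ℝ F x (Pi.single i 1) ^ 2 ∂laplacePi d ≤
      ∫ s, k s ^ 2 ∂unifL1Sphere d := by
    have hkm : Measurable k := by have := hcont.measurable; fun_prop
    have hkb2 : ∀ x : Vec d, |k ((l1Norm x)⁻¹ • x) ^ 2| ≤ c ^ 2 := fun x => by
      rw [abs_of_nonneg (sq_nonneg _)]
      have := hkb x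
      have := hk0 ((l1Norm x)⁻¹ • x)
      gcongr
    rw [← integral_finsetSum _ fun i _ => integrable_sq_lineDeriv hFL i,
      ← integral_laplacePi_radial (g := fun s => k s ^ 2) (by fun_prop) hkb2]
    have hmt : Measurable fun x : Fin d → ℝ => (WithLp.toLp 2 x : Vec d) :=
      (MeasurableEquiv.toLp 2 (Fin d → ℝ)).measurable
    refine integral_mono_ae (integrable_finsetSum _ fun i _ => integrable_sq_lineDeriv hFL i)
      ?_ ?_
    · refine (integrable_const (c ^ 2)).mono' ?_ (.of_forall fun x => hkb2 _)
      exact ((hkm.comp (measurable_radial.comp hmt)).pow_const 2).aestronglyMeasurable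
    · filter_upwards [(laplacePi_absolutelyContinuous d).ae_le hFL.ae_differentiableAt]
        with x hx
      exact sum_sq_lineDeriv_le hx (hk0 _) fun y => by
        rw [WithLp.toLp_sub]; exact hinc (WithLp.toLp 2 x) (WithLp.toLp 2 y)
  have hpoin := laplacePi_poincare d hFL
  have hsph := ae_unifL1Sphere hd
  have hns : ∀ᵐ s ∂unifL1Sphere d, ‖s‖ ≤ 1 := by
    filter_upwards [hsph] with s hs using hs ▸ norm_le_l1Norm s
  have hint1 : Integrable (fun s => h s ^ 2) (unifL1Sphere d) := by
    refine (integrable_const (L ^ 2)).mono' (by fun_prop) ?_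
    filter_upwards [hns] with s hs
    rw [Real.norm_of_nonneg (sq_nonneg _), ← sq_abs]
    have := (hn s).trans (mul_le_of_le_one_right hL0 hs)
    gcongr
  have hint2 : Integrable (fun s : Vec d => ‖s‖ ^ 2) (unifL1Sphere d) := by
    refine (integrable_const (1 : ℝ)).mono' (by fun_prop) ?_
    filter_upwards [hns] with s hs
    rw [Real.norm_of_nonneg (sq_nonneg _)]
    exact pow_le_one₀ (norm_nonneg _) hs
  have hkint : ∫ s, k s ^ 2 ∂unifL1Sphere d ≤
      3 * d * ∫ s, h s ^ 2 ∂unifL1Sphere d + 3 * L ^ 2 +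
        3 * L ^ 2 * (d * ∫ s, ‖s‖ ^ 2 ∂unifL1Sphere d) := by
    have e : 3 * d * ∫ s, h s ^ 2 ∂unifL1Sphere d + 3 * L ^ 2 +
        3 * L ^ 2 * (d * ∫ s, ‖s‖ ^ 2 ∂unifL1Sphere d) =
        ∫ s, (3 * d * h s ^ 2 + 3 * L ^ 2 + 3 * L ^ 2 * (d * ‖s‖ ^ 2)) ∂unifL1Sphere d := by
      have i1 : Integrable (fun s => 3 * d * h s ^ 2 + 3 * L ^ 2) (unifL1Sphere d) :=
        (hint1.const_mul _).add (integrable_const _)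
      rw [integral_add i1 ((hint2.const_mul _).const_mul _),
        integral_add (hint1.const_mul _) (integrable_const _), integral_const_mul,
        integral_const_mul, integral_const_mul, integral_const_mul]
      simp
    rw [e]
    refine integral_mono_of_nonneg (.of_forall fun s => sq_nonneg _)
      (((hint1.const_mul _).add (integrable_const _)).add ((hint2.const_mul _).const_mul _))
      (.of_forall fun s => ?_)
    have hsd : √(d : ℝ) ^ 2 = d := Real.sq_sqrt (by positivity)
    set a := √(d : ℝ) * |h s|
    have ha : a ^ 2 = d * h s ^ 2 := by rw [mul_pow, sq_abs, hsd]
    have hb : (L * (√d * ‖s‖)) ^ 2 = L ^ 2 * (d * ‖s‖ ^ 2) := by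
      rw [mul_pow, mul_pow, hsd]
    set b := L * (√(d : ℝ) * ‖s‖)
    have hks : k s = a + L + b := by simp only [hk, a, b]; ring
    simp only [hks]
    nlinarith [sq_nonneg (a - L), sq_nonneg (a - b), sq_nonneg (L - b)]
  have hNs := integral_unifL1Sphere_norm_sq (d := d)
  have hd' : (1 : ℝ) ≤ d := by exact_mod_cast hd
  set V := ∫ s, h s ^ 2 ∂unifL1Sphere d with hV
  set W := ∫ s, ‖s‖ ^ 2 ∂unifL1Sphere d
  have hV0 : 0 ≤ V := integral_nonneg fun s => sq_nonneg _
  have hVL : V ≤ L ^ 2 := by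
    have := integral_mono_ae hint1 (integrable_const (L ^ 2)) (by
      filter_upwards [hns] with s hs
      rw [← sq_abs]
      have := (hn s).trans (mul_le_of_le_one_right hL0 hs)
      gcongr)
    simpa using this
  have hW : d * W ≤ 2 := by
    have hW0 : 0 ≤ W := integral_nonneg fun s => sq_nonneg _
    have : (d : ℝ) * (d * W + W - 2) = 0 := by linear_combination hNs
    have := (mul_eq_zero.1 this).resolve_left (by positivity)
    linarith
  have hmain : d * (d + 1) * V ≤ 12 * d * V + 36 * L ^ 2 := by
    rw [hFodd, hFsq] at hpoin
    nlinarith [mul_le_mul_of_nonneg_left hW (sq_nonneg L)]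
  rcases le_or_gt (d : ℝ) 22 with h22 | h22
  · have : (d : ℝ) ^ 2 ≤ 484 := by nlinarith
    nlinarith [mul_le_mul this hVL hV0 (by norm_num), sq_nonneg L]
  · have : 0 ≤ d * V * (d - 22) := by
      have : (0 : ℝ) ≤ d - 22 := by linarith
      positivity
    nlinarith [sq_nonneg L]

/-! ### The divergence theorem on the `ℓ₁`-ball -/

theorem measurable_signVec : Measurable (signVec (d := d)) := by
  refine (MeasurableEquiv.toLp 2 (Fin d → ℝ)).measurable.comp (measurable_pi_lambda _ fun i => ?_)
  exact Measurable.ite (measurableSet_lt (by fun_prop) measurable_const) measurable_const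
    measurable_const

theorem norm_signVec_sq (x : Vec d) : ‖signVec x‖ ^ 2 = d := by
  rw [EuclideanSpace.norm_sq_eq, Finset.sum_congr rfl (g := fun _ => (1 : ℝ)) fun i _ => ?_]
  · simp
  · simp only [signVec]
    split_ifs <;> simp

theorem norm_signVec (x : Vec d) : ‖signVec x‖ = √d := by
  rw [← norm_signVec_sq x, Real.sqrt_sq (norm_nonneg _)]

theorem signVec_smul {r : ℝ} (hr : 0 < r) (x : Vec d) : signVec (r • x) = signVec x := by
  ext i
  simp only [signVec, PiLp.smul_apply, smul_eq_mul, mul_neg_iff, hr, hr.not_gt, true_and,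
    false_and, or_false]

theorem ae_volume_coord_ne_zero : ∀ᵐ x : Vec d, ∀ i, x i ≠ 0 := by
  refine ae_all_iff.2 fun i => ?_
  exact (PiLp.volume_preserving_ofLp (Fin d)).quasiMeasurePreserving.ae
    (Measure.ae_eval_ne (μ := fun _ : Fin d => (volume : Measure ℝ)) i 0)

theorem convex_l1Ball (u : ℝ) : Convex ℝ (l1Ball d u) := by
  rintro x hx y hy a b ha hb hab
  calc l1Norm (a • x + b • y) ≤ a * l1Norm x + b * l1Norm y := by
        refine (l1Norm_add_le _ _).trans ?_
        rw [l1Norm_smul, l1Norm_smul, abs_of_nonneg ha, abs_of_nonneg hb]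
    _ < u := by
        simp only [l1Ball, mem_ofPred_eq] at hx hy
        rcases ha.eq_or_lt with h | h
        · have : b = 1 := by linarith
          subst this; rw [← h]; linarith
        · have h1 := mul_lt_mul_of_pos_left hx h
          have h2 := mul_le_mul_of_nonneg_left hy.le hb
          have h3 : a * u + b * u = u := by rw [← add_mul, hab, one_mul]
          linarith

theorem ae_volume_l1Norm_ne {a : ℝ} (ha : 0 < a) : ∀ᵐ x : Vec d, l1Norm x ≠ a := by
  have h0 := (convex_l1Ball (d := d) a).addHaar_frontier (volume : Measure (Vec d))
  rw [ae_iff]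
  refine measure_mono_null (fun x hx => ?_) h0
  simp only [ne_eq, not_not, mem_ofPred_eq] at hx
  rw [(isOpen_l1Ball a).frontier_eq]
  refine ⟨?_, fun h => (ne_of_lt h) hx⟩
  have ht : Tendsto (fun r : ℝ => r • x) (𝓝[<] 1) (𝓝 x) := by
    have : Continuous fun r : ℝ => r • x := by fun_prop
    simpa using (this.tendsto 1).mono_left nhdsWithin_le_nhds
  refine mem_closure_of_tendsto ht ?_
  filter_upwards [Ioo_mem_nhdsLT (show (0 : ℝ) < 1 by norm_num)] with r hr
  simp only [l1Ball, mem_ofPred_eq, l1Norm_smul, abs_of_pos hr.1, hx]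
  nlinarith [hr.2]

theorem hasLineDerivAt_l1Norm {x : Vec d} (hx : ∀ i, x i ≠ 0) (v : Vec d) :
    HasLineDerivAt ℝ l1Norm (inner ℝ (signVec x) v) x v := by
  have h : ∀ i : Fin d, HasDerivAt (fun t : ℝ => |x i + t * v i|)
      ((if x i < 0 then -1 else 1) * v i) 0 := by
    intro i
    have hlin : HasDerivAt (fun t : ℝ => x i + t * v i) (v i) 0 := by
      simpa using ((hasDerivAt_id (0 : ℝ)).mul_const (v i)).const_add (x i)
    have h0 : x i + 0 * v i = x i := by ring
    split_ifs with hi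
    · have := (hasDerivAt_abs_neg hi)
      rw [← h0] at this
      exact this.comp 0 hlin
    · have := (hasDerivAt_abs_pos (lt_of_le_of_ne (not_lt.1 hi) (hx i).symm))
      rw [← h0] at this
      exact this.comp 0 hlin
  have hs := HasDerivAt.fun_sum (u := Finset.univ) fun i _ => h i
  have e : inner ℝ (signVec x) v = ∑ i, (if x i < 0 then -1 else 1) * v i := by
    simp only [PiLp.inner_apply, signVec]
    refine Finset.sum_congr rfl fun i _ => ?_
    simp [mul_comm]
  rw [HasLineDerivAt, e]
  exact hs

/-- The cone function `x ↦ max 0 (a - ‖x‖₁)`. -/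
noncomputable def l1Cone (a : ℝ) (x : Vec d) : ℝ := max 0 (a - l1Norm x)

theorem lipschitzWith_l1Cone (a : ℝ) : LipschitzWith (√d).toNNReal (l1Cone (d := d) a) := by
  refine LipschitzWith.of_dist_le_mul fun x y => ?_
  rw [Real.dist_eq, dist_eq_norm, Real.coe_toNNReal _ (Real.sqrt_nonneg _)]
  refine le_trans ?_ (abs_l1Norm_sub_le x y)
  rw [l1Cone, l1Cone]
  refine (abs_max_sub_max_le_max _ _ _ _).trans (max_le (by simp) (le_of_eq ?_))
  rw [← abs_neg]
  congr 1
  ring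

theorem l1Cone_eq_zero {a : ℝ} {x : Vec d} (hx : x ∉ l1Ball d a) : l1Cone a x = 0 :=
  max_eq_left (sub_nonpos.2 (not_lt.1 hx))

theorem l1Cone_eq {a : ℝ} {x : Vec d} (hx : x ∈ l1Ball d a) : l1Cone a x = a - l1Norm x :=
  max_eq_right (sub_nonneg.2 (le_of_lt hx))

theorem hasCompactSupport_l1Cone (a : ℝ) : HasCompactSupport (l1Cone (d := d) a) := by
  refine HasCompactSupport.of_support_subset_isCompact (isCompact_closedBall (0 : Vec d) a)
    fun x hx => ?_
  by_contra h
  refine hx (l1Cone_eq_zero fun h2 => h ?_)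
  exact Metric.ball_subset_closedBall (l1Ball_subset_ball a h2)

theorem ae_lineDeriv_l1Cone {a : ℝ} (ha : 0 < a) (v : Vec d) :
    ∀ᵐ x : Vec d, lineDeriv ℝ (l1Cone a) x (-v) =
      (l1Ball d a).indicator (fun x => inner ℝ (signVec x) v) x := by
  filter_upwards [ae_volume_coord_ne_zero, ae_volume_l1Norm_ne ha] with x hx hxa
  have hc : Continuous fun t : ℝ => l1Norm (x + t • (-v)) := by fun_prop
  have h0 : l1Norm (x + (0 : ℝ) • (-v)) = l1Norm x := by simp
  rcases lt_or_gt_of_ne hxa with h | h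
  · rw [indicator_of_mem (show x ∈ l1Ball d a from h)]
    have hd : HasDerivAt (fun t : ℝ => a - l1Norm (x + t • (-v))) (inner ℝ (signVec x) v) 0 := by
      have := (hasLineDerivAt_l1Norm hx (-v)).const_sub a
      simpa using this
    refine HasDerivAt.deriv (hd.congr_of_eventuallyEq ?_)
    filter_upwards [hc.continuousAt.eventually_lt continuousAt_const (h0 ▸ h)] with t ht
    exact l1Cone_eq ht
  · rw [indicator_of_notMem (show x ∉ l1Ball d a from not_lt.2 h.le)]
    refine HasDerivAt.deriv ((hasDerivAt_const (0 : ℝ) (0 : ℝ)).congr_of_eventuallyEq ?_)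
    filter_upwards [continuousAt_const.eventually_lt hc.continuousAt (h0.symm ▸ h)] with t ht
    exact l1Cone_eq_zero (not_lt.2 (le_of_lt ht))

/-- The divergence theorem on `ℓ₁`-balls, integrated over the radius from `0` to `a`. -/
theorem integral_lineDeriv_mul_l1Cone {A : Vec d → ℝ} {D : ℝ≥0} (hA : LipschitzWith D A)
    {a : ℝ} (ha : 0 < a) (v : Vec d) :
    ∫ x, lineDeriv ℝ A x v * l1Cone a x =
      ∫ x in l1Ball d a, inner ℝ (signVec x) v * A x := by
  rw [LipschitzWith.integral_lineDeriv_mul_eq hA (lipschitzWith_l1Cone a)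
    (hasCompactSupport_l1Cone a), ← integral_indicator (measurableSet_l1Ball a)]
  refine integral_congr_ae ?_
  filter_upwards [ae_lineDeriv_l1Cone ha v] with x hx
  rw [hx]
  by_cases h : x ∈ l1Ball d a <;> simp [h]

/-- If the derivative of `A` in the direction `v` is at most `M` in the `ℓ₁`-ball, so is its mean,
and the divergence theorem expresses the mean by the values of `A` on the sphere. The flux through
the sphere is approximated by thin annuli. -/
theorem flux_le_of_lineDeriv_le {A : Vec d → ℝ} {D : ℝ≥0} (hA : LipschitzWith D A) (v : Vec d)
    {M : ℝ} (hM : ∀ᵐ x : Vec d, x ∈ l1Ball d 1 → lineDeriv ℝ A x v ≤ M) :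
    d * ∫ x in l1Ball d 1, inner ℝ (signVec x) v * A ((l1Norm x)⁻¹ • x) ≤
      M * volume.real (l1Ball d 1) := by
  set V := volume.real (l1Ball d 1) with hV
  set q := ∫ x in l1Ball d 1, inner ℝ (signVec x) v * A ((l1Norm x)⁻¹ • x) with hq
  have hAc := hA.continuous
  have hsg : Measurable fun x : Vec d => inner ℝ (signVec x) v := by
    have := measurable_signVec (d := d)
    fun_prop
  have hsgb : ∀ x : Vec d, |inner ℝ (signVec x) v| ≤ √d * ‖v‖ := fun x => by
    rw [← norm_signVec x]; exact abs_real_inner_le_norm _ _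
  have hAb : ∀ x : Vec d, ‖x‖ ≤ 1 → |A x| ≤ |A 0| + D := fun x hx => by
    have h := hA.dist_le_mul x 0
    rw [Real.dist_eq, dist_zero_right] at h
    have h2 : |A x| ≤ |A x - A 0| + |A 0| := by
      simpa using abs_add_le (A x - A 0) (A 0)
    have h3 : D * ‖x‖ ≤ D := mul_le_of_le_one_right D.2 hx
    linarith
  set h : Vec d → ℝ := fun x => inner ℝ (signVec x) v * A ((l1Norm x)⁻¹ • x) with hh
  have hhm : Measurable h := by
    have := hAc.measurable.comp (measurable_radial (d := d))
    exact hsg.mul this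
  have hhb : ∀ x, |h x| ≤ √d * ‖v‖ * (|A 0| + D) := fun x => by
    simp only [hh]
    rw [abs_mul]
    gcongr
    · exact hsgb x
    · exact hAb _ (norm_radial_le_one x)
  have hhom : ∀ r : ℝ, 0 < r → ∀ x, h (r • x) = h x := fun r hr x => by
    simp only [hh, radial_smul hr, signVec_smul hr]
  have hgi : IntegrableOn (fun x => inner ℝ (signVec x) v * A x) (l1Ball d 1) := by
    refine IntegrableOn.of_bound (volume_l1Ball_lt_top 1)
      (hsg.mul hAc.measurable).aestronglyMeasurable (√d * ‖v‖ * (|A 0| + D)) ?_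
    filter_upwards [ae_restrict_mem (measurableSet_l1Ball 1)] with x hx
    rw [Real.norm_eq_abs, abs_mul]
    gcongr
    · exact hsgb x
    · exact hAb _ ((norm_le_l1Norm x).trans (le_of_lt hx))
  have hhi : IntegrableOn h (l1Ball d 1) := integrableOn_l1Ball_of_bounded hhm hhb 1
  set c : ℝ := √d * ‖v‖ * D with hc
  have hVpos : 0 < V := volumeReal_l1Ball_pos
  -- the estimate on the annulus of width `ε`
  have key : ∀ ε ∈ Ioo (0 : ℝ) 1, (∑ i ∈ Finset.range d, (1 - ε) ^ i) * q -
      c * ε * (∑ i ∈ Finset.range d, (1 - ε) ^ i) * V ≤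
      M * V + |M| * ε * (∑ i ∈ Finset.range d, (1 - ε) ^ i) * V := by
    intro ε hε
    obtain ⟨b, hb⟩ : ∃ b : ℝ, b = 1 - ε := ⟨_, rfl⟩
    have hb0 : 0 < b := by linarith [hε.2]
    have hb1 : b ≤ 1 := by linarith [hε.1]
    rw [← hb]
    have hsub : l1Ball d b ⊆ l1Ball d 1 := l1Ball_mono hb1
    have hgeo : ε * ∑ i ∈ Finset.range d, b ^ i = 1 - b ^ d := by
      rw [← mul_neg_geom_sum, hb]; ring
    have hvolb : volume.real (l1Ball d b) = b ^ d * V := by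
      have := setIntegral_l1Ball (d := d) (h := fun _ => 1) (fun _ _ _ => rfl) hb0
      simpa using this
    -- the difference of two cones
    set Δ : Vec d → ℝ := fun x => l1Cone 1 x - l1Cone b x with hΔ
    have hΔ0 : ∀ x, 0 ≤ Δ x := fun x => sub_nonneg.2 (max_le_max_left _ (by linarith))
    have hΔ1 : ∀ x, Δ x ≤ ε := fun x => by
      simp only [hΔ, l1Cone]
      rcases le_total (b - l1Norm x) 0 with h1 | h1
      · rw [max_eq_left h1, sub_zero]; exact max_le hε.1.le (by linarith)
      · rw [max_eq_right h1, max_eq_right (by linarith)]; linarith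
    have hΔout : ∀ x ∉ l1Ball d 1, Δ x = 0 := fun x hx => by
      simp only [hΔ]
      rw [l1Cone_eq_zero hx, l1Cone_eq_zero fun h2 => hx (hsub h2), sub_zero]
    have hΔin : ∀ x ∈ l1Ball d b, Δ x = ε := fun x hx => by
      simp only [hΔ]
      rw [l1Cone_eq (hsub hx), l1Cone_eq hx]; linarith
    have hcone : ∀ a : ℝ, Integrable (l1Cone (d := d) a) := fun a =>
      (lipschitzWith_l1Cone a).continuous.integrable_of_hasCompactSupport
        (hasCompactSupport_l1Cone a)
    have hΔi : Integrable Δ := (hcone 1).sub (hcone b)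
    have hAcone : ∀ a : ℝ, Integrable fun x => lineDeriv ℝ A x v * l1Cone a x := fun a =>
      (hcone a).bdd_mul (aestronglyMeasurable_lineDeriv hAc _)
        (.of_forall fun x => norm_lineDeriv_le_of_lipschitz ℝ hA)
    have hup : ∫ x, Δ x ≤ ε * V := by
      rw [← setIntegral_eq_integral_of_forall_compl_eq_zero (s := l1Ball d 1) hΔout]
      refine (setIntegral_mono_on hΔi.integrableOn
        (integrableOn_const (volume_l1Ball_lt_top 1).ne) (measurableSet_l1Ball 1)
        fun x _ => hΔ1 x).trans (le_of_eq ?_)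
      simp [hV, mul_comm]
    have hlow : ε * (b ^ d * V) ≤ ∫ x, Δ x := by
      refine le_trans (le_of_eq ?_) (setIntegral_le_integral hΔi (s := l1Ball d b)
        (.of_forall hΔ0))
      rw [setIntegral_congr_fun (measurableSet_l1Ball b) hΔin]
      simp [hvolb, mul_comm]
    have hMΔ : M * ∫ x, Δ x ≤ M * (ε * V) + |M| * (ε * (1 - b ^ d) * V) := by
      have h1 : M * ((∫ x, Δ x) - ε * V) ≤ |M| * |(∫ x, Δ x) - ε * V| := by
        rw [← abs_mul]; exact le_abs_self _
      have h2 : |(∫ x, Δ x) - ε * V| ≤ ε * (1 - b ^ d) * V := by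
        rw [abs_le]
        constructor
        · linarith
        · have : b ^ d ≤ 1 := pow_le_one₀ hb0.le hb1
          have : 0 ≤ ε * (1 - b ^ d) * V :=
            mul_nonneg (mul_nonneg hε.1.le (by linarith)) hVpos.le
          linarith
      nlinarith [mul_le_mul_of_nonneg_left h2 (abs_nonneg M)]
    have hJ : ∫ x in l1Ball d 1 \ l1Ball d b, inner ℝ (signVec x) v * A x ≤ M * ∫ x, Δ x := by
      rw [setIntegral_sdiff (measurableSet_l1Ball b) hgi hsub,
        ← integral_lineDeriv_mul_l1Cone hA one_pos, ← integral_lineDeriv_mul_l1Cone hA hb0,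
        ← integral_sub (hAcone 1) (hAcone b), ← integral_const_mul]
      refine integral_mono_ae ((hAcone 1).sub (hAcone b)) (hΔi.const_mul M) ?_
      filter_upwards [hM] with x hx
      rw [← mul_sub]
      change lineDeriv ℝ A x v * Δ x ≤ M * Δ x
      by_cases hx1 : x ∈ l1Ball d 1
      · exact mul_le_mul_of_nonneg_right (hx hx1) (hΔ0 x)
      · rw [hΔout x hx1, mul_zero, mul_zero]
    have hmd : MeasurableSet (l1Ball d 1 \ l1Ball d b) :=
      (measurableSet_l1Ball 1).diff (measurableSet_l1Ball b)
    have hvd : volume.real (l1Ball d 1 \ l1Ball d b) = (1 - b ^ d) * V := by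
      rw [measureReal_sdiff hsub (measurableSet_l1Ball b) (volume_l1Ball_lt_top 1).ne, hvolb]
      ring
    have hqd : ∫ x in l1Ball d 1 \ l1Ball d b, h x = (1 - b ^ d) * q := by
      rw [setIntegral_sdiff (measurableSet_l1Ball b) hhi hsub, setIntegral_l1Ball hhom hb0]
      ring
    have hdiff : (1 - b ^ d) * q - c * ε * ((1 - b ^ d) * V) ≤
        ∫ x in l1Ball d 1 \ l1Ball d b, inner ℝ (signVec x) v * A x := by
      have hcst : ∫ _x in l1Ball d 1 \ l1Ball d b, c * ε = c * ε * ((1 - b ^ d) * V) := by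
        simp [hvd, mul_comm]
      have hvdt : volume (l1Ball d 1 \ l1Ball d b) ≠ ∞ :=
        ((measure_mono sdiff_subset).trans_lt (volume_l1Ball_lt_top 1)).ne
      rw [← hqd, ← hcst, ← integral_sub (hhi.mono_set sdiff_subset) (integrableOn_const hvdt)]
      refine setIntegral_mono_on ((hhi.mono_set sdiff_subset).sub (integrableOn_const hvdt))
        (hgi.mono_set sdiff_subset) hmd fun x hx => ?_
      have hx1 : l1Norm x < 1 := hx.1
      have hx2 : b ≤ l1Norm x := not_lt.1 hx.2
      have hdist : ‖(l1Norm x)⁻¹ • x - x‖ ≤ ε := by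
        have e : (l1Norm x)⁻¹ • x - x = (1 - l1Norm x) • ((l1Norm x)⁻¹ • x) := by
          rw [sub_smul, l1Norm_smul_radial, one_smul]
        rw [e, norm_smul, Real.norm_of_nonneg (by linarith)]
        nlinarith [norm_radial_le_one x, norm_nonneg ((l1Norm x)⁻¹ • x)]
      have hAd : |A ((l1Norm x)⁻¹ • x) - A x| ≤ D * ε := by
        have := hA.dist_le_mul ((l1Norm x)⁻¹ • x) x
        rw [Real.dist_eq, dist_eq_norm] at this
        exact this.trans (by gcongr)
      have : |inner ℝ (signVec x) v * (A ((l1Norm x)⁻¹ • x) - A x)| ≤ c * ε := by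
        rw [abs_mul, hc, mul_assoc]
        exact mul_le_mul (hsgb x) hAd (abs_nonneg _) (by positivity)
      have := le_of_abs_le this
      simp only [hh]
      linarith
    set S := ∑ i ∈ Finset.range d, b ^ i
    rw [← hgeo] at hdiff hMΔ
    have htot := (hdiff.trans hJ).trans hMΔ
    have : ε * (S * q - c * ε * S * V) ≤ ε * (M * V + |M| * ε * S * V) := by linarith
    exact le_of_mul_le_mul_left this hε.1
  have hlim : ∀ F : ℝ → ℝ, Continuous F → Tendsto F (𝓝[>] 0) (𝓝 (F 0)) := fun F hF =>
    (hF.tendsto 0).mono_left nhdsWithin_le_nhds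
  have hfin := le_of_tendsto_of_tendsto (hlim (fun ε => (∑ i ∈ Finset.range d, (1 - ε) ^ i) * q -
      c * ε * (∑ i ∈ Finset.range d, (1 - ε) ^ i) * V) (by fun_prop))
    (hlim (fun ε => M * V + |M| * ε * (∑ i ∈ Finset.range d, (1 - ε) ^ i) * V) (by fun_prop))
    (by filter_upwards [Ioo_mem_nhdsGT (show (0 : ℝ) < 1 by norm_num)] with ε hε using key ε hε)
  simpa using hfin

/-! ### The gradient estimator: approximate subgradient and second moment -/

/-- Half the symmetric difference of `f` about `y` at scale `μ`. -/
noncomputable def symmDiffHalf (μ : ℝ) (f : Vec d → ℝ) (y x : Vec d) : ℝ :=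
  (f (y + μ • x) - f (y - μ • x)) / 2

theorem gradEst_eq (μ : ℝ) (f : Vec d → ℝ) (y s : Vec d) :
    gradEst μ f y s = (d / μ * symmDiffHalf μ f y s) • signVec s := by
  rw [gradEst, symmDiffHalf]
  congr 1
  ring

theorem abs_symmDiffHalf_sub_le {f : Vec d → ℝ} {G : ℝ}
    (hf : ∀ x y, |f x - f y| ≤ G * ‖x - y‖) {μ : ℝ} (hμ : 0 ≤ μ) (y a b : Vec d) :
    |symmDiffHalf μ f y a - symmDiffHalf μ f y b| ≤ G * μ * ‖a - b‖ := by
  have h1 := hf (y + μ • a) (y + μ • b)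
  have h2 := hf (y - μ • a) (y - μ • b)
  have e1 : y + μ • a - (y + μ • b) = μ • (a - b) := by rw [smul_sub]; abel
  have e2 : y - μ • a - (y - μ • b) = -(μ • (a - b)) := by rw [smul_sub]; abel
  rw [e1, norm_smul, Real.norm_of_nonneg hμ] at h1
  rw [e2, norm_neg, norm_smul, Real.norm_of_nonneg hμ] at h2
  rw [abs_le] at h1 h2 ⊢
  simp only [symmDiffHalf]
  constructor <;> linarith [h1.1, h1.2, h2.1, h2.2]

theorem symmDiffHalf_neg (μ : ℝ) (f : Vec d → ℝ) (y x : Vec d) :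
    symmDiffHalf μ f y (-x) = -symmDiffHalf μ f y x := by
  simp only [symmDiffHalf, smul_neg, sub_neg_eq_add, ← sub_eq_add_neg]
  ring

theorem lipschitzWith_symmDiffHalf {f : Vec d → ℝ} {G : ℝ} (hG : 0 ≤ G)
    (hf : ∀ x y, |f x - f y| ≤ G * ‖x - y‖) {μ : ℝ} (hμ : 0 ≤ μ) (y : Vec d) :
    LipschitzWith (G * μ).toNNReal (symmDiffHalf μ f y) :=
  LipschitzWith.of_dist_le_mul fun a b => by
    rw [Real.dist_eq, dist_eq_norm, Real.coe_toNNReal _ (by positivity)]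
    exact abs_symmDiffHalf_sub_le hf hμ y a b

/-- Convexity bounds the increment of the symmetric difference in the direction `(v - y) / μ`: the
first term is a forward difference and the second one a backward difference. -/
theorem symmDiffHalf_add_smul_sub_le {f : Vec d → ℝ} {G : ℝ} (hG : 0 ≤ G)
    (hf : ∀ x y, |f x - f y| ≤ G * ‖x - y‖) (hcv : ConvexOn ℝ (unitBall d) f)
    {μ : ℝ} (hμ : 0 < μ) {y v : Vec d} (hv : ‖v‖ + μ ≤ 1) {x : Vec d}
    (hx : ‖x‖ ≤ 1) {t : ℝ} (ht0 : 0 < t) (ht1 : t ≤ 1) (ht : ‖y‖ + μ + t * ‖v - y‖ ≤ 1) :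
    symmDiffHalf μ f y (x + t • μ⁻¹ • (v - y)) - symmDiffHalf μ f y x ≤
      t * (f v - f y + 2 * G * μ) := by
  have hμx : ‖μ • x‖ ≤ μ := by
    rw [norm_smul, Real.norm_of_nonneg hμ.le]; exact mul_le_of_le_one_right hμ.le hx
  have htd : ‖t • (v - y)‖ = t * ‖v - y‖ := by rw [norm_smul, Real.norm_of_nonneg ht0.le]
  have htd0 : 0 ≤ t * ‖v - y‖ := by positivity
  have m1 : y + μ • x ∈ unitBall d := by
    have := norm_add_le y (μ • x)
    simp only [unitBall, mem_ofPred_eq]; linarith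
  have m2 : v + μ • x ∈ unitBall d := by
    have := norm_add_le v (μ • x)
    simp only [unitBall, mem_ofPred_eq]; linarith
  have m3 : v - μ • x ∈ unitBall d := by
    have := norm_sub_le v (μ • x)
    simp only [unitBall, mem_ofPred_eq]; linarith
  have m4 : y - μ • x - t • (v - y) ∈ unitBall d := by
    have := norm_sub_le y (μ • x)
    have := norm_sub_le (y - μ • x) (t • (v - y))
    simp only [unitBall, mem_ofPred_eq]; linarith
  have c1 := hcv.2 m1 m2 (sub_nonneg.2 ht1) ht0.le (by ring)
  have e1 : (1 - t) • (y + μ • x) + t • (v + μ • x) = y + μ • x + t • (v - y) := by module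
  rw [e1] at c1
  have c2 := hcv.2 m4 m3 (show 0 ≤ 1 / (1 + t) by positivity)
    (show 0 ≤ t / (1 + t) by positivity) (by field_simp)
  have e2 : (1 / (1 + t)) • (y - μ • x - t • (v - y)) + (t / (1 + t)) • (v - μ • x) =
      y - μ • x := by
    have : y - μ • x = (1 / (1 + t)) • ((1 + t) • (y - μ • x)) := by
      rw [smul_smul, one_div_mul_cancel (by positivity), one_smul]
    conv_rhs => rw [this]
    rw [div_eq_mul_one_div t, mul_comm t, mul_smul, ← smul_add]
    congr 1
    module
  rw [e2] at c2
  simp only [smul_eq_mul] at c1 c2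
  have c2' : (1 + t) * f (y - μ • x) ≤ f (y - μ • x - t • (v - y)) + t * f (v - μ • x) := by
    calc _ ≤ (1 + t) * (1 / (1 + t) * f (y - μ • x - t • (v - y)) +
          t / (1 + t) * f (v - μ • x)) := by gcongr
      _ = _ := by field_simp
  have e3 : μ • (x + t • μ⁻¹ • (v - y)) = μ • x + t • (v - y) := by
    rw [smul_add, smul_comm t, smul_smul, mul_inv_cancel₀ hμ.ne', one_smul]
  have b1 : f (v + μ • x) ≤ f v + G * μ := by
    have := (abs_le.1 (hf (v + μ • x) v)).2
    rw [add_sub_cancel_left] at this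
    nlinarith
  have b2 : f (v - μ • x) ≤ f v + G * μ := by
    have := (abs_le.1 (hf (v - μ • x) v)).2
    rw [sub_sub_cancel_left, norm_neg] at this
    nlinarith
  have b3 : f y - G * μ ≤ f (y + μ • x) := by
    have := (abs_le.1 (hf (y + μ • x) y)).1
    rw [add_sub_cancel_left] at this
    nlinarith
  have b4 : f y - G * μ ≤ f (y - μ • x) := by
    have := (abs_le.1 (hf (y - μ • x) y)).1
    rw [sub_sub_cancel_left, norm_neg] at this
    nlinarith
  simp only [symmDiffHalf]
  rw [e3, ← add_assoc, ← sub_sub]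
  have k1 : t * (f (v + μ • x) - f (y + μ • x)) ≤ t * (f v - f y + 2 * G * μ) := by
    gcongr; linarith
  have k2 : t * (f (v - μ • x) - f (y - μ • x)) ≤ t * (f v - f y + 2 * G * μ) := by
    gcongr; linarith
  linarith

theorem measurable_gradEst {f : Vec d → ℝ} (hf : Continuous f) (μ : ℝ) :
    Measurable fun p : Vec d × Vec d => gradEst μ f p.1 p.2 := by
  have hs : Measurable fun p : Vec d × Vec d => signVec p.2 :=
    measurable_signVec.comp measurable_snd
  have hc : Measurable fun p : Vec d × Vec d =>
      (d : ℝ) / (2 * μ) * (f (p.1 + μ • p.2) - f (p.1 - μ • p.2)) :=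
    Continuous.measurable (by fun_prop)
  exact hc.smul hs

theorem measurable_gradEst_comp {Ω : Type*} [MeasurableSpace Ω] {f : Vec d → ℝ} (hf : Continuous f)
    (μ : ℝ) {y s : Ω → Vec d} (hy : Measurable y) (hs : Measurable s) :
    Measurable fun ω => gradEst μ f (y ω) (s ω) := by
  have h := (measurable_gradEst hf μ).comp (hy.prodMk hs)
  exact h

theorem norm_gradEst_le {f : Vec d → ℝ} {G : ℝ} (hf : ∀ x y, |f x - f y| ≤ G * ‖x - y‖)
    {μ : ℝ} (hμ : 0 < μ) (y : Vec d) {s : Vec d} (hG : 0 ≤ G) (hs : ‖s‖ ≤ 1) :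
    ‖gradEst μ f y s‖ ≤ d * G * √d := by
  have h0 : symmDiffHalf μ f y 0 = 0 := by simp [symmDiffHalf]
  have h := abs_symmDiffHalf_sub_le hf hμ.le y s 0
  rw [h0, sub_zero, sub_zero] at h
  rw [gradEst_eq, norm_smul, norm_signVec, norm_mul, Real.norm_eq_abs (symmDiffHalf μ f y s),
    Real.norm_of_nonneg (by positivity)]
  refine mul_le_mul_of_nonneg_right ?_ (Real.sqrt_nonneg _)
  calc d / μ * |symmDiffHalf μ f y s| ≤ d / μ * (G * μ * ‖s‖) := by gcongr
    _ ≤ d / μ * (G * μ * 1) := by gcongr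
    _ = d * G := by field_simp

theorem ae_norm_le_one_unifL1Sphere (hd : 0 < d) : ∀ᵐ s ∂unifL1Sphere d, ‖s‖ ≤ 1 := by
  filter_upwards [ae_unifL1Sphere hd] with s hs using hs ▸ norm_le_l1Norm s

/-- In the mean, the gradient estimator is a subgradient of the loss, up to the error `2 G μ` of
smoothing at scale `μ`. -/
theorem integral_inner_gradEst_ge (hd : 0 < d) {f : Vec d → ℝ} {G : ℝ} (hG : 0 ≤ G)
    (hf : ∀ x y, |f x - f y| ≤ G * ‖x - y‖) (hcv : ConvexOn ℝ (unitBall d) f)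
    {μ : ℝ} (hμ : 0 < μ) {y v : Vec d} (hy : ‖y‖ + μ < 1) (hv : ‖v‖ + μ ≤ 1) :
    f y - f v - 2 * G * μ ≤ ∫ s, inner ℝ (gradEst μ f y s) (y - v) ∂unifL1Sphere d := by
  set A := symmDiffHalf μ f y with hA
  have hAL := lipschitzWith_symmDiffHalf hG hf hμ.le y
  set δ : Vec d := μ⁻¹ • (v - y) with hδ
  set M : ℝ := f v - f y + 2 * G * μ with hM
  have hfc : Continuous f := by
    refine LipschitzWith.continuous (K := G.toNNReal) (LipschitzWith.of_dist_le_mul fun a b => ?_)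
    rw [Real.dist_eq, dist_eq_norm, Real.coe_toNNReal _ hG]
    exact hf a b
  have hder : ∀ᵐ x : Vec d, x ∈ l1Ball d 1 → lineDeriv ℝ A x δ ≤ M := by
    filter_upwards [hAL.ae_lineDifferentiableAt δ] with x hx hx1
    have hxn : ‖x‖ ≤ 1 := (norm_le_l1Norm x).trans (le_of_lt hx1)
    have ht := HasDerivAt.tendsto_slope_zero_right hx.hasLineDerivAt
    refine le_of_tendsto ht ?_
    have hsmall : ∀ᶠ t : ℝ in 𝓝[>] 0, ‖y‖ + μ + t * ‖v - y‖ < 1 := by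
      have hc : Continuous fun t : ℝ => ‖y‖ + μ + t * ‖v - y‖ := by fun_prop
      exact (hc.continuousAt.eventually_lt continuousAt_const (by simpa using hy)).filter_mono
        nhdsWithin_le_nhds
    filter_upwards [hsmall, Ioo_mem_nhdsGT (show (0 : ℝ) < 1 by norm_num)] with t h1 h2
    have := symmDiffHalf_add_smul_sub_le hG hf hcv hμ hv hxn h2.1 h2.2.le h1.le
    simp only [zero_add, zero_smul, add_zero, smul_eq_mul]
    rw [inv_mul_le_iff₀ h2.1]
    exact this
  have hflux := flux_le_of_lineDeriv_le hAL δ hder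
  have hVpos := volumeReal_l1Ball_pos (d := d)
  have hgm : Measurable fun s : Vec d => inner ℝ (gradEst μ f y s) (y - v) := by
    have := (measurable_gradEst hfc μ).comp (measurable_const (a := y).prodMk measurable_id)
    exact Measurable.inner this measurable_const
  rw [integral_unifL1Sphere hgm]
  have e : ∫ x in l1Ball d 1, inner ℝ (gradEst μ f y ((l1Norm x)⁻¹ • x)) (y - v) =
      -(d * ∫ x in l1Ball d 1, inner ℝ (signVec x) δ * A ((l1Norm x)⁻¹ • x)) := by
    rw [← integral_const_mul, ← integral_neg]
    refine integral_congr_ae (ae_restrict_of_ae ?_)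
    filter_upwards [ae_volume_ne_zero hd] with x hx
    rw [gradEst_eq, signVec_smul (inv_pos.2 (l1Norm_pos hx)), real_inner_smul_left, hδ,
      real_inner_smul_right, ← neg_sub v y, inner_neg_right]
    ring
  rw [e, inv_mul_eq_div, le_div_iff₀ hVpos]
  have : f y - f v - 2 * G * μ = -M := by rw [hM]; ring
  rw [this]
  linarith

/-- The second moment of the gradient estimator is of order `d G ^ 2`. -/
theorem integral_norm_gradEst_sq_le (hd : 0 < d) {f : Vec d → ℝ} {G : ℝ} (hG : 0 ≤ G)
    (hf : ∀ x y, |f x - f y| ≤ G * ‖x - y‖) {μ : ℝ} (hμ : 0 < μ) (y : Vec d) :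
    ∫ s, ‖gradEst μ f y s‖ ^ 2 ∂unifL1Sphere d ≤ 500 * d * G ^ 2 := by
  have h := integral_sq_unifL1Sphere_le hd (h := symmDiffHalf μ f y) (L := G * μ)
    (abs_symmDiffHalf_sub_le hf hμ.le y) (by positivity) (symmDiffHalf_neg μ f y)
  have e : ∀ s : Vec d, ‖gradEst μ f y s‖ ^ 2 =
      d / μ ^ 2 * (d ^ 2 * symmDiffHalf μ f y s ^ 2) := by
    intro s
    rw [gradEst_eq, norm_smul, mul_pow, norm_signVec_sq, norm_mul, mul_pow, Real.norm_eq_abs,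
      Real.norm_eq_abs, sq_abs, sq_abs]
    ring
  simp_rw [e]
  rw [integral_const_mul, integral_const_mul]
  calc _ ≤ d / μ ^ 2 * (500 * (G * μ) ^ 2) := by gcongr
    _ = _ := by field_simp

/-! ### The mirror step as a projected gradient step -/

/-- The nearest-point projection onto the closed ball of radius `R` about the origin. -/
noncomputable def projBall (R : ℝ) (p : Vec d) : Vec d := (R / max R ‖p‖) • p

theorem continuous_projBall {R : ℝ} (hR : 0 < R) : Continuous (projBall (d := d) R) := by
  unfold projBall
  have : ∀ p : Vec d, max R ‖p‖ ≠ 0 := fun p => (lt_max_of_lt_left hR).ne'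
  fun_prop (disch := assumption)

theorem norm_projBall_le {R : ℝ} (hR : 0 < R) (p : Vec d) : ‖projBall R p‖ ≤ R := by
  have h : 0 < max R ‖p‖ := lt_max_of_lt_left hR
  rw [projBall, norm_smul, Real.norm_of_nonneg (by positivity), div_mul_eq_mul_div, div_le_iff₀ h]
  gcongr
  exact le_max_right _ _

/-- The obtuse angle property of the projection, which makes it the unique nearest point. -/
theorem norm_sq_projBall_add_le {R : ℝ} (hR : 0 < R) (p : Vec d) {w : Vec d} (hw : ‖w‖ ≤ R) :
    ‖w - projBall R p‖ ^ 2 + ‖projBall R p - p‖ ^ 2 ≤ ‖w - p‖ ^ 2 := by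
  rcases le_or_gt ‖p‖ R with h | h
  · have : projBall R p = p := by
      rw [projBall, max_eq_left h, div_self hR.ne', one_smul]
    simp [this]
  · have hp : 0 < ‖p‖ := hR.trans h
    obtain ⟨c, hc⟩ : ∃ c, c = R / ‖p‖ := ⟨_, rfl⟩
    have hcR : c * ‖p‖ = R := by rw [hc]; field_simp
    have hc1 : c ≤ 1 := by rw [hc, div_le_one hp]; exact h.le
    have e : projBall R p = c • p := by rw [projBall, max_eq_right h.le, hc]
    have hin : inner ℝ w p ≤ R * ‖p‖ := (real_inner_le_norm w p).trans (by gcongr)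
    rw [e, norm_sub_sq_real, norm_sub_sq_real (c • p), norm_sub_sq_real w p, real_inner_smul_right,
      real_inner_smul_left, real_inner_self_eq_norm_sq, norm_smul, mul_pow, Real.norm_eq_abs, sq_abs]
    have h2 : c ^ 2 * ‖p‖ ^ 2 = R * (c * ‖p‖) := by rw [← hcR]; ring
    nlinarith [mul_nonneg (sub_nonneg.2 hc1) (sub_nonneg.2 hin)]

theorem mem_shrunk_unitBall {α : ℝ} (hα : α < 1) (x : Vec d) :
    x ∈ shrunk α (unitBall d) ↔ ‖x‖ ≤ 1 - α := by
  have h : 0 < 1 - α := by linarith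
  constructor
  · rintro ⟨z, hz, rfl⟩
    rw [norm_smul, Real.norm_of_nonneg h.le]
    exact mul_le_of_le_one_right h.le hz
  · intro hx
    refine ⟨(1 - α)⁻¹ • x, ?_, ?_⟩
    · simp only [unitBall, mem_ofPred_eq]
      rw [norm_smul, norm_inv, Real.norm_of_nonneg h.le, inv_mul_le_iff₀ h, mul_one]
      exact hx
    · simp only
      rw [smul_smul, mul_inv_cancel₀ h.ne', one_smul]

theorem gradient_halfSq (y : Vec d) : gradient (halfSq d) y = y := by
  refine HasGradientAt.gradient ?_
  rw [hasGradientAt_iff_hasFDerivAt]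
  have h := (hasStrictFDerivAt_norm_sq y).hasFDerivAt.mul_const ((2 : ℝ)⁻¹)
  have e : halfSq d = fun x => ‖x‖ ^ 2 * (2 : ℝ)⁻¹ := by
    ext x; rw [halfSq, div_eq_mul_inv]
  rw [e]
  refine h.congr_fderiv ?_
  ext v
  simp

theorem bregman_halfSq (x y : Vec d) : bregman (halfSq d) x y = ‖x - y‖ ^ 2 / 2 := by
  rw [bregman, gradient_halfSq, halfSq, halfSq, norm_sub_sq_real, inner_sub_right,
    real_inner_self_eq_norm_sq, real_inner_comm]
  ring

/-- For `ψ = ‖·‖² / 2` the objective of the mirror step is, up to a constant, a multiple of the squared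
distance to `y - η g`. -/
theorem mirrorStep_halfSq {α η : ℝ} (hα : α < 1) (hη : 0 < η) (g y : Vec d) :
    mirrorStep (halfSq d) (shrunk α (unitBall d)) η g y = projBall (1 - α) (y - η • g) := by
  have hR : 0 < 1 - α := by linarith
  set p := y - η • g with hp
  have hval : ∀ w : Vec d, inner ℝ g w + 1 / η * bregman (halfSq d) w y =
      1 / (2 * η) * ‖w - p‖ ^ 2 + (inner ℝ g y - η / 2 * ‖g‖ ^ 2) := by
    intro w
    have e : w - p = (w - y) + η • g := by rw [hp]; abel
    have c1 : inner ℝ g w = inner ℝ w g := real_inner_comm _ _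
    have c2 : inner ℝ g y = inner ℝ y g := real_inner_comm _ _
    rw [bregman_halfSq, e, norm_add_sq_real, real_inner_smul_right, norm_smul, mul_pow,
      Real.norm_eq_abs, sq_abs, inner_sub_left, c1, c2]
    field_simp
    ring
  have hmin : ∃ z, z ∈ shrunk α (unitBall d) ∧
      IsMinOn (fun w => inner ℝ g w + 1 / η * bregman (halfSq d) w y)
        (shrunk α (unitBall d)) z := by
    refine ⟨projBall (1 - α) p, (mem_shrunk_unitBall hα _).2 (norm_projBall_le hR p),
      fun w hw => ?_⟩
    have := norm_sq_projBall_add_le hR p ((mem_shrunk_unitBall hα w).1 hw)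
    simp only [mem_ofPred_eq, hval]
    gcongr 1 / (2 * η) * ?_ + _
    nlinarith [sq_nonneg ‖w - projBall (1 - α) p‖]
  have hspec := Classical.epsilon_spec hmin
  change mirrorStep (halfSq d) (shrunk α (unitBall d)) η g y ∈ _ ∧
    IsMinOn _ _ (mirrorStep (halfSq d) (shrunk α (unitBall d)) η g y) at hspec
  set z := mirrorStep (halfSq d) (shrunk α (unitBall d)) η g y
  have h1 := hspec.2 ((mem_shrunk_unitBall hα _).2 (norm_projBall_le hR p))
  simp only [mem_ofPred_eq, hval] at h1
  have h2 : ‖z - p‖ ^ 2 ≤ ‖projBall (1 - α) p - p‖ ^ 2 := by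
    have : 0 < 1 / (2 * η) := by positivity
    nlinarith
  have h3 := norm_sq_projBall_add_le hR p ((mem_shrunk_unitBall hα z).1 hspec.1)
  have h4 : ‖z - projBall (1 - α) p‖ ^ 2 = 0 := by
    nlinarith [sq_nonneg ‖z - projBall (1 - α) p‖]
  exact sub_eq_zero.1 (norm_eq_zero.1 (pow_eq_zero_iff two_ne_zero |>.1 h4))

/-! ### Pathwise regret of the base learners and of the meta learner -/

/-- Dynamic regret of projected gradient descent in the unit ball. -/
theorem sum_inner_le_of_step {η : ℝ} (hη : 0 < η) {y g v : ℕ → Vec d} {T : ℕ}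
    (hstep : ∀ t < T, ‖y (t + 1) - v t‖ ^ 2 ≤
      ‖y t - v t‖ ^ 2 - 2 * η * inner ℝ (g t) (y t - v t) + η ^ 2 * ‖g t‖ ^ 2)
    (hy : ∀ t ≤ T, ‖y t‖ ≤ 1) (hv : ∀ t ≤ T, ‖v t‖ ≤ 1) :
    ∑ t ∈ Finset.range T, inner ℝ (g t) (y t - v t) ≤
      (2 + 2 * pathVar T v) / η + η / 2 * ∑ t ∈ Finset.range T, ‖g t‖ ^ 2 := by
  have hdist : ∀ a b : Vec d, ‖a‖ ≤ 1 → ‖b‖ ≤ 1 → ‖a - b‖ ≤ 2 := fun a b ha hb =>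
    (norm_sub_le a b).trans (by linarith)
  have key : ∀ n ≤ T, 2 * η * ∑ t ∈ Finset.range n, inner ℝ (g t) (y t - v t) +
      ‖y n - v n‖ ^ 2 ≤ 4 + 4 * pathVar n v + η ^ 2 * ∑ t ∈ Finset.range n, ‖g t‖ ^ 2 := by
    intro n
    induction n with
    | zero =>
      intro _
      have := hdist _ _ (hy 0 (Nat.zero_le _)) (hv 0 (Nat.zero_le _))
      simp only [Finset.range_zero, Finset.sum_empty, pathVar]
      nlinarith [norm_nonneg (y 0 - v 0)]
    | succ n ih =>
      intro hn
      have h1 := ih (by omega)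
      have h2 := hstep n (by omega)
      have a1 := hdist _ _ (hy (n + 1) hn) (hv n (by omega))
      have a2 := hdist _ _ (hy (n + 1) hn) (hv (n + 1) hn)
      have a3 : ‖y (n + 1) - v (n + 1)‖ ≤ ‖y (n + 1) - v n‖ + ‖v (n + 1) - v n‖ := by
        have := norm_sub_le (y (n + 1) - v n) (v (n + 1) - v n)
        rwa [sub_sub_sub_cancel_right] at this
      have a4 : ‖y (n + 1) - v (n + 1)‖ ^ 2 ≤
          ‖y (n + 1) - v n‖ ^ 2 + 4 * ‖v (n + 1) - v n‖ := by
        nlinarith [norm_nonneg (y (n + 1) - v n), norm_nonneg (y (n + 1) - v (n + 1)),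
          norm_nonneg (v (n + 1) - v n)]
      simp only [pathVar] at h1 ⊢
      rw [Finset.sum_range_succ, Finset.sum_range_succ, Finset.sum_range_succ]
      linarith
  have h := key T le_rfl
  have h0 : 2 * η * ∑ t ∈ Finset.range T, inner ℝ (g t) (y t - v t) ≤
      2 * η * ((2 + 2 * pathVar T v) / η + η / 2 * ∑ t ∈ Finset.range T, ‖g t‖ ^ 2) := by
    have e : 2 * η * ((2 + 2 * pathVar T v) / η + η / 2 * ∑ t ∈ Finset.range T, ‖g t‖ ^ 2) =
        4 + 4 * pathVar T v + η ^ 2 * ∑ t ∈ Finset.range T, ‖g t‖ ^ 2 := by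
      field_simp
      ring
    rw [e]
    linarith [sq_nonneg ‖y T - v T‖]
  exact le_of_mul_le_mul_left h0 (by positivity)

/-- Hoeffding's lemma for a finite distribution. -/
theorem sum_mul_exp_le {ω φ : Fin N → ℝ} (hω : ∀ k, 0 ≤ ω k) (hsum : ∑ k, ω k = 1)
    (hmean : ∑ k, ω k * φ k = 0) {b : ℝ} (hb : ∀ k, |φ k| ≤ b) (hb0 : 0 ≤ b) (γ : ℝ) :
    ∑ k, ω k * Real.exp (-γ * φ k) ≤ Real.exp ((γ * b) ^ 2 / 2) := by
  refine le_trans ?_ (Real.cosh_le_exp_half_sq (γ * b))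
  have hk : ∀ k, Real.exp (-γ * φ k) ≤
      Real.cosh (γ * b) + -(φ k / b) * Real.sinh (γ * b) := by
    intro k
    rcases hb0.eq_or_lt with h | h
    · have h1 : φ k = 0 := abs_eq_zero.1 (le_antisymm (h ▸ hb k) (abs_nonneg _))
      simp [h1, ← h]
    · have hle : |-(φ k / b)| ≤ 1 := by
        rw [abs_neg, abs_div, abs_of_pos h, div_le_one h]; exact hb k
      have := Real.exp_mul_le_cosh_add_mul_sinh hle (γ * b)
      convert this using 2
      field_simp
  calc ∑ k, ω k * Real.exp (-γ * φ k)
      ≤ ∑ k, ω k * (Real.cosh (γ * b) + -(φ k / b) * Real.sinh (γ * b)) :=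
        Finset.sum_le_sum fun k _ => mul_le_mul_of_nonneg_left (hk k) (hω k)
    _ = (∑ k, ω k) * Real.cosh (γ * b) - (∑ k, ω k * φ k) * (Real.sinh (γ * b) / b) := by
        rw [Finset.sum_mul, Finset.sum_mul, ← Finset.sum_sub_distrib]
        exact Finset.sum_congr rfl fun k _ => by ring
    _ = _ := by rw [hsum, hmean]; ring

/-- Regret of the exponentially weighted average with respect to one of the base learners. -/
theorem neg_sum_le_of_expWeights {ω φ : ℕ → Fin N → ℝ} {b : ℕ → ℝ} {γ : ℝ} (hγ : 0 < γ) {T : ℕ}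
    (hpos : ∀ t k, 0 < ω t k) (hsum : ∀ t, ∑ k, ω t k = 1)
    (hmean : ∀ t, ∑ k, ω t k * φ t k = 0) (hb0 : ∀ t, 0 ≤ b t) (hb : ∀ t k, |φ t k| ≤ b t)
    (hstep : ∀ t k, ω (t + 1) k =
      ω t k * Real.exp (-γ * φ t k) / ∑ j, ω t j * Real.exp (-γ * φ t j)) (k : Fin N) :
    -∑ t ∈ Finset.range T, φ t k ≤
      Real.log (1 / ω 0 k) / γ + γ / 2 * ∑ t ∈ Finset.range T, b t ^ 2 := by
  have key : ∀ n, Real.log (ω 0 k) - γ * ∑ t ∈ Finset.range n, φ t k -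
      γ ^ 2 / 2 * ∑ t ∈ Finset.range n, b t ^ 2 ≤ Real.log (ω n k) := by
    intro n
    induction n with
    | zero => simp
    | succ n ih =>
      have hZ := sum_mul_exp_le (fun k => (hpos n k).le) (hsum n) (hmean n) (hb n) (hb0 n) γ
      have hZ0 : 0 < ∑ j, ω n j * Real.exp (-γ * φ n j) :=
        Finset.sum_pos (fun j _ => mul_pos (hpos n j) (Real.exp_pos _)) ⟨k, Finset.mem_univ k⟩
      have hlog : Real.log (∑ j, ω n j * Real.exp (-γ * φ n j)) ≤ (γ * b n) ^ 2 / 2 := by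
        rw [Real.log_le_iff_le_exp hZ0]; exact hZ
      rw [hstep, Real.log_div (mul_pos (hpos n k) (Real.exp_pos _)).ne' hZ0.ne',
        Real.log_mul (hpos n k).ne' (Real.exp_pos _).ne', Real.log_exp, Finset.sum_range_succ,
        Finset.sum_range_succ]
      nlinarith
  have h1 : ω T k ≤ 1 := by
    rw [← hsum T]
    exact Finset.single_le_sum (fun j _ => (hpos T j).le) (Finset.mem_univ k)
  have h2 : Real.log (ω T k) ≤ 0 := Real.log_nonpos (hpos T k).le h1
  have h3 := (key T).trans h2
  rw [one_div, Real.log_inv]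
  have h4 : γ * (-∑ t ∈ Finset.range T, φ t k) ≤
      γ * (-Real.log (ω 0 k) / γ + γ / 2 * ∑ t ∈ Finset.range T, b t ^ 2) := by
    have : γ * (-Real.log (ω 0 k) / γ + γ / 2 * ∑ t ∈ Finset.range T, b t ^ 2) =
        -Real.log (ω 0 k) + γ ^ 2 / 2 * ∑ t ∈ Finset.range T, b t ^ 2 := by
      field_simp
    rw [this]
    linarith
  exact le_of_mul_le_mul_left h4 hγ

/-! ### Pathwise regret of the algorithm -/

/-- The part of the Euclidean setting that the pathwise analysis uses: the unit ball with the
squared norm, positive parameters, and initial points in the shrunk ball. -/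
structure IsBallInput (I : Input d N) : Prop where
  X_eq : I.X = unitBall d
  ψ_eq : I.ψ = halfSq d
  α_pos : 0 < I.α
  α_lt : I.α < 1
  γ_pos : 0 < I.γ
  η_pos : ∀ k, 0 < I.η k
  norm_y₁ : ∀ k, ‖I.y₁ k‖ ≤ 1 - I.α
  N_pos : 0 < N

theorem Input.init_wts_pos (I : Input d N) (k : Fin N) : 0 < I.init.wts k := by
  have : 0 < N := k.pos
  simp only [Input.init]
  positivity

theorem Input.sum_init_wts (I : Input d N) (hN : 0 < N) : ∑ k, I.init.wts k = 1 := by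
  have h : ∀ n : ℕ, ∑ k ∈ Finset.range n, (1 : ℝ) / (((k : ℝ) + 1) * ((k : ℝ) + 2)) =
      n / (n + 1) := by
    intro n
    induction n with
    | zero => simp
    | succ n ih =>
      rw [Finset.sum_range_succ, ih]
      push_cast
      field_simp
      ring
  simp only [Input.init]
  rw [← Finset.mul_sum, Fin.sum_univ_eq_sum_range
    (fun k : ℕ => (1 : ℝ) / (((k : ℝ) + 1) * ((k : ℝ) + 2))), h]
  field_simp

/-- The gradient estimate of iteration `t`. -/
noncomputable def Input.grad (I : Input d N) (f : ℕ → Vec d → ℝ) (s : ℕ → Vec d) (t : ℕ) : Vec d :=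
  gradEst I.μ (f t) (I.state f s t).decision (s t)

namespace IsBallInput

variable {I : Input d N}

theorem state_succ_pts (hI : IsBallInput I) (f : ℕ → Vec d → ℝ) (s : ℕ → Vec d)
    (t : ℕ) (k : Fin N) : (I.state f s (t + 1)).pts k =
    projBall (1 - I.α) ((I.state f s t).pts k - I.η k • I.grad f s t) := by
  rw [Input.state, Input.step, ← mirrorStep_halfSq hI.α_lt (hI.η_pos k), hI.X_eq, hI.ψ_eq]
  rfl

theorem _root_.BCO.Input.wts_pos (I : Input d N) (f : ℕ → Vec d → ℝ) (s : ℕ → Vec d) (t : ℕ) (k : Fin N) : 0 < (I.state f s t).wts k := by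
  induction t generalizing k with
  | zero => exact I.init_wts_pos k
  | succ t ih =>
    exact div_pos (mul_pos (ih k) (Real.exp_pos _))
      (Finset.sum_pos (fun j _ => mul_pos (ih j) (Real.exp_pos _)) ⟨k, Finset.mem_univ k⟩)

theorem sum_wts (hI : IsBallInput I) (f : ℕ → Vec d → ℝ) (s : ℕ → Vec d)
    (t : ℕ) : ∑ k, (I.state f s t).wts k = 1 := by
  cases t with
  | zero => exact I.sum_init_wts hI.N_pos
  | succ t =>
    simp only [Input.state, Input.step]
    rw [← Finset.sum_div]
    exact div_self (Finset.sum_pos (fun j _ => mul_pos (I.wts_pos f s t j) (Real.exp_pos _))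
      ⟨⟨0, hI.N_pos⟩, Finset.mem_univ _⟩).ne'

theorem norm_pts_le (hI : IsBallInput I) (f : ℕ → Vec d → ℝ) (s : ℕ → Vec d)
    (t : ℕ) (k : Fin N) : ‖(I.state f s t).pts k‖ ≤ 1 - I.α := by
  cases t with
  | zero => exact hI.norm_y₁ k
  | succ t =>
    rw [hI.state_succ_pts]
    exact norm_projBall_le (by linarith [hI.α_lt]) _

theorem norm_decision_le (hI : IsBallInput I) (f : ℕ → Vec d → ℝ) (s : ℕ → Vec d)
    (t : ℕ) : ‖(I.state f s t).decision‖ ≤ 1 - I.α := by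
  rw [State.decision]
  calc ‖∑ k, (I.state f s t).wts k • (I.state f s t).pts k‖
      ≤ ∑ k, (I.state f s t).wts k * (1 - I.α) := by
        refine norm_sum_le_of_le _ fun k _ => ?_
        rw [norm_smul, Real.norm_of_nonneg (I.wts_pos f s t k).le]
        exact mul_le_mul_of_nonneg_left (hI.norm_pts_le f s t k) (I.wts_pos f s t k).le
    _ = 1 - I.α := by rw [← Finset.sum_mul, hI.sum_wts, one_mul]

/-- Pathwise dynamic regret for the linearized losses, for an arbitrary base learner `k`. -/
theorem sum_inner_grad_le (hI : IsBallInput I) (f : ℕ → Vec d → ℝ) (s : ℕ → Vec d)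
    (T : ℕ) {v : ℕ → Vec d} (hv : ∀ t ≤ T, ‖v t‖ ≤ 1 - I.α) (k : Fin N) :
    ∑ t ∈ Finset.range T, inner ℝ (I.grad f s t) ((I.state f s t).decision - v t) ≤
      Real.log (1 / I.init.wts k) / I.γ + (2 + 2 * pathVar T v) / I.η k +
        (2 * I.γ + I.η k / 2) * ∑ t ∈ Finset.range T, ‖I.grad f s t‖ ^ 2 := by
  have hα := hI.α_pos
  have hR : 0 < 1 - I.α := by linarith [hI.α_lt]
  have base := sum_inner_le_of_step (T := T) (hI.η_pos k) (y := fun t => (I.state f s t).pts k)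
    (g := I.grad f s) (v := v) (fun t ht => by
      rw [hI.state_succ_pts]
      set p := (I.state f s t).pts k - I.η k • I.grad f s t with hp
      have h1 := norm_sq_projBall_add_le hR p (hv t ht.le)
      rw [norm_sub_rev (v t), norm_sub_rev (v t)] at h1
      have h2 : ‖p - v t‖ ^ 2 = ‖(I.state f s t).pts k - v t‖ ^ 2 -
          2 * I.η k * inner ℝ (I.grad f s t) ((I.state f s t).pts k - v t) +
          I.η k ^ 2 * ‖I.grad f s t‖ ^ 2 := by
        have e : p - v t = ((I.state f s t).pts k - v t) - I.η k • I.grad f s t := by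
          rw [hp]; abel
        rw [e, norm_sub_sq_real, real_inner_smul_right, norm_smul, mul_pow, Real.norm_eq_abs,
          sq_abs, real_inner_comm]
        ring
      linarith [sq_nonneg ‖projBall (1 - I.α) p - p‖])
    (fun t _ => (hI.norm_pts_le f s t k).trans (by linarith))
    (fun t ht => (hv t ht).trans (by linarith))
  have meta' := neg_sum_le_of_expWeights (ω := fun t => (I.state f s t).wts)
    (φ := fun t k => inner ℝ (I.grad f s t) ((I.state f s t).pts k - (I.state f s t).decision))
    (b := fun t => 2 * ‖I.grad f s t‖) hI.γ_pos (T := T) (I.wts_pos f s) (hI.sum_wts f s)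
    (fun t => by
      have : ∀ j, (I.state f s t).wts j *
          inner ℝ (I.grad f s t) ((I.state f s t).pts j - (I.state f s t).decision) =
          inner ℝ (I.grad f s t) ((I.state f s t).wts j • (I.state f s t).pts j) -
          (I.state f s t).wts j * inner ℝ (I.grad f s t) (I.state f s t).decision := fun j => by
        rw [inner_sub_right, real_inner_smul_right]; ring
      simp_rw [this]
      rw [Finset.sum_sub_distrib, ← inner_sum, ← Finset.sum_mul, hI.sum_wts, one_mul]
      exact sub_self _)
    (fun t => by positivity)
    (fun t j => by
      refine (abs_real_inner_le_norm _ _).trans ?_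
      have h1 := norm_sub_le ((I.state f s t).pts j) (I.state f s t).decision
      have h2 := hI.norm_pts_le f s t j
      have h3 := hI.norm_decision_le f s t
      rw [mul_comm]
      gcongr
      linarith)
    (fun t j => rfl) k
  have split : ∀ t, inner ℝ (I.grad f s t) ((I.state f s t).decision - v t) =
      -inner ℝ (I.grad f s t) ((I.state f s t).pts k - (I.state f s t).decision) +
      inner ℝ (I.grad f s t) ((I.state f s t).pts k - v t) := fun t => by
    rw [← inner_neg_right, ← inner_add_right]
    congr 1
    abel
  simp_rw [split]
  rw [Finset.sum_add_distrib, Finset.sum_neg_distrib]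
  simp only [mul_pow, ← Finset.mul_sum] at meta'
  have e0 : (I.state f s 0).wts k = I.init.wts k := rfl
  rw [e0] at meta'
  linarith

end IsBallInput

/-! ### Measurability and independence of the decisions -/

theorem Input.state_congr (I : Input d N) (f : ℕ → Vec d → ℝ) {s s' : ℕ → Vec d} {t : ℕ}
    (h : ∀ i < t, s i = s' i) : I.state f s t = I.state f s' t := by
  induction t with
  | zero => rfl
  | succ t ih =>
    rw [Input.state, Input.state, ih fun i hi => h i (by omega), h t (by omega)]

/-- The state depends on the losses through their values at the played points only. -/
theorem Input.state_congr_loss (I : Input d N) {f f' : ℕ → Vec d → ℝ} {s : ℕ → Vec d} {t : ℕ}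
    (h : ∀ i < t, f i ((I.state f' s i).decision + I.μ • s i) =
        f' i ((I.state f' s i).decision + I.μ • s i) ∧
      f i ((I.state f' s i).decision - I.μ • s i) =
        f' i ((I.state f' s i).decision - I.μ • s i)) :
    I.state f s t = I.state f' s t := by
  induction t with
  | zero => rfl
  | succ t ih =>
    have h1 := h t (by omega)
    rw [Input.state, Input.state, ih fun i hi => h i (by omega)]
    simp only [Input.step, Input.surrogate, gradEst, h1.1, h1.2]

variable {Ω : Type*} [MeasurableSpace Ω]

theorem IsBallInput.measurable_state {I : Input d N} (hI : IsBallInput I) {f : ℕ → Vec d → ℝ}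
    (hf : ∀ t, Continuous (f t)) {s : ℕ → Ω → Vec d} (hs : ∀ t, Measurable (s t)) (t : ℕ) :
    (∀ k, Measurable fun ω => (I.state f (fun i => s i ω) t).pts k) ∧
      ∀ k, Measurable fun ω => (I.state f (fun i => s i ω) t).wts k := by
  induction t with
  | zero => exact ⟨fun k => measurable_const, fun k => measurable_const⟩
  | succ t ih =>
    have hdec : Measurable fun ω => (I.state f (fun i => s i ω) t).decision :=
      Finset.measurable_fun_sum _ fun k _ => (ih.2 k).smul (ih.1 k)
    have hgrad : Measurable fun ω => I.grad f (fun i => s i ω) t :=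
      measurable_gradEst_comp (hf t) I.μ hdec (hs t)
    refine ⟨fun k => ?_, fun k => ?_⟩
    · have hR : 0 < 1 - I.α := by linarith [hI.α_lt]
      have hc : Measurable fun p : Vec d × Vec d => projBall (1 - I.α) (p.1 - I.η k • p.2) :=
        ((continuous_projBall hR).comp
          (continuous_fst.sub (continuous_snd.const_smul (I.η k)))).measurable
      have e : (fun ω => (I.state f (fun i => s i ω) (t + 1)).pts k) = fun ω =>
          projBall (1 - I.α) ((I.state f (fun i => s i ω) t).pts k -
            I.η k • I.grad f (fun i => s i ω) t) :=
        funext fun ω => hI.state_succ_pts f (fun i => s i ω) t k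
      rw [e]
      have h := hc.comp ((ih.1 k).prodMk hgrad)
      exact h
    · have hw : ∀ j, Measurable fun ω => (I.state f (fun i => s i ω) t).wts j *
          Real.exp (-I.γ * I.surrogate (f t) (s t ω) (I.state f (fun i => s i ω) t)
            ((I.state f (fun i => s i ω) t).pts j)) := fun j => by
        have hin : Measurable fun ω => I.surrogate (f t) (s t ω) (I.state f (fun i => s i ω) t)
            ((I.state f (fun i => s i ω) t).pts j) := by
          have h := Measurable.inner (𝕜 := ℝ) hgrad ((ih.1 j).sub hdec)
          exact h
        have h := (ih.2 j).mul (Real.measurable_exp.comp (hin.const_mul (-I.γ)))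
        exact h
      exact (hw k).div (Finset.measurable_fun_sum _ fun j _ => hw j)

theorem IsBallInput.measurable_decision {I : Input d N} (hI : IsBallInput I)
    {f : ℕ → Vec d → ℝ} (hf : ∀ t, Continuous (f t)) {s : ℕ → Ω → Vec d}
    (hs : ∀ t, Measurable (s t)) (t : ℕ) :
    Measurable fun ω => (I.state f (fun i => s i ω) t).decision :=
  Finset.measurable_fun_sum _ fun k _ =>
    ((hI.measurable_state hf hs t).2 k).smul ((hI.measurable_state hf hs t).1 k)

/-- The decision of iteration `t` depends on the earlier directions only. -/
theorem IsBallInput.indepFun_decision {I : Input d N} (hI : IsBallInput I)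
    {f : ℕ → Vec d → ℝ} (hf : ∀ t, Continuous (f t)) {P : Measure Ω} {s : ℕ → Ω → Vec d}
    (hs : ∀ t, Measurable (s t)) (hind : ProbabilityTheory.iIndepFun s P) (t : ℕ) :
    ProbabilityTheory.IndepFun (fun ω => (I.state f (fun i => s i ω) t).decision) (s t) P := by
  have h := hind.indepFun_finset (Finset.range t) {t} (by simp) hs
  -- extends the first `t` directions by zero
  let ext : ((i : Finset.range t) → Vec d) → ℕ → Vec d := fun z i =>
    if hi : i ∈ Finset.range t then z ⟨i, hi⟩ else 0
  have hext : ∀ i, Measurable fun z => ext z i := fun i => by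
    by_cases hi : i ∈ Finset.range t
    · simp only [ext, hi, dite_true]; exact measurable_pi_apply _
    · simp only [ext, hi, dite_false]; exact measurable_const
  have h2 := h.comp (hI.measurable_decision hf (s := fun i z => ext z i) hext t)
    (measurable_pi_apply (⟨t, Finset.mem_singleton_self t⟩ : ({t} : Finset ℕ)))
  have e : (fun ω => (I.state f (fun i => s i ω) t).decision) =
      (fun z => (I.state f (fun i => ext z i) t).decision) ∘
        fun ω (i : Finset.range t) => s i ω := by
    ext1 ω
    simp only [Function.comp_apply]
    rw [I.state_congr f (s' := fun i => ext (fun i => s i ω) i) fun i hi => by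
      simp [ext, hi]]
  rw [e]
  exact h2

/-! ### Expected regret for globally Lipschitz losses -/

theorem continuous_of_abs_sub_le {f : Vec d → ℝ} {G : ℝ} (hG : 0 ≤ G)
    (hf : ∀ x y, |f x - f y| ≤ G * ‖x - y‖) : Continuous f := by
  refine LipschitzWith.continuous (K := G.toNNReal) (LipschitzWith.of_dist_le_mul fun a b => ?_)
  rw [Real.dist_eq, dist_eq_norm, Real.coe_toNNReal _ hG]
  exact hf a b

theorem integrable_comp_of_norm_le_one {P : Measure Ω} [IsProbabilityMeasure P] {f : Vec d → ℝ}
    {G : ℝ} (hG : 0 ≤ G) (hf : ∀ x y, |f x - f y| ≤ G * ‖x - y‖) {X : Ω → Vec d}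
    (hX : Measurable X) (hX1 : ∀ᵐ ω ∂P, ‖X ω‖ ≤ 1) : Integrable (fun ω => f (X ω)) P := by
  have hm : Measurable fun ω => f (X ω) := (continuous_of_abs_sub_le hG hf).measurable.comp hX
  refine (integrable_const (|f 0| + G)).mono' hm.aestronglyMeasurable ?_
  filter_upwards [hX1] with ω hω
  have h1 := hf (X ω) 0
  rw [sub_zero] at h1
  have h2 : |f (X ω)| ≤ |f (X ω) - f 0| + |f 0| := by
    simpa using abs_add_le (f (X ω) - f 0) (f 0)
  rw [Real.norm_eq_abs]
  nlinarith

section Estimator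

variable {P : Measure Ω} {Y S : Ω → Vec d} {f : Vec d → ℝ} {G μ : ℝ}

theorem ae_norm_le_one_of_map_eq (hd : 0 < d) (hS : Measurable S)
    (hSu : P.map S = unifL1Sphere d) : ∀ᵐ ω ∂P, ‖S ω‖ ≤ 1 := by
  have := ae_norm_le_one_unifL1Sphere hd
  rw [← hSu] at this
  exact ae_of_ae_map hS.aemeasurable this

variable [IsProbabilityMeasure P]

/-- The joint law of a random point and an independent direction; it reduces the following bounds to
those for a fixed point. -/
theorem map_prodMk_eq (hY : Measurable Y) (hS : Measurable S) (hSu : P.map S = unifL1Sphere d)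
    (hind : ProbabilityTheory.IndepFun Y S P) :
    P.map (fun ω => (Y ω, S ω)) = (P.map Y).prod (unifL1Sphere d) := by
  rw [← hSu]
  exact (ProbabilityTheory.indepFun_iff_map_prod_eq_prod_map_map hY.aemeasurable
    hS.aemeasurable).1 hind

theorem integrable_norm_gradEst_sq (hd : 0 < d) (hY : Measurable Y) (hS : Measurable S)
    (hSu : P.map S = unifL1Sphere d) (hG : 0 ≤ G) (hf : ∀ x y, |f x - f y| ≤ G * ‖x - y‖)
    (hμ : 0 < μ) : Integrable (fun ω => ‖gradEst μ f (Y ω) (S ω)‖ ^ 2) P := by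
  have hm := measurable_gradEst_comp (continuous_of_abs_sub_le hG hf) μ hY hS
  refine (integrable_const ((d * G * √d) ^ 2)).mono' (hm.norm.pow_const 2).aestronglyMeasurable ?_
  filter_upwards [ae_norm_le_one_of_map_eq hd hS hSu] with ω hω
  rw [norm_pow, norm_norm]
  have := norm_gradEst_le hf hμ (Y ω) hG hω
  gcongr

theorem integrable_inner_gradEst (hd : 0 < d) (hY : Measurable Y) (hS : Measurable S)
    (hSu : P.map S = unifL1Sphere d) (hG : 0 ≤ G) (hf : ∀ x y, |f x - f y| ≤ G * ‖x - y‖)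
    (hμ : 0 < μ) (v : Vec d) (hY1 : ∀ ω, ‖Y ω‖ ≤ 1) :
    Integrable (fun ω => inner ℝ (gradEst μ f (Y ω) (S ω)) (Y ω - v)) P := by
  have hm := measurable_gradEst_comp (continuous_of_abs_sub_le hG hf) μ hY hS
  have hm2 := Measurable.inner (𝕜 := ℝ) hm (hY.sub_const v)
  refine (integrable_const (d * G * √d * (1 + ‖v‖))).mono' hm2.aestronglyMeasurable ?_
  filter_upwards [ae_norm_le_one_of_map_eq hd hS hSu] with ω hω
  refine (norm_inner_le_norm _ _).trans ?_
  have h1 := norm_gradEst_le hf hμ (Y ω) hG hω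
  have h2 := norm_sub_le (Y ω) v
  have h3 := hY1 ω
  gcongr
  linarith

theorem integral_norm_gradEst_sq_comp_le (hd : 0 < d) (hY : Measurable Y) (hS : Measurable S)
    (hSu : P.map S = unifL1Sphere d) (hind : ProbabilityTheory.IndepFun Y S P) (hG : 0 ≤ G)
    (hf : ∀ x y, |f x - f y| ≤ G * ‖x - y‖) (hμ : 0 < μ) :
    ∫ ω, ‖gradEst μ f (Y ω) (S ω)‖ ^ 2 ∂P ≤ 500 * d * G ^ 2 := by
  have hmap := map_prodMk_eq hY hS hSu hind
  have hpm : Measurable fun ω => (Y ω, S ω) := hY.prodMk hS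
  have hgm := (measurable_gradEst (continuous_of_abs_sub_le hG hf) μ).norm.pow_const 2
  have hi := integrable_norm_gradEst_sq hd hY hS hSu hG hf hμ
  have hi2 : Integrable (fun p : Vec d × Vec d => ‖gradEst μ f p.1 p.2‖ ^ 2)
      ((P.map Y).prod (unifL1Sphere d)) := by
    rw [← hmap, integrable_map_measure hgm.aestronglyMeasurable hpm.aemeasurable]
    exact hi
  have e : ∫ ω, ‖gradEst μ f (Y ω) (S ω)‖ ^ 2 ∂P =
      ∫ y, ∫ s, ‖gradEst μ f y s‖ ^ 2 ∂unifL1Sphere d ∂P.map Y := by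
    rw [← integral_prod _ hi2, ← hmap, integral_map hpm.aemeasurable hgm.aestronglyMeasurable]
  have : IsProbabilityMeasure (P.map Y) := Measure.isProbabilityMeasure_map hY.aemeasurable
  rw [e]
  refine (integral_mono hi2.integral_prod_left (integrable_const _) fun y =>
    integral_norm_gradEst_sq_le hd hG hf hμ y).trans (by simp)

theorem integral_inner_gradEst_comp_ge (hd : 0 < d) (hY : Measurable Y) (hS : Measurable S)
    (hSu : P.map S = unifL1Sphere d) (hind : ProbabilityTheory.IndepFun Y S P) (hG : 0 ≤ G)
    (hf : ∀ x y, |f x - f y| ≤ G * ‖x - y‖) (hμ : 0 < μ)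
    (hcv : ConvexOn ℝ (unitBall d) f) {R : ℝ} (hY1 : ∀ ω, ‖Y ω‖ ≤ R) (hR : R + μ < 1)
    {v : Vec d} (hv : ‖v‖ ≤ R) :
    ∫ ω, f (Y ω) ∂P - f v - 2 * G * μ ≤
      ∫ ω, inner ℝ (gradEst μ f (Y ω) (S ω)) (Y ω - v) ∂P := by
  have hmap := map_prodMk_eq hY hS hSu hind
  have hpm : Measurable fun ω => (Y ω, S ω) := hY.prodMk hS
  have hfc := continuous_of_abs_sub_le hG hf
  have hgm : Measurable fun p : Vec d × Vec d => inner ℝ (gradEst μ f p.1 p.2) (p.1 - v) :=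
    Measurable.inner (measurable_gradEst hfc μ) (measurable_fst.sub_const v)
  have hYle : ∀ ω, ‖Y ω‖ ≤ 1 := fun ω => (hY1 ω).trans (by linarith)
  have hi := integrable_inner_gradEst hd hY hS hSu hG hf hμ v hYle
  have hi2 : Integrable (fun p : Vec d × Vec d => inner ℝ (gradEst μ f p.1 p.2) (p.1 - v))
      ((P.map Y).prod (unifL1Sphere d)) := by
    rw [← hmap, integrable_map_measure hgm.aestronglyMeasurable hpm.aemeasurable]
    exact hi
  have e : ∫ ω, inner ℝ (gradEst μ f (Y ω) (S ω)) (Y ω - v) ∂P =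
      ∫ y, ∫ s, inner ℝ (gradEst μ f y s) (y - v) ∂unifL1Sphere d ∂P.map Y := by
    rw [← integral_prod _ hi2, ← hmap, integral_map hpm.aemeasurable hgm.aestronglyMeasurable]
  have : IsProbabilityMeasure (P.map Y) := Measure.isProbabilityMeasure_map hY.aemeasurable
  have hfi : Integrable (fun ω => f (Y ω)) P :=
    integrable_comp_of_norm_le_one hG hf hY (.of_forall hYle)
  have hfi2 : Integrable f (P.map Y) := by
    rw [integrable_map_measure hfc.aestronglyMeasurable hY.aemeasurable]
    exact hfi
  have e2 : ∫ ω, f (Y ω) ∂P - f v - 2 * G * μ = ∫ y, (f y - f v - 2 * G * μ) ∂P.map Y := by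
    have hfi3 : Integrable (fun y => f y - f v) (P.map Y) := hfi2.sub (integrable_const _)
    rw [integral_sub hfi3 (integrable_const _), integral_sub hfi2 (integrable_const _),
      integral_map hY.aemeasurable hfc.aestronglyMeasurable]
    simp
  have hae : ∀ᵐ y ∂P.map Y, ‖y‖ ≤ R := by
    rw [ae_map_iff hY.aemeasurable (measurableSet_le (by fun_prop) measurable_const)]
    exact .of_forall hY1
  rw [e, e2]
  refine integral_mono_ae ((hfi2.sub (integrable_const _)).sub (integrable_const _))
    hi2.integral_prod_left ?_
  filter_upwards [hae] with y hy
  exact integral_inner_gradEst_ge hd hG hf hcv hμ (by linarith) (by linarith)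

end Estimator

theorem pathVar_smul_le {c : ℝ} (hc0 : 0 ≤ c) (hc1 : c ≤ 1) (T : ℕ) (u : ℕ → Vec d) :
    pathVar T (fun t => c • u t) ≤ pathVar T u := by
  refine Finset.sum_le_sum fun t _ => ?_
  rw [← smul_sub, norm_smul, Real.norm_of_nonneg hc0]
  exact mul_le_of_le_one_left (norm_nonneg _) hc1

theorem pathVar_nonneg (T : ℕ) (u : ℕ → Vec d) : 0 ≤ pathVar T u :=
  Finset.sum_nonneg fun _ _ => norm_nonneg _

/-- Expected dynamic regret in terms of the parameters of an arbitrary base learner `k`. -/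
theorem IsBallInput.integral_dynRegret_le {I : Input d N} (hI : IsBallInput I) (hd : 0 < d)
    (hμ : 0 < I.μ) (hμα : I.μ < I.α) {G : ℝ} (hG : 0 ≤ G) {f : ℕ → Vec d → ℝ}
    (hf : ∀ t x y, |f t x - f t y| ≤ G * ‖x - y‖) (hcv : ∀ t, ConvexOn ℝ (unitBall d) (f t))
    {T : ℕ} {u : ℕ → Vec d} (hu : ∀ t ≤ T, ‖u t‖ ≤ 1)
    {P : Measure Ω} [IsProbabilityMeasure P] {s : ℕ → Ω → Vec d} (hs : ∀ t, Measurable (s t))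
    (hsu : ∀ t, P.map (s t) = unifL1Sphere d) (hind : ProbabilityTheory.iIndepFun s P)
    (k : Fin N) :
    Integrable (fun ω => I.dynRegret T f u (fun t => s t ω)) P ∧
    ∫ ω, I.dynRegret T f u (fun t => s t ω) ∂P ≤
      Real.log (1 / I.init.wts k) / I.γ + (2 + 2 * pathVar T u) / I.η k +
        (2 * I.γ + I.η k / 2) * (T * (500 * d * G ^ 2)) + T * (G * (3 * I.μ + I.α)) := by
  have hα0 := hI.α_pos
  have hα1 := hI.α_lt
  have hηk := hI.η_pos k
  have hγ := hI.γ_pos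
  have hfc : ∀ t, Continuous (f t) := fun t => continuous_of_abs_sub_le hG (hf t)
  set Y : ℕ → Ω → Vec d := fun t ω => (I.state f (fun i => s i ω) t).decision with hYdef
  have hY : ∀ t, Measurable (Y t) := hI.measurable_decision hfc hs
  have hY1 : ∀ t ω, ‖Y t ω‖ ≤ 1 - I.α := fun t ω => hI.norm_decision_le f _ t
  have hYind : ∀ t, ProbabilityTheory.IndepFun (Y t) (s t) P :=
    hI.indepFun_decision hfc hs hind
  have hs1 : ∀ t, ∀ᵐ ω ∂P, ‖s t ω‖ ≤ 1 := fun t => ae_norm_le_one_of_map_eq hd (hs t) (hsu t)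
  have hμs : ∀ t ω, ‖s t ω‖ ≤ 1 → ‖I.μ • s t ω‖ ≤ I.μ := fun t ω h => by
    rw [norm_smul, Real.norm_of_nonneg hμ.le]
    exact mul_le_of_le_one_right hμ.le h
  have hpm : ∀ t, Measurable fun ω => Y t ω + I.μ • s t ω := fun t =>
    (hY t).add ((hs t).const_smul I.μ)
  have hmm : ∀ t, Measurable fun ω => Y t ω - I.μ • s t ω := fun t =>
    (hY t).sub ((hs t).const_smul I.μ)
  have hip : ∀ t, Integrable (fun ω => f t (Y t ω + I.μ • s t ω)) P := fun t =>
    integrable_comp_of_norm_le_one hG (hf t) (hpm t) (by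
      filter_upwards [hs1 t] with ω hω
      have := norm_add_le (Y t ω) (I.μ • s t ω)
      linarith [hμs t ω hω, hY1 t ω])
  have him : ∀ t, Integrable (fun ω => f t (Y t ω - I.μ • s t ω)) P := fun t =>
    integrable_comp_of_norm_le_one hG (hf t) (hmm t) (by
      filter_upwards [hs1 t] with ω hω
      have := norm_sub_le (Y t ω) (I.μ • s t ω)
      linarith [hμs t ω hω, hY1 t ω])
  have hiY : ∀ t, Integrable (fun ω => f t (Y t ω)) P := fun t =>
    integrable_comp_of_norm_le_one hG (hf t) (hY t)
      (.of_forall fun ω => (hY1 t ω).trans (by linarith))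
  have hi : ∀ t, Integrable (fun ω => (f t (Y t ω + I.μ • s t ω) + f t (Y t ω - I.μ • s t ω)) / 2 -
      f t (u t)) P := fun t =>
    (((hip t).add (him t)).div_const 2).sub (integrable_const _)
  refine ⟨integrable_finsetSum _ fun t _ => hi t, ?_⟩
  set v : ℕ → Vec d := fun t => (1 - I.α) • u t with hv
  have hv1 : ∀ t ≤ T, ‖v t‖ ≤ 1 - I.α := fun t ht => by
    simp only [hv]
    rw [norm_smul, Real.norm_of_nonneg (by linarith)]
    exact mul_le_of_le_one_right (by linarith) (hu t ht)
  set g : ℕ → Ω → Vec d := fun t ω => gradEst I.μ (f t) (Y t ω) (s t ω) with hg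
  have hginn : ∀ t, Integrable (fun ω => inner ℝ (g t ω) (Y t ω - v t)) P := fun t =>
    integrable_inner_gradEst hd (hY t) (hs t) (hsu t) hG (hf t) hμ (v t)
      fun ω => (hY1 t ω).trans (by linarith)
  have hgsq : ∀ t, Integrable (fun ω => ‖g t ω‖ ^ 2) P := fun t =>
    integrable_norm_gradEst_sq hd (hY t) (hs t) (hsu t) hG (hf t) hμ
  -- replace the losses at the played points by the linearized losses
  have hterm : ∀ t ∈ Finset.range T, ∫ ω, ((f t (Y t ω + I.μ • s t ω) +
      f t (Y t ω - I.μ • s t ω)) / 2 - f t (u t)) ∂P ≤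
      ∫ ω, inner ℝ (g t ω) (Y t ω - v t) ∂P + G * (3 * I.μ + I.α) := by
    intro t ht
    have htT := (Finset.mem_range.1 ht).le
    have h1 : ∫ ω, ((f t (Y t ω + I.μ • s t ω) +
        f t (Y t ω - I.μ • s t ω)) / 2 - f t (u t)) ∂P ≤
        ∫ ω, (f t (Y t ω) + (G * (I.μ + I.α) - f t (v t))) ∂P := by
      refine integral_mono_ae (hi t) ((hiY t).add (integrable_const _)) ?_
      filter_upwards [hs1 t] with ω hω
      have a1 := (abs_le.1 (hf t (Y t ω + I.μ • s t ω) (Y t ω))).2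
      have a2 := (abs_le.1 (hf t (Y t ω - I.μ • s t ω) (Y t ω))).2
      have a3 := (abs_le.1 (hf t (v t) (u t))).2
      rw [add_sub_cancel_left] at a1
      rw [sub_sub_cancel_left, norm_neg] at a2
      have e : v t - u t = -(I.α • u t) := by simp only [hv]; rw [sub_smul, one_smul]; abel
      rw [e, norm_neg, norm_smul, Real.norm_of_nonneg hα0.le] at a3
      have b1 : G * ‖I.μ • s t ω‖ ≤ G * I.μ := by gcongr; exact hμs t ω hω
      have b2 : G * (I.α * ‖u t‖) ≤ G * I.α := by
        gcongr; exact mul_le_of_le_one_right hα0.le (hu t htT)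
      linarith
    have h2 := integral_inner_gradEst_comp_ge hd (hY t) (hs t) (hsu t) (hYind t) hG (hf t) hμ
      (hcv t) (hY1 t) (by linarith) (hv1 t htT)
    rw [integral_add (hiY t) (integrable_const _)] at h1
    simp only [integral_const, probReal_univ, one_smul] at h1
    linarith
  have hpath : ∀ ω, ∑ t ∈ Finset.range T, inner ℝ (g t ω) (Y t ω - v t) ≤
      Real.log (1 / I.init.wts k) / I.γ + (2 + 2 * pathVar T u) / I.η k +
        (2 * I.γ + I.η k / 2) * ∑ t ∈ Finset.range T, ‖g t ω‖ ^ 2 := by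
    intro ω
    refine (hI.sum_inner_grad_le f (fun t => s t ω) T hv1 k).trans ?_
    have := pathVar_smul_le (c := 1 - I.α) (by linarith) (by linarith) T u
    have h2 : (2 + 2 * pathVar T v) / I.η k ≤ (2 + 2 * pathVar T u) / I.η k := by gcongr
    exact add_le_add (add_le_add le_rfl h2) le_rfl
  have hsumi : Integrable (fun ω => ∑ t ∈ Finset.range T, ‖g t ω‖ ^ 2) P :=
    integrable_finsetSum _ fun t _ => hgsq t
  calc ∫ ω, I.dynRegret T f u (fun t => s t ω) ∂P
      = ∑ t ∈ Finset.range T, ∫ ω, ((f t (Y t ω + I.μ • s t ω) +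
          f t (Y t ω - I.μ • s t ω)) / 2 - f t (u t)) ∂P :=
        integral_finsetSum _ fun t _ => hi t
    _ ≤ ∑ t ∈ Finset.range T,
          (∫ ω, inner ℝ (g t ω) (Y t ω - v t) ∂P + G * (3 * I.μ + I.α)) :=
        Finset.sum_le_sum hterm
    _ = ∫ ω, ∑ t ∈ Finset.range T, inner ℝ (g t ω) (Y t ω - v t) ∂P +
          T * (G * (3 * I.μ + I.α)) := by
        rw [Finset.sum_add_distrib, integral_finsetSum _ fun t _ => hginn t]
        simp
    _ ≤ ∫ ω, (Real.log (1 / I.init.wts k) / I.γ + (2 + 2 * pathVar T u) / I.η k +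
          (2 * I.γ + I.η k / 2) * ∑ t ∈ Finset.range T, ‖g t ω‖ ^ 2) ∂P +
          T * (G * (3 * I.μ + I.α)) := by
        gcongr
        · exact integrable_finsetSum _ fun t _ => hginn t
        · exact (integrable_const _).add (hsumi.const_mul _)
        · exact fun ω => hpath ω
    _ = Real.log (1 / I.init.wts k) / I.γ + (2 + 2 * pathVar T u) / I.η k +
          (2 * I.γ + I.η k / 2) * ∑ t ∈ Finset.range T, ∫ ω, ‖g t ω‖ ^ 2 ∂P +
          T * (G * (3 * I.μ + I.α)) := by
        rw [integral_add (integrable_const _) (hsumi.const_mul _), integral_const_mul,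
          integral_finsetSum _ fun t _ => hgsq t]
        simp
    _ ≤ Real.log (1 / I.init.wts k) / I.γ + (2 + 2 * pathVar T u) / I.η k +
          (2 * I.γ + I.η k / 2) * ∑ _t ∈ Finset.range T, 500 * d * G ^ 2 +
          T * (G * (3 * I.μ + I.α)) := by
        gcongr with t _
        exact integral_norm_gradEst_sq_comp_le hd (hY t) (hs t) (hsu t) (hYind t) hG (hf t) hμ
    _ = _ := by simp

/-! ### The Euclidean parameters -/

theorem oscOn_unitBall_halfSq (hd : 0 < d) : oscOn (unitBall d) (halfSq d) = 1 / 2 := by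
  have h1 : IsGreatest (halfSq d '' unitBall d) (1 / 2) := by
    refine ⟨⟨EuclideanSpace.single ⟨0, hd⟩ 1, by simp [unitBall], by simp [halfSq]⟩, ?_⟩
    rintro _ ⟨x, hx, rfl⟩
    have hx' : ‖x‖ ≤ 1 := hx
    have : ‖x‖ ^ 2 ≤ 1 := pow_le_one₀ (norm_nonneg x) hx'
    simp only [halfSq]
    linarith
  have h2 : IsLeast (halfSq d '' unitBall d) 0 := by
    refine ⟨⟨0, by simp [unitBall], by simp [halfSq]⟩, ?_⟩
    rintro _ ⟨x, -, rfl⟩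
    simp only [halfSq]
    positivity
  rw [oscOn, h1.csSup_eq, h2.csInf_eq, sub_zero]

theorem gradBound_unitBall_halfSq (hd : 0 < d) : gradBound (unitBall d) (halfSq d) = 1 := by
  have h1 : IsGreatest ((fun x => ‖gradient (halfSq d) x‖) '' unitBall d) 1 := by
    simp only [gradient_halfSq]
    refine ⟨⟨EuclideanSpace.single ⟨0, hd⟩ 1, by simp [unitBall], by simp⟩, ?_⟩
    rintro _ ⟨x, hx, rfl⟩
    exact hx
  rw [gradBound, h1.csSup_eq]

theorem xiC_two_two (d : ℕ) : xiC 2 2 d = d := by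
  rw [xiC, min_self]
  norm_num

theorem upsilonC_two_two (d : ℕ) : upsilonC 2 2 d = √d := by
  rw [upsilonC, max_self, Real.sqrt_eq_rpow]
  norm_num

theorem zetaC_nonneg (d : ℕ) : 0 ≤ zetaC 2 d := by
  rw [zetaC]
  split_ifs
  · positivity
  · have := Real.log_natCast_nonneg d
    positivity

/-- Up to a factor `κ` between two absolute constants, the smallest step size is
`1 / (G √(d T))`. -/
theorem exists_stepSize_eq {d T : ℕ} (hd : 0 < d) (hT : 0 < T) {G : ℝ} (hG : 0 < G) {B : ℝ}
    (hB0 : 0 ≤ B) (hB2 : B ≤ 2) : ∃ κ : ℝ, 1 / 9 ≤ κ ∧ κ ≤ 1 ∧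
      ∀ j : ℕ, stepSize (1 / 2) B G (d : ℝ) 1 T j = 2 ^ j * (κ / (G * √(d * T))) := by
  have hd' : (0 : ℝ) < d := by exact_mod_cast hd
  have hT' : (0 : ℝ) < T := by exact_mod_cast hT
  have h2 : √(2 : ℝ) ^ 2 = 2 := Real.sq_sqrt (by norm_num)
  have h2lo : 1 ≤ √(2 : ℝ) := by rw [Real.one_le_sqrt]; norm_num
  have h2hi : √(2 : ℝ) ≤ 3 / 2 := by rw [Real.sqrt_le_left (by norm_num)]; norm_num
  refine ⟨√((1 / 2 + B) / (6 * (1 + √2) ^ 2)), ?_, ?_, fun j => ?_⟩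
  · refine Real.le_sqrt_of_sq_le ?_
    rw [le_div_iff₀ (by positivity)]
    nlinarith
  · rw [Real.sqrt_le_one, div_le_one (by positivity)]
    nlinarith
  · rw [stepSize]
    congr 1
    have e : (1 / 2 + B) / (6 * (1 + √2) ^ 2 * G ^ 2 * d * T / 1) =
        (1 / 2 + B) / (6 * (1 + √2) ^ 2) / (G ^ 2 * (d * T)) := by
      field_simp
    rw [e, Real.sqrt_div (by positivity), Real.sqrt_mul (sq_nonneg G), Real.sqrt_sq hG.le]

/-- The grid of step sizes contains one that fits the path variation up to a factor `2`. The path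
variation of `T` steps in the unit ball is at most `2 T`, which the largest step size covers. -/
theorem exists_learner {T : ℕ} {B : ℝ} (hB0 : 0 ≤ B) (hB2 : B ≤ 2) {p : ℝ} (hp0 : 0 ≤ p)
    (hp : p ≤ 2 * T) : ∃ k : ℕ, k < numLearners (1 / 2) B 1 1 T ∧
      (2 : ℝ) ^ k ≤ √(1 + p) ∧ √(1 + p) ≤ 2 * 2 ^ k := by
  have hT : (0 : ℝ) ≤ T := by positivity
  rw [numLearners]
  set X : ℝ := 1 + 2 * 1 * 1 * T / (1 / 2 + B) with hX
  set m : ℕ := ⌈1 / 2 * Real.logb 2 X⌉₊ with hm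
  have hX1 : 1 + p ≤ 4 * X := by
    have : 2 * 1 * 1 * (T : ℝ) / (5 / 2) ≤ 2 * 1 * 1 * T / (1 / 2 + B) := by gcongr; linarith
    rw [hX]
    linarith
  have hXpos : 0 < X := by linarith
  have hXm : X ≤ (2 ^ m) ^ 2 := by
    have h1 : 1 / 2 * Real.logb 2 X ≤ m := Nat.le_ceil _
    have h2 : Real.logb 2 X ≤ ((m * 2 : ℕ) : ℝ) := by push_cast; linarith
    rw [Real.logb_le_iff_le_rpow (by norm_num) hXpos, Real.rpow_natCast] at h2
    rwa [← pow_mul]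
  have hm2 : √(1 + p) ≤ 2 * 2 ^ m := by
    rw [Real.sqrt_le_left (by positivity)]
    calc 1 + p ≤ 4 * X := hX1
      _ ≤ 4 * (2 ^ m) ^ 2 := by gcongr
      _ = _ := by ring
  obtain ⟨j, hj1, hj2⟩ := exists_nat_pow_near (x := √(1 + p)) (y := (2 : ℝ))
    (by rw [Real.one_le_sqrt]; linarith) (by norm_num)
  rcases le_or_gt j m with h | h
  · exact ⟨j, by omega, hj1, by rw [pow_succ'] at hj2; exact hj2.le⟩
  · exact ⟨m, by omega, (pow_le_pow_right₀ (by norm_num) h.le).trans hj1, hm2⟩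

theorem muOrder_le {d T : ℕ} (hd : 0 < d) (hT : 0 < T) {B : ℝ} (hB2 : B ≤ 2) :
    muOrder (1 / 2) B (d : ℝ) 1 (√d) (zetaC 2 d) 1 (1 / 2) T ≤ 1 / √T := by
  have hd' : (0 : ℝ) < d := by exact_mod_cast hd
  have hT' : (0 : ℝ) < T := by exact_mod_cast hT
  have hz := zetaC_nonneg d
  have hsd : 0 < √(d : ℝ) := Real.sqrt_pos.2 hd'
  have hsT : 0 < √(T : ℝ) := Real.sqrt_pos.2 hT'
  have h1 : √((1 / 2 + B) * d) ≤ 2 * √d := by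
    rw [Real.sqrt_le_left (by positivity), mul_pow, Real.sq_sqrt hd'.le]
    nlinarith
  rw [muOrder, one_mul, div_le_div_iff₀ (by positivity) hsT, one_mul]
  calc √((1 / 2 + B) * d) * √T ≤ 2 * √d * √T := by gcongr
    _ ≤ √T * (1 + √d + zetaC 2 d) * 1 / (1 / 2) := by
      have : √(d : ℝ) ≤ 1 + √d + zetaC 2 d := by linarith
      have := mul_le_mul_of_nonneg_left this hsT.le
      linarith

theorem EuclideanSetting.isBallInput {c₁ c₂ c₃ : ℝ} {T : ℕ} {G B : ℝ} {I : Input d N}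
    (h : EuclideanSetting c₁ c₂ c₃ d T G B I) (hc₁ : 0 < c₁) (hd : 0 < d) (hT : 0 < T)
    (hG : 0 < G) (hB0 : 0 ≤ B) (hB2 : B ≤ 2) : IsBallInput I := by
  have hd' : (0 : ℝ) < d := by exact_mod_cast hd
  have hT' : (0 : ℝ) < T := by exact_mod_cast hT
  refine ⟨h.X_eq, h.ψ_eq, h.α_mem.1, h.α_mem.2, ?_, fun k => ?_, fun k => ?_, ?_⟩
  · refine lt_of_lt_of_le ?_ h.le_γ
    rw [gammaOrder, xiC_two_two]
    positivity
  · obtain ⟨κ, hκ, -, hs⟩ := exists_stepSize_eq hd hT hG hB0 hB2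
    rw [h.η_eq, oscOn_unitBall_halfSq hd, xiC_two_two, hs]
    have : 0 < κ := by linarith
    positivity
  · exact (mem_shrunk_unitBall h.α_mem.2 _).1 (h.y₁_mem k)
  · rw [h.N_eq, numLearners]; omega

theorem log_inv_init_wts_le (I : Input d N) (k : Fin N) :
    Real.log (1 / I.init.wts k) ≤ 2 * 2 ^ (k : ℕ) := by
  have hN : (0 : ℝ) < N := by exact_mod_cast k.pos
  have hle : 1 / I.init.wts k ≤ ((k : ℕ) + 2 : ℝ) ^ 2 := by
    simp only [Input.init]
    rw [div_le_iff₀ (by positivity)]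
    have e : ((k : ℕ) + 2 : ℝ) ^ 2 * (((N : ℝ) + 1) / N * (1 / (((k : ℕ) + 1) * ((k : ℕ) + 2)))) =
        (((k : ℕ) + 2 : ℝ) / ((k : ℕ) + 1)) * ((N + 1) / N) := by
      field_simp
    rw [e]
    have h1 : (1 : ℝ) ≤ ((k : ℕ) + 2 : ℝ) / ((k : ℕ) + 1) := by
      rw [one_le_div (by positivity)]; linarith
    have h2 : (1 : ℝ) ≤ ((N : ℝ) + 1) / N := by
      rw [one_le_div hN]; linarith
    nlinarith
  have hk : ((k : ℕ) : ℝ) + 1 ≤ 2 ^ (k : ℕ) := by exact_mod_cast Nat.lt_two_pow_self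
  calc Real.log (1 / I.init.wts k) ≤ Real.log (((k : ℕ) + 2 : ℝ) ^ 2) :=
        Real.log_le_log (one_div_pos.2 (I.init_wts_pos k)) hle
    _ = 2 * Real.log ((k : ℕ) + 2 : ℝ) := by rw [Real.log_pow]; norm_num
    _ ≤ 2 * (((k : ℕ) + 2 : ℝ) - 1) := by
        gcongr
        exact Real.log_le_sub_one_of_pos (by positivity)
    _ ≤ _ := by linarith

/-- Along directions of norm at most one the regret depends on the values of the losses on the unit
ball only. -/
theorem IsBallInput.dynRegret_congr {I : Input d N} (hI : IsBallInput I) (hμ : 0 ≤ I.μ)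
    (hμα : I.μ ≤ I.α) {f f' : ℕ → Vec d → ℝ} {T : ℕ}
    (hff : ∀ t < T, ∀ x, ‖x‖ ≤ 1 → f t x = f' t x) {u s : ℕ → Vec d} (hu : ∀ t ≤ T, ‖u t‖ ≤ 1)
    (hs : ∀ t, ‖s t‖ ≤ 1) : I.dynRegret T f u s = I.dynRegret T f' u s := by
  have hn : ∀ t, ‖(I.state f' s t).decision‖ + ‖I.μ • s t‖ ≤ 1 := fun t => by
    have h1 := hI.norm_decision_le f' s t
    have h2 : ‖I.μ • s t‖ ≤ I.μ := by
      rw [norm_smul, Real.norm_of_nonneg hμ]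
      exact mul_le_of_le_one_right hμ (hs t)
    linarith
  have hp : ∀ t < T, f t ((I.state f' s t).decision + I.μ • s t) =
      f' t ((I.state f' s t).decision + I.μ • s t) := fun t ht =>
    hff t ht _ ((norm_add_le _ _).trans (hn t))
  have hm : ∀ t < T, f t ((I.state f' s t).decision - I.μ • s t) =
      f' t ((I.state f' s t).decision - I.μ • s t) := fun t ht =>
    hff t ht _ ((norm_sub_le _ _).trans (hn t))
  refine Finset.sum_congr rfl fun t ht => ?_
  have htT := Finset.mem_range.1 ht
  have hst : I.state f s t = I.state f' s t := I.state_congr_loss fun i hi =>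
    ⟨hp i (hi.trans htT), hm i (hi.trans htT)⟩
  rw [Input.xPlus, Input.xMinus, Input.xPlus, Input.xMinus, hst, hp t htT, hm t htT,
    hff t htT _ (hu t htT.le)]

theorem exists_lipschitz_extension {f : Vec d → ℝ} {G : ℝ} (hG : 0 ≤ G)
    (hf : ∀ x ∈ unitBall d, ∀ y ∈ unitBall d, |f x - f y| ≤ G * ‖x - y‖) :
    ∃ g : Vec d → ℝ, (∀ x y, |g x - g y| ≤ G * ‖x - y‖) ∧ EqOn f g (unitBall d) := by
  have hL : LipschitzOnWith G.toNNReal f (unitBall d) :=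
    LipschitzOnWith.of_dist_le_mul fun x hx y hy => by
      rw [Real.dist_eq, dist_eq_norm, Real.coe_toNNReal _ hG]
      exact hf x hx y hy
  obtain ⟨g, hg, he⟩ := hL.extend_real
  refine ⟨g, fun x y => ?_, he⟩
  have := hg.dist_le_mul x y
  rwa [Real.dist_eq, dist_eq_norm, Real.coe_toNNReal _ hG] at this

end BCO

theorem mainTheorem2 (c₁ c₂ c₃ : ℝ) (hc₁ : 0 < c₁) (hc₂ : c₁ ≤ c₂) (hc₃ : 0 < c₃) :
    ∃ C : ℝ, 0 < C ∧
      ∀ (d T : ℕ), 3 ≤ d → 1 ≤ T →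
      ∀ (G : ℝ), 0 < G →
      ∀ (B : ℝ), 0 ≤ B → B ≤ 2 →
      ∀ (N : ℕ) (I : BCO.Input d N), BCO.EuclideanSetting c₁ c₂ c₃ d T G B I →
      ∀ (f : ℕ → BCO.Vec d → ℝ),
        (∀ t < T, ConvexOn ℝ (BCO.unitBall d) (f t)) →
        (∀ t < T, ∀ x ∈ BCO.unitBall d, ∀ y ∈ BCO.unitBall d, |f t x - f t y| ≤ G * ‖x - y‖) →
      ∀ (u : ℕ → BCO.Vec d), (∀ t ≤ T, u t ∈ BCO.unitBall d) →
      ∀ (Ω : Type*) [MeasurableSpace Ω] (P : MeasureTheory.Measure Ω)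
        [MeasureTheory.IsProbabilityMeasure P] (s : ℕ → Ω → BCO.Vec d),
        (∀ t, Measurable (s t)) →
        (∀ t, P.map (s t) = BCO.unifL1Sphere d) →
        ProbabilityTheory.iIndepFun s P →
        MeasureTheory.Integrable (fun ω => I.dynRegret T f u (fun t => s t ω)) P ∧
        ∫ ω, I.dynRegret T f u (fun t => s t ω) ∂P ≤
          C * (G * √(d * T * (1 + BCO.pathVar T u))) := by
  have hc₂0 : 0 < c₂ := hc₁.trans_le hc₂
  -- The summands come from the prior weight of the chosen learner, from its distance to the
  -- comparators, from the second moments of the gradient estimates, and from `μ` and `α`.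
  refine ⟨2 / c₁ + 36 + 1000 * c₂ + 250 + 5 * c₃, by positivity, ?_⟩
  intro d T hd3 hT G hG B hB0 hB2 N I hset f hcv hf u hu Ω _ P _ s hs hsu hind
  have hd : 0 < d := by omega
  have hd' : (0 : ℝ) < d := by exact_mod_cast hd
  have hT' : (0 : ℝ) < T := by exact_mod_cast hT
  have hI := hset.isBallInput hc₁ hd hT hG hB0 hB2
  have hu1 : ∀ t ≤ T, ‖u t‖ ≤ 1 := hu
  have hsd : 1 ≤ √(d : ℝ) := by
    rw [Real.one_le_sqrt]; exact_mod_cast hd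
  have hμ := hset.μ_pos
  have hα : I.α = 2 * (I.μ * √d) := by
    have h := hset.μ_α
    rw [show (1 : ℝ) - 1 / 2 = 1 / 2 by norm_num, ← Real.sqrt_eq_rpow] at h
    linarith
  have hμd : I.μ ≤ I.μ * √d := le_mul_of_one_le_right hμ.le hsd
  have hμα : I.μ < I.α := by linarith
  -- globally Lipschitz losses with the same values on the unit ball
  have hex : ∀ t, ∃ g : BCO.Vec d → ℝ, (∀ x y, |g x - g y| ≤ G * ‖x - y‖) ∧
      ConvexOn ℝ (BCO.unitBall d) g ∧ (t < T → Set.EqOn (f t) g (BCO.unitBall d)) := by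
    intro t
    by_cases ht : t < T
    · obtain ⟨g, hg, he⟩ := BCO.exists_lipschitz_extension hG.le (hf t ht)
      exact ⟨g, hg, (hcv t ht).congr he, fun _ => he⟩
    · refine ⟨fun _ => 0, fun x y => by simp; positivity, convexOn_const 0 ?_, fun h => absurd h ht⟩
      have : BCO.unitBall d = Metric.closedBall 0 1 := by
        ext x; simp [BCO.unitBall]
      rw [this]
      exact convex_closedBall _ _
  choose f' hf'L hf'cv hff' using hex
  have hae : (fun ω => I.dynRegret T f u (fun t => s t ω)) =ᵐ[P]
      fun ω => I.dynRegret T f' u (fun t => s t ω) := by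
    filter_upwards [MeasureTheory.ae_all_iff.2 fun t =>
      BCO.ae_norm_le_one_of_map_eq hd (hs t) (hsu t)] with ω hω
    exact hI.dynRegret_congr hμ.le hμα.le (fun t ht x hx => hff' t ht hx) hu1 hω
  have hp0 := BCO.pathVar_nonneg T u
  have hp2 : BCO.pathVar T u ≤ 2 * T := by
    refine (Finset.sum_le_card_nsmul _ _ 2 fun t ht => ?_).trans (by simp [mul_comm])
    have h1 := hu1 t (Finset.mem_range.1 ht).le
    have h2 := hu1 (t + 1) (Finset.mem_range.1 ht)
    exact (norm_sub_le _ _).trans (by linarith)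
  obtain ⟨j, hjN, hj1, hj2⟩ := BCO.exists_learner hB0 hB2 hp0 hp2
  obtain ⟨κ, hκ1, hκ2, hstep⟩ := BCO.exists_stepSize_eq hd hT hG hB0 hB2
  have hN := hset.N_eq
  rw [BCO.oscOn_unitBall_halfSq hd, BCO.gradBound_unitBall_halfSq hd] at hN
  set k : Fin N := ⟨j, hN ▸ hjN⟩ with hk
  have hηk : I.η k = 2 ^ j * (κ / (G * √(d * T))) := by
    rw [hset.η_eq, BCO.oscOn_unitBall_halfSq hd, BCO.xiC_two_two, hstep]
  obtain ⟨hint, hbound⟩ := hI.integral_dynRegret_le hd hμ hμα hG.le hf'L hf'cv hu1 hs hsu hind k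
  refine ⟨hint.congr hae.symm, ?_⟩
  rw [MeasureTheory.integral_congr_ae hae]
  refine hbound.trans ?_
  rw [Real.sqrt_mul (by positivity)]
  set Λ := √((d : ℝ) * T) with hΛ
  set S := √(1 + BCO.pathVar T u) with hS
  have hΛ0 : 0 < Λ := Real.sqrt_pos.2 (by positivity)
  have hΛsq : Λ ^ 2 = d * T := Real.sq_sqrt (by positivity)
  have hS1 : 1 ≤ S := by rw [hS, Real.one_le_sqrt]; linarith
  have hSsq : S ^ 2 = 1 + BCO.pathVar T u := Real.sq_sqrt (by positivity)
  have hγlo : c₁ / (G * Λ) ≤ I.γ := by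
    have := hset.le_γ
    rwa [BCO.gammaOrder, BCO.xiC_two_two, one_mul, mul_one_div] at this
  have hγhi : I.γ ≤ c₂ / (G * Λ) := by
    have := hset.γ_le
    rwa [BCO.gammaOrder, BCO.xiC_two_two, one_mul, mul_one_div] at this
  have hη0 := hI.η_pos k
  have hκ0 : 0 < κ := by linarith
  have t1 : Real.log (1 / I.init.wts k) / I.γ ≤ 2 / c₁ * (G * (Λ * S)) := by
    calc Real.log (1 / I.init.wts k) / I.γ ≤ 2 * S / (c₁ / (G * Λ)) := by
          have := BCO.log_inv_init_wts_le I k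
          gcongr
          linarith
      _ = _ := by field_simp
  have t2 : (2 + 2 * BCO.pathVar T u) / I.η k ≤ 36 * (G * (Λ * S)) := by
    have hlow : S / 2 * (1 / 9 / (G * Λ)) ≤ I.η k := by
      rw [hηk]
      gcongr
      linarith
    calc (2 + 2 * BCO.pathVar T u) / I.η k ≤ (2 * S ^ 2) / (S / 2 * (1 / 9 / (G * Λ))) := by
          rw [hSsq, mul_add, mul_one]
          gcongr
      _ = _ := by field_simp; norm_num
  have t3 : (2 * I.γ + I.η k / 2) * (T * (500 * d * G ^ 2)) ≤
      (1000 * c₂ + 250) * (G * (Λ * S)) := by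
    have hup : I.η k ≤ S * (1 / (G * Λ)) := by
      rw [hηk]
      gcongr
    have hγS : I.γ ≤ c₂ * S / (G * Λ) :=
      hγhi.trans (by gcongr; exact le_mul_of_one_le_right hc₂0.le hS1)
    calc (2 * I.γ + I.η k / 2) * (T * (500 * d * G ^ 2))
        ≤ (2 * (c₂ * S / (G * Λ)) + S * (1 / (G * Λ)) / 2) * (T * (500 * d * G ^ 2)) := by
          gcongr
      _ = (2 * (c₂ * S / (G * Λ)) + S * (1 / (G * Λ)) / 2) * (500 * Λ ^ 2 * G ^ 2) := by
          rw [hΛsq]; ring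
      _ = _ := by field_simp; ring
  have t4 : T * (G * (3 * I.μ + I.α)) ≤ 5 * c₃ * (G * (Λ * S)) := by
    have hsT : 0 < √(T : ℝ) := Real.sqrt_pos.2 hT'
    have hμle : I.μ ≤ c₃ * (1 / √T) := by
      refine hset.μ_le.trans ?_
      rw [BCO.oscOn_unitBall_halfSq hd, BCO.xiC_two_two, BCO.upsilonC_two_two]
      gcongr
      exact BCO.muOrder_le hd hT hB2
    have hTT : (T : ℝ) = √T * √T := (Real.mul_self_sqrt hT'.le).symm
    have hΛ2 : Λ = √d * √T := Real.sqrt_mul hd'.le _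
    calc T * (G * (3 * I.μ + I.α)) ≤ T * (G * (5 * (I.μ * √d))) := by
          gcongr
          linarith
      _ ≤ T * (G * (5 * (c₃ * (1 / √T) * √d))) := by gcongr
      _ = 5 * c₃ * (G * Λ) := by
          rw [hΛ2]
          nth_rewrite 1 [hTT]
          field_simp
      _ ≤ 5 * c₃ * (G * (Λ * S)) := by
          gcongr
          exact le_mul_of_one_le_right hΛ0.le hS1
  linarith
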